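/- Let $n\ge 1$, $m\ge 0$ be integers and let $(M,\theta)$ be a strictly pseudoconvex CR manifold of real dimension $2n+1$: a smooth (Hausdorff, second countable) manifold without boundary, with a nowhere vanishing smooth 1-form $\theta$, an integrable complex structure $J$ on the Levi distribution $H(M)=\ker\theta$, and Levi form $G_\theta(X,Y)=-d\theta(JX,Y)$ positive definite on $H(M)$. Let $\xi$ be the Reeb field of $\theta$, $g_\theta=G_\theta+\theta\otimes\theta$ the Webster metric, $\vartheta_\theta$ its volume measure, $\nabla$ the Tanaka–Webster connection, and $\Delta_b u=\mathrm{trace}_{G_\theta}\nabla du$ the sub-Laplacian. Let $\mathbb H^m=\mathbb R^{2m+1}$ be the Heisenberg group with coordinates $(x,y,t)$, with contact form $\theta_{\mathbb H^m}=dt+2\sum_j(x_j\,dy_j-y_j\,dx_j)$, Levi distribution $H(\mathbb H^m)=\ker\theta_{\mathbb H^m}$ and Webster metric $g_{\mathbb H^m}=4\sum_j(dx_j^2+dy_j^2)+\theta_{\mathbb H^m}^2$. Let $f:M\to\mathbb H^m$ be a $C^2$ map which is semi-isometric, i.e. $|df(X)|_{\mathbb H^m}=|X|_{G_\theta}$ and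 $\langle df(X),df(\xi)\rangle_{\mathbb H^m}=0$ for all $X\in H(M)$, and which satisfies $df(H(M))\subseteq H(\mathbb H^m)$. Let $H_b(f)=\sum_{i=1}^{2n}\big(\nabla^f_{X_i}df(X_i)-df(\nabla_{X_i}X_i)\big)$ be its Levi tension, where $\{X_i\}$ is a local $G_\theta$-orthonormal frame of $H(M)$ and $\nabla^f$ is induced by the Levi-Civita connection of $g_{\mathbb H^m}$; $|H_b(f)|_{\mathbb H^m}$ is its length in $g_{\mathbb H^m}$. Let $\Omega\subset M$ be a bounded domain (open, connected, with compact closure; $\Omega=M$ is allowed if $M$ is compact) and $V\in L^1_{\rm loc}(\Omega)$ a real function such that the operator $-\Delta_b+V$ in $\Omega$, with Dirichlet boundary conditions if $\Omega\neq M$, has discrete spectrum bounded from below. Here the form domain is the closure of the compactly supported $C^2$ functions on $\Omega$ for the norm $\big(\int_\Omega(|\nabla^Hu|_{G_\theta}^2+(1+|V|)u^2)\,\vartheta_\theta\big)^{1/2}$, and the equation $(-\Delta_b+V)u=\lambda u$ is understood in the sense of distributions for $u$ in this form domain. Let $\lambda_1\le\lambda_2\le\cdots\to\infty$ be the eigenvalues,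 repeated according to multiplicity, and $\{u_i\}_{i\ge1}$ a complete orthonormal family in $L^2(\Omega,\vartheta_\theta)$ of corresponding eigenfunctions. Then for every integer $k\ge 1$ and every $p\in\mathbb R$, $$\sum_{i=1}^k(\lambda_{k+1}-\lambda_i)^p\le\frac{\max\{2,p\}}{n}\sum_{i=1}^k(\lambda_{k+1}-\lambda_i)^{p-1}\Big(\lambda_i+\frac14D_i\Big),\qquad D_i=\int_\Omega\big(|H_b(f)|^2_{\mathbb H^m}-4V\big)u_i^2\,\vartheta_\theta,$$ where the integrals $D_i$ converge, where $0^0=1$ in the case $p=1$, and where, if $p<1$, the terms with $\lambda_i=\lambda_{k+1}$ (in which negative powers of $0$ occur) are omitted from both sums. Moreover, if $V$ is bounded below on $\Omega$, then $D_\infty=\sup_\Omega\big(|H_b(f)|^2_{\mathbb H^m}-4V\big)$ is finite and, for every $k\ge1$, $$\lambda_{k+1}\le\Big(1+\frac2n\Big)\frac1k\sum_{i=1}^k\lambda_i+\frac1{2n}D_\infty$$ and $$\lambda_{k+1}\le\Big(1+\frac2n\Big)k^{1/n}\lambda_1+\frac14\Big(\Big(1+\frac2n\Big)k^{1/n}-1\Big)D_\infty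 .$$ -/

import Mathlib

open Set Filter Topology MeasureTheory
open scoped Manifold ContDiff ENNReal Bundle

noncomputable section

/-- The model space `ℝ^(2n+1)`. -/
abbrev ModelE (n : ℕ) : Type := EuclideanSpace ℝ (Fin (2 * n + 1))

section CR

variable (n : ℕ) (M : Type*) [TopologicalSpace M] [ChartedSpace (ModelE n) M]
  [IsManifold (𝓡 (2 * n + 1)) ∞ M]

/-- Vector fields on `M`, without regularity. -/
abbrev VField : Type _ := (x : M) → TangentSpace (𝓡 (2 * n + 1)) x

variable {n M}

/-- A vector field is smooth as a section of the tangent bundle. -/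
def SmoothField (X : VField n M) : Prop :=
  ContMDiff (𝓡 (2 * n + 1)) (𝓡 (2 * n + 1)).tangent ∞
    (fun x => (⟨x, X x⟩ : TangentBundle (𝓡 (2 * n + 1)) M))

/-- The derivative of `u` at `x` in the direction `v`. -/
def dirDeriv {F : Type*} [NormedAddCommGroup F] [NormedSpace ℝ F] (u : M → F) (x : M)
    (v : TangentSpace (𝓡 (2 * n + 1)) x) : F :=
  mvfderiv (𝓡 (2 * n + 1)) u x v

/-- The Lie bracket `[X, Y]` of vector fields. -/
def bracket (X Y : VField n M) : VField n M :=
  VectorField.mlieBracket (𝓡 (2 * n + 1)) X Y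

/-- A local extension of a tangent vector at `x` to a vector field which is smooth near `x`
(constant in the preferred chart at `x`). -/
def extendVec {x : M} (v : TangentSpace (𝓡 (2 * n + 1)) x) : VField n M :=
  FiberBundle.extend (ModelE n) v

/-- The exterior derivative of a 1-form, `dα(V, W) = V(α(W)) - W(α(V)) - α([V, W])`, evaluated
on two tangent vectors at `x` through local extensions. -/
def extDerivOneForm (α : (x : M) → TangentSpace (𝓡 (2 * n + 1)) x →L[ℝ] ℝ) (x : M)
    (v w : TangentSpace (𝓡 (2 * n + 1)) x) : ℝ :=
  dirDeriv (fun y => α y (extendVec w y)) x v - dirDeriv (fun y => α y (extendVec v y)) x w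
    - α x (bracket (extendVec v) (extendVec w) x)

variable (n M) in
/-- A strictly pseudoconvex CR manifold `(M, θ)` of real dimension `2n+1`: a nowhere vanishing
smooth 1-form `θ`, the Levi distribution `H(M) = ker θ`, an integrable complex structure `J` on
`H(M)`, and positivity of the Levi form `G_θ(v, w) = -dθ(Jv, w)` on `H(M)`.

The complex structure is given as the restriction to `H(M)` of a smooth field `J` of
endomorphisms of `TM` that preserves `H(M)`; the values of `J` off `H(M)` are never used. -/
structure StrictlyPseudoconvexCR where
  /-- the pseudo-Hermitian structure -/
  theta : (x : M) → TangentSpace (𝓡 (2 * n + 1)) x →L[ℝ] ℝ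
  /-- the complex structure on `ker θ` -/
  J : (x : M) → TangentSpace (𝓡 (2 * n + 1)) x →L[ℝ] TangentSpace (𝓡 (2 * n + 1)) x
  smooth_theta : ContMDiff (𝓡 (2 * n + 1)) ((𝓡 (2 * n + 1)).prod 𝓘(ℝ, ModelE n →L[ℝ] ℝ)) ∞
    (fun x => Bundle.TotalSpace.mk' (ModelE n →L[ℝ] ℝ)
      (E := fun x : M => TangentSpace (𝓡 (2 * n + 1)) x →L[ℝ] Bundle.Trivial M ℝ x) x (theta x))
  smooth_J : ContMDiff (𝓡 (2 * n + 1))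
    ((𝓡 (2 * n + 1)).prod 𝓘(ℝ, ModelE n →L[ℝ] ModelE n)) ∞
    (fun x => Bundle.TotalSpace.mk' (ModelE n →L[ℝ] ModelE n)
      (E := fun x : M => TangentSpace (𝓡 (2 * n + 1)) x →L[ℝ] TangentSpace (𝓡 (2 * n + 1)) x)
      x (J x))
  theta_ne_zero : ∀ x, theta x ≠ 0
  J_mem : ∀ (x : M) (v : TangentSpace (𝓡 (2 * n + 1)) x), theta x v = 0 → theta x (J x v) = 0
  J_sq : ∀ (x : M) (v : TangentSpace (𝓡 (2 * n + 1)) x), theta x v = 0 → J x (J x v) = -v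
  /-- `[X, Y] - [JX, JY]` is horizontal for horizontal `X`, `Y`. -/
  integrable_mem : ∀ X Y : VField n M, SmoothField X → SmoothField Y →
    (∀ x, theta x (X x) = 0) → (∀ x, theta x (Y x) = 0) → ∀ x,
      theta x (bracket X Y x - bracket (fun y => J y (X y)) (fun y => J y (Y y)) x) = 0
  /-- `[JX, Y] + [X, JY] = J([X, Y] - [JX, JY])` for horizontal `X`, `Y`. -/
  integrable_eq : ∀ X Y : VField n M, SmoothField X → SmoothField Y →
    (∀ x, theta x (X x) = 0) → (∀ x, theta x (Y x) = 0) → ∀ x,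
      bracket (fun y => J y (X y)) Y x + bracket X (fun y => J y (Y y)) x =
        J x (bracket X Y x - bracket (fun y => J y (X y)) (fun y => J y (Y y)) x)
  levi_pos : ∀ (x : M) (v : TangentSpace (𝓡 (2 * n + 1)) x), theta x v = 0 → v ≠ 0 →
    0 < -extDerivOneForm theta x (J x v) v

namespace StrictlyPseudoconvexCR

variable (S : StrictlyPseudoconvexCR n M)

/-- The Levi form `G_θ(v, w) = -dθ(Jv, w)` (meaningful for horizontal `v`, `w`). -/
def levi (x : M) (v w : TangentSpace (𝓡 (2 * n + 1)) x) : ℝ :=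
  -extDerivOneForm S.theta x (S.J x v) w

/-- The Reeb vector field: the unique `ξ` with `θ(ξ) = 1` and `dθ(ξ, ·) = 0`. -/
def reeb (x : M) : TangentSpace (𝓡 (2 * n + 1)) x :=
  Classical.epsilon fun v => S.theta x v = 1 ∧ ∀ w, extDerivOneForm S.theta x v w = 0

/-- The projection `v ↦ v^H` onto `H(M)` along the Reeb field. -/
def hproj (x : M) (v : TangentSpace (𝓡 (2 * n + 1)) x) : TangentSpace (𝓡 (2 * n + 1)) x :=
  v - S.theta x v • S.reeb x

/-- The Webster metric `g_θ(v, w) = G_θ(v^H, w^H) + θ(v) θ(w)`. -/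
def webster (x : M) (v w : TangentSpace (𝓡 (2 * n + 1)) x) : ℝ :=
  S.levi x (S.hproj x v) (S.hproj x w) + S.theta x v * S.theta x w

/-- `e` is a `G_θ`-orthonormal basis of the (`2n`-dimensional) space `H_x(M)`. -/
def IsHorizontalONB (x : M) (e : Fin (2 * n) → TangentSpace (𝓡 (2 * n + 1)) x) : Prop :=
  (∀ i, S.theta x (e i) = 0) ∧ ∀ i j, S.levi x (e i) (e j) = if i = j then 1 else 0

/-- A chosen `G_θ`-orthonormal basis of `H_x(M)`, used to write traces with respect to `G_θ`;
it is not assumed to depend continuously on `x`. -/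
def onb (x : M) : Fin (2 * n) → TangentSpace (𝓡 (2 * n + 1)) x :=
  Classical.epsilon fun e => S.IsHorizontalONB x e

/-- A horizontal vector field, smooth near `x`, with value `v` at `x` (for horizontal `v`). -/
def hextend {x : M} (v : TangentSpace (𝓡 (2 * n + 1)) x) : VField n M :=
  fun y => S.hproj y (extendVec v y)

/-- The Koszul expression `g_θ(∇_X Y, Z)` of the Levi-Civita connection of the Webster metric. -/
def koszul (X Y Z : VField n M) (x : M) : ℝ :=
  (1 / 2) *
    (dirDeriv (fun y => S.webster y (Y y) (Z y)) x (X x)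
      + dirDeriv (fun y => S.webster y (X y) (Z y)) x (Y x)
      - dirDeriv (fun y => S.webster y (X y) (Y y)) x (Z x)
      + S.webster x (bracket X Y x) (Z x)
      - S.webster x (bracket X Z x) (Y x)
      - S.webster x (bracket Y Z x) (X x))

/-- The Tanaka-Webster derivative `∇_v Y` of a horizontal vector field `Y` in a horizontal
direction `v` at `x`. It is the horizontal part of the Levi-Civita derivative of the Webster
metric. (`∇` preserves `H(M)`, `∇ G_θ = 0`, and `∇_X Y - ∇_Y X - [X, Y]` is a multiple of the
Reeb field for horizontal `X`, `Y`, so `G_θ(∇_X Y, Z)` is given by the Koszul formula for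
horizontal `Z`.) -/
def tanakaWebster (Y : VField n M) (x : M) (v : TangentSpace (𝓡 (2 * n + 1)) x) :
    TangentSpace (𝓡 (2 * n + 1)) x :=
  ∑ k, S.koszul (extendVec v) Y (extendVec (S.onb x k)) x • S.onb x k

/-- The sub-Laplacian `Δ_b u = trace_{G_θ} ∇du`, with `∇du(X, Y) = X(Y u) - (∇_X Y) u`. -/
def subLaplacian (u : M → ℝ) (x : M) : ℝ :=
  ∑ i, (dirDeriv (fun y => dirDeriv u y (S.hextend (S.onb x i) y)) x (S.onb x i)
    - dirDeriv u x (S.tanakaWebster (S.hextend (S.onb x i)) x (S.onb x i)))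

/-- The horizontal gradient: `∇^H u ∈ H(M)` and `G_θ(X, ∇^H u) = X u` for `X ∈ H(M)`. -/
def hgrad (u : M → ℝ) (x : M) : TangentSpace (𝓡 (2 * n + 1)) x :=
  ∑ i, dirDeriv u x (S.onb x i) • S.onb x i

/-- The density, in the chart at `c`, of the Riemannian volume of the Webster metric. -/
def chartDensity (c : M) (y : ModelE n) : ℝ≥0∞ :=
  ENNReal.ofReal <| Real.sqrt <| Matrix.det <| Matrix.of fun i j : Fin (2 * n + 1) =>
    S.webster ((extChartAt (𝓡 (2 * n + 1)) c).symm y)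
      (mfderiv 𝓘(ℝ, ModelE n) (𝓡 (2 * n + 1)) (extChartAt (𝓡 (2 * n + 1)) c).symm y
        (EuclideanSpace.single i (1 : ℝ) : ModelE n))
      (mfderiv 𝓘(ℝ, ModelE n) (𝓡 (2 * n + 1)) (extChartAt (𝓡 (2 * n + 1)) c).symm y
        (EuclideanSpace.single j (1 : ℝ) : ModelE n))

/-- The volume measure of `(M, θ)` restricted to the domain of the chart at `c`. -/
def chartVolume [MeasurableSpace M] (c : M) : Measure M :=
  Measure.map (extChartAt (𝓡 (2 * n + 1)) c).symm
    ((volume.restrict (extChartAt (𝓡 (2 * n + 1)) c).target).withDensity (S.chartDensity c))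

/-- The volume measure of `(M, θ)`, i.e. the Riemannian volume of the Webster metric: the
measure whose restriction to the domain of the chart at `c` is `chartVolume c`, obtained by
gluing as the least measure above all of these. -/
def vol [MeasurableSpace M] : Measure M := ⨆ c : M, S.chartVolume c

end StrictlyPseudoconvexCR

/-! ### The Heisenberg group as the target -/

/-- The Heisenberg group `ℍ^m = ℝ^(2m+1)`, with coordinates `(x, y, t)`, `z = x + iy`. -/
abbrev Heis (m : ℕ) : Type := (Fin m → ℝ) × (Fin m → ℝ) × ℝ

namespace Heis

/-- The contact form `dt + 2 ∑ (x_j dy_j - y_j dx_j)` at `p`, on `a`. -/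
def theta {m : ℕ} (p a : Heis m) : ℝ :=
  a.2.2 + 2 * ∑ j, (p.1 j * a.2.1 j - p.2.1 j * a.1 j)

/-- The Webster metric of `ℍ^m`: the left-invariant fields `X_j`, `Y_j` have length `2`,
`T = ∂_t` has length `1`, and all of these are orthogonal. -/
def metric {m : ℕ} (p a b : Heis m) : ℝ :=
  4 * ∑ j, (a.1 j * b.1 j + a.2.1 j * b.2.1 j) + theta p a * theta p b

/-- `X_j = ∂_{x_j} + 2 y_j ∂_t`. -/
def X {m : ℕ} (j : Fin m) (p : Heis m) : Heis m := (Pi.single j 1, 0, 2 * p.2.1 j)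

/-- `Y_j = ∂_{y_j} - 2 x_j ∂_t`. -/
def Y {m : ℕ} (j : Fin m) (p : Heis m) : Heis m := (0, Pi.single j 1, -2 * p.1 j)

/-- `T = ∂_t`. -/
def T {m : ℕ} : Heis m := (0, 0, 1)

/-- The Christoffel symbols of the first kind of the metric, on constant vector fields. -/
def christoffelFirst {m : ℕ} (p a b c : Heis m) : ℝ :=
  (1 / 2) * (fderiv ℝ (fun q => metric q b c) p a + fderiv ℝ (fun q => metric q a c) p b
    - fderiv ℝ (fun q => metric q a b) p c)

/-- The Levi-Civita connection `∇_a B = D_a B + Γ_p(a, B)` of the metric; `Γ_p(a, b)` is expanded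
in the orthonormal frame `X_j / 2`, `Y_j / 2`, `T`. -/
def christoffel {m : ℕ} (p a b : Heis m) : Heis m :=
  ∑ j, ((1 / 4 : ℝ) • (christoffelFirst p a b (X j p) • X j p)
      + (1 / 4 : ℝ) • (christoffelFirst p a b (Y j p) • Y j p))
    + christoffelFirst p a b T • T

end Heis

namespace StrictlyPseudoconvexCR

variable (S : StrictlyPseudoconvexCR n M)

/-- `f : (M, θ) → ℍ^m` is semi-isometric: `|df(X)| = |X|_{G_θ}` and `df(X) ⊥ df(ξ)` for
horizontal `X`. -/
def SemiIsometric {m : ℕ} (f : M → Heis m) : Prop :=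
  ∀ (x : M) (v : TangentSpace (𝓡 (2 * n + 1)) x), S.theta x v = 0 →
    Heis.metric (f x) (dirDeriv f x v) (dirDeriv f x v) = S.levi x v v ∧
    Heis.metric (f x) (dirDeriv f x v) (dirDeriv f x (S.reeb x)) = 0

/-- `df(H(M)) ⊆ H(ℍ^m)`. -/
def PreservesHorizontal {m : ℕ} (f : M → Heis m) : Prop :=
  ∀ (x : M) (v : TangentSpace (𝓡 (2 * n + 1)) x), S.theta x v = 0 →
    Heis.theta (f x) (dirDeriv f x v) = 0

/-- `β_f(v, w) = ∇^f_v df(W) - df(∇_v W)`, with `W` a horizontal extension of `w`, `∇^f` the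
pull-back of the Levi-Civita connection of `ℍ^m`, and `∇` the Tanaka-Webster connection. -/
def beta {m : ℕ} (f : M → Heis m) (x : M) (v w : TangentSpace (𝓡 (2 * n + 1)) x) : Heis m :=
  dirDeriv (fun y => dirDeriv f y (S.hextend w y)) x v
    + Heis.christoffel (f x) (dirDeriv f x v) (dirDeriv f x w)
    - dirDeriv f x (S.tanakaWebster (S.hextend w) x v)

/-- The Levi tension `H_b(f) = trace_{G_θ} β_f`. -/
def leviTension {m : ℕ} (f : M → Heis m) (x : M) : Heis m :=
  ∑ i, S.beta f x (S.onb x i) (S.onb x i)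

/-- `|H_b(f)|²` in the Webster metric of `ℍ^m`. -/
def leviTensionSq {m : ℕ} (f : M → Heis m) (x : M) : ℝ :=
  Heis.metric (f x) (S.leviTension f x) (S.leviTension f x)

/-! ### The operator `-Δ_b + V` with Dirichlet boundary conditions -/

/-- Test functions on `Ω`: functions of class `C²` with compact support contained in `Ω`. -/
def IsTest (n : ℕ) {M : Type*} [TopologicalSpace M] [ChartedSpace (ModelE n) M]
    (Ω : Set M) (φ : M → ℝ) : Prop :=
  ContMDiff (𝓡 (2 * n + 1)) 𝓘(ℝ, ℝ) 2 φ ∧ HasCompactSupport φ ∧ tsupport φ ⊆ Ω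

/-- The form domain of `-Δ_b + V` in `Ω` with Dirichlet boundary conditions: the closure of the
test functions in `L²(Ω)` for the norm `(∫_Ω |∇^H u|² + (1 + |V|) u²)^(1/2)`. -/
def InFormDomain [MeasurableSpace M] (Ω : Set M) (V : M → ℝ) (u : M → ℝ) : Prop :=
  MemLp u 2 (S.vol.restrict Ω) ∧
  ∃ φ : ℕ → M → ℝ, (∀ k, IsTest n Ω (φ k)) ∧
    Tendsto (fun k => ∫⁻ x in Ω, ENNReal.ofReal ((1 + |V x|) * (φ k x - u x) ^ 2) ∂S.vol)
      atTop (𝓝 0) ∧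
    Tendsto (fun kl : ℕ × ℕ => ∫⁻ x in Ω, ENNReal.ofReal
        (S.levi x (S.hgrad (φ kl.1 - φ kl.2) x) (S.hgrad (φ kl.1 - φ kl.2) x)) ∂S.vol)
      (atTop ×ˢ atTop) (𝓝 0)

/-- `u` solves `-Δ_b u + V u = μ u` in `Ω` with Dirichlet boundary conditions: it lies in the form
domain, and the equation holds tested against test functions. -/
def IsDirichletSolution [MeasurableSpace M] (Ω : Set M) (V : M → ℝ) (μ : ℝ) (u : M → ℝ) : Prop :=
  S.InFormDomain Ω V u ∧ ∀ φ : M → ℝ, IsTest n Ω φ →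
    ∫ x in Ω, u x * (-S.subLaplacian φ x + V x * φ x) ∂S.vol = μ * ∫ x in Ω, u x * φ x ∂S.vol

/-- The operator `-Δ_b + V` in `Ω` with Dirichlet boundary conditions has discrete spectrum
bounded from below; `lam 0 ≤ lam 1 ≤ ⋯` is the sequence of its eigenvalues repeated according to
multiplicity (so `lam j` is `λ_{j+1}`), and `u 0, u 1, …` is a complete orthonormal family
in `L²(Ω)` of corresponding eigenfunctions. -/
structure IsDirichletSpectrum [MeasurableSpace M] (Ω : Set M) (V : M → ℝ) (lam : ℕ → ℝ)
    (u : ℕ → M → ℝ) : Prop where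
  mono : Monotone lam
  discrete : Tendsto lam atTop atTop
  eigen : ∀ j, S.IsDirichletSolution Ω V (lam j) (u j)
  orthonormal : ∀ i j, ∫ x in Ω, u i x * u j x ∂S.vol = if i = j then 1 else 0
  complete : ∀ g : M → ℝ, MemLp g 2 (S.vol.restrict Ω) →
    (∀ j, ∫ x in Ω, g x * u j x ∂S.vol = 0) → ∀ᵐ x ∂S.vol.restrict Ω, g x = 0

end StrictlyPseudoconvexCR
end CR
end

/-!
# Eigenvalue inequalities for `-Δ_b + V` on CR manifolds mapped into the Heisenberg group

The argument commutes the operator `L = -Δ_b + V` with the functions `2 x_j ∘ f` and `2 y_j ∘ f`,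
denoted `F_α`. Write `Γ(φ, ψ) = ⟨∇^H φ, ∇^H ψ⟩`. Since `f` is horizontal and semi-isometric,
* `∑ Γ(F_α, φ) Γ(F_α, ψ) = Γ(φ, ψ)` and `∑ Γ(F_α, F_α) = 2n` (`sum_carre_mul_carre`,
  `sum_carre_self`);
* `∑ (Δ_b F_α)² = |H_b(f)|²` (`leviTensionSq_eq`), because horizontal lines are geodesics of
  `ℍ^m` and `H_b(f)` is horizontal;
* `∑ (Δ_b F_α) Γ(F_α, φ) = 0` (`sum_subLaplacian_mul_carre`): the Levi tension is normal to
  `df(H(M))`. The pulled-back metric `∑ dF_α ⊗ dF_α` differs from the Webster metric by a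
  multiple of `θ ⊗ θ`, so both have the same Christoffel symbols on horizontal vectors.

The commutator `v_α = [Δ_b, F_α] u_i = (Δ_b F_α) u_i + 2 Γ(F_α, u_i)` has Fourier coefficients
`⟨v_α, u_j⟩ = (λ_i - λ_j) ⟨F_α u_i, u_j⟩`, and the identities above give
`∑ ⟨v_α, F_α u_i⟩ = -2n` and `∑ ‖v_α‖² = 4 λ_i + D_i` (`exists_commutator`). With `w_ij = ∑ ⟨F_α u_i, u_j⟩²`,
Parseval's identity turns this into the sum rules (`hasSum_weight`)

  `∑_j (λ_j - λ_i) w_ij = 2n`,  `∑_j (λ_j - λ_i)² w_ij = 4 λ_i + D_i`.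

The rest uses only these, the symmetry of `w` and `w ≥ 0`. Multiply the first rule by
`(z - λ_i)^p` and the second by `(z - λ_i)^(p-1)`, sum over `λ_i < z`, and symmetrize: the inequality
reduces to `(x^p - y^p)(x - y) ≤ max(1, p/2) (x - y)² (x^(p-1) + y^(p-1))`
(`sum_rpow_le_of_commutator`). The bound by the mean is the case `p = 1`. In the case `p = 2`,
at all thresholds `z`, the inequality says that a Riesz mean divided by `z^(n+2)` is monotone,
and this yields the bound by `k^(1/n) λ_1` (`le_mul_rpow_of_riesz`).

Two analytic points need care. All of the geometry is defined through choices of local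
extensions and of orthonormal bases that vary discontinuously; it is computed in charts, where
the horizontal gradient solves a linear system with smooth coefficients, and `√g Δ_b u` is the
coordinate divergence of `√g` times this gradient (`sum_fderiv_densRep_gradRep`). This gives
Green's formula for the glued volume measure. Secondly, the eigenfunctions lie only in the form
domain and `V` is only locally integrable, so that every identity for `u_i` is a limit of
identities for test functions (`FormApprox`).
-/

noncomputable section

/-! ### Vector fields in charts -/

section Charts

variable {n : ℕ} {M : Type*} [TopologicalSpace M] [ChartedSpace (ModelE n) M]
  [IsManifold (𝓡 (2 * n + 1)) ∞ M]

/-- A family of operators on a finite-dimensional space is as smooth as its values on each vector.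
This is the pointwise counterpart of `contDiff_clm_apply_iff`. -/
lemma ContDiffAt.of_clm_apply {D E F : Type*} [NormedAddCommGroup D] [NormedSpace ℝ D]
    [NormedAddCommGroup E] [NormedSpace ℝ E] [NormedAddCommGroup F] [NormedSpace ℝ F]
    [FiniteDimensional ℝ E] {k : WithTop ℕ∞} {f : D → E →L[ℝ] F} {x : D}
    (h : ∀ v, ContDiffAt ℝ k (fun y => f y v) x) : ContDiffAt ℝ k f x := by
  let d := Module.finrank ℝ E
  have hd : d = Module.finrank ℝ (Fin d → ℝ) := (Module.finrank_fin_fun ℝ).symm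
  let e₁ := ContinuousLinearEquiv.ofFinrankEq hd
  let e₂ := (e₁.arrowCongr (1 : F ≃L[ℝ] F)).trans (ContinuousLinearEquiv.piRing (Fin d))
  rw [← Function.id_comp f, ← e₂.symm_comp_self]
  exact e₂.symm.contDiff.contDiffAt.comp x (contDiffAt_pi.2 fun i => h _)

/-- The point of `M` with coordinates `y` in the preferred chart at `c`. -/
abbrev chartPt (c : M) (y : ModelE n) : M := (extChartAt (𝓡 (2 * n + 1)) c).symm y

/-- The range of the preferred chart at `c`. -/
abbrev chartTarget (c : M) : Set (ModelE n) := (extChartAt (𝓡 (2 * n + 1)) c).target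

/-- The differential `T_x M → ℝ^(2n+1)` of the preferred chart at `c`. All coordinate
representations below push tangent vectors forward along this map. -/
def chartDiff (c x : M) : TangentSpace (𝓡 (2 * n + 1)) x →L[ℝ] ModelE n :=
  mfderiv (𝓡 (2 * n + 1)) 𝓘(ℝ, ModelE n) (extChartAt (𝓡 (2 * n + 1)) c) x

/-- The differential of the inverse chart, `ℝ^(2n+1) → T M`; it inverts `chartDiff c` over the range
of the chart. -/
def chartFrame (c : M) (y : ModelE n) : ModelE n →L[ℝ]
    TangentSpace (𝓡 (2 * n + 1)) (chartPt c y) :=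
  mfderiv 𝓘(ℝ, ModelE n) (𝓡 (2 * n + 1)) (extChartAt (𝓡 (2 * n + 1)) c).symm y

lemma isManifold_one : IsManifold (𝓡 (2 * n + 1)) 1 M :=
  IsManifold.of_le (n := ∞) (by simp)

lemma chartDiff_chartFrame (c : M) {y : ModelE n}
    (hy : y ∈ chartTarget c) (v : ModelE n) :
    chartDiff c _ (chartFrame c y v) = v := by
  have := isManifold_one (n := n) (M := M)
  have h := mfderiv_extChartAt_comp_mfderivWithin_extChartAt_symm (I := 𝓡 (2 * n + 1)) hy
  simp only [modelWithCornersSelf_coe, range_id, mfderivWithin_univ] at h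
  exact DFunLike.congr_fun h v

lemma chartFrame_chartDiff (c : M) {y : ModelE n}
    (hy : y ∈ chartTarget c)
    (v : TangentSpace (𝓡 (2 * n + 1)) (chartPt c y)) :
    chartFrame c y (chartDiff c _ v) = v := by
  have := isManifold_one (n := n) (M := M)
  have h := mfderivWithin_extChartAt_symm_comp_mfderiv_extChartAt (I := 𝓡 (2 * n + 1)) hy
  simp only [modelWithCornersSelf_coe, range_id, mfderivWithin_univ] at h
  exact DFunLike.congr_fun h v

lemma contMDiffAt_chartPt (c : M) {y : ModelE n}
    (hy : y ∈ chartTarget c) :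
    ContMDiffAt 𝓘(ℝ, ModelE n) (𝓡 (2 * n + 1)) ∞ (extChartAt (𝓡 (2 * n + 1)) c).symm y :=
  (contMDiffOn_extChartAt_symm c).contMDiffAt ((isOpen_extChartAt_target c).mem_nhds hy)

lemma dirDeriv_chartFrame {F : Type*} [NormedAddCommGroup F] [NormedSpace ℝ F] (c : M)
    {y : ModelE n} (hy : y ∈ chartTarget c) {u : M → F}
    (hu : MDifferentiableAt (𝓡 (2 * n + 1)) 𝓘(ℝ, F) u (chartPt c y))
    (v : ModelE n) :
    dirDeriv u _ (chartFrame c y v) = fderiv ℝ (u ∘ chartPt c) y v := by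
  have h := mfderiv_comp y hu ((contMDiffAt_chartPt c hy).mdifferentiableAt (by simp))
  rw [mfderiv_eq_fderiv] at h
  rw [h]; rfl

/-- The coordinate representation of a vector field in the chart at `c`, as a map of `ℝ^(2n+1)`.
Outside `chartTarget c` its values carry no meaning. -/
def fieldRep (c : M) (X : VField n M) (y : ModelE n) : ModelE n :=
  chartDiff c _ (X (chartPt c y))

/-- This identification gives access to the naturality of the Lie bracket under pullback. -/
lemma fieldRep_eq_mpullback (c : M) (X : VField n M) {y : ModelE n}
    (hy : y ∈ chartTarget c) :
    fieldRep c X y = VectorField.mpullback 𝓘(ℝ, ModelE n) (𝓡 (2 * n + 1))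
      (extChartAt (𝓡 (2 * n + 1)) c).symm X y := by
  have : (chartFrame c y).IsInvertible := by
    apply ContinuousLinearMap.IsInvertible.of_inverse (g := chartDiff c _)
    · ext1 v; exact chartFrame_chartDiff c hy v
    · ext1 v; exact chartDiff_chartFrame c hy v
  obtain ⟨e, he⟩ := this
  rw [VectorField.mpullback_apply]
  change _ = (chartFrame c y).inverse _
  rw [fieldRep, ← he, ContinuousLinearMap.inverse_equiv]
  apply e.injective
  have := chartFrame_chartDiff c hy (X (chartPt c y))
  rw [← he] at this
  exact this.trans (e.apply_symm_apply _).symm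

lemma fieldRep_bracket (c : M) {X Y : VField n M} {y : ModelE n}
    (hy : y ∈ chartTarget c)
    (hX : MDifferentiableAt (𝓡 (2 * n + 1)) (𝓡 (2 * n + 1)).tangent
      (fun x => (⟨x, X x⟩ : TangentBundle (𝓡 (2 * n + 1)) M))
      (chartPt c y))
    (hY : MDifferentiableAt (𝓡 (2 * n + 1)) (𝓡 (2 * n + 1)).tangent
      (fun x => (⟨x, Y x⟩ : TangentBundle (𝓡 (2 * n + 1)) M))
      (chartPt c y)) :
    fieldRep c (bracket X Y) y =
      VectorField.lieBracket ℝ (fieldRep c X) (fieldRep c Y) y := by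
  have h2 : minSmoothness ℝ 2 = 2 := minSmoothness_of_isRCLikeNormedField
  have h3 : minSmoothness ℝ 3 = 3 := minSmoothness_of_isRCLikeNormedField
  have : IsManifold (𝓡 (2 * n + 1)) (minSmoothness ℝ 2) M :=
    IsManifold.of_le (n := ∞) (by rw [h2]; exact WithTop.coe_le_coe.2 le_top)
  have : IsManifold (𝓡 (2 * n + 1)) (minSmoothness ℝ 3) M :=
    IsManifold.of_le (n := ∞) (by rw [h3]; exact WithTop.coe_le_coe.2 le_top)
  rw [fieldRep_eq_mpullback c _ hy, bracket,
    VectorField.mpullback_mlieBracket hX hY (contMDiffAt_chartPt c hy)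
      (by rw [h2]; exact WithTop.coe_le_coe.2 le_top)]
  have key : ∀ P Q : (z : ModelE n) → TangentSpace 𝓘(ℝ, ModelE n) z,
      VectorField.mlieBracket 𝓘(ℝ, ModelE n) P Q y =
      VectorField.lieBracket ℝ (V := (P : ModelE n → ModelE n)) Q y := fun P Q => by
    have h := congrFun (VectorField.mlieBracketWithin_eq_lieBracketWithin
      (𝕜 := ℝ) (V := P) (W := Q) (s := univ)) y
    rw [VectorField.mlieBracketWithin_univ] at h
    exact h.trans (congrFun VectorField.lieBracketWithin_univ y)
  refine (key _ _).trans ?_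
  have hrep : ∀ Z : VField n M, (VectorField.mpullback 𝓘(ℝ, ModelE n) (𝓡 (2 * n + 1))
      (extChartAt (𝓡 (2 * n + 1)) c).symm Z : ModelE n → ModelE n) =ᶠ[𝓝 y] fieldRep c Z := by
    intro Z
    filter_upwards [(isOpen_extChartAt_target c).mem_nhds hy] with z hz
    exact (fieldRep_eq_mpullback c _ hz).symm
  exact (hrep X).lieBracket_vectorField_eq (hrep Y)

/-- The preferred trivialization of the tangent bundle at `c` is `chartDiff c`, so that smoothness
of sections can be read off in coordinates. -/
lemma section_trivialization (c : M) {x : M} (hx : x ∈ (extChartAt (𝓡 (2 * n + 1)) c).source)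
    (v : TangentSpace (𝓡 (2 * n + 1)) x) :
    (trivializationAt (ModelE n) (TangentSpace (𝓡 (2 * n + 1)) : M → Type _) c ⟨x, v⟩).2 =
      chartDiff c x v := by
  have := isManifold_one (n := n) (M := M)
  rw [extChartAt_source] at hx
  rw [chartDiff, ← TangentBundle.continuousLinearMapAt_trivializationAt hx]
  rw [Bundle.Trivialization.continuousLinearMapAt_apply_of_mem]
  simpa using hx

lemma contMDiffAt_field_iff (c : M) {X : VField n M} {k : ℕ∞} {y : ModelE n}
    (hy : y ∈ chartTarget c) :
    ContMDiffAt (𝓡 (2 * n + 1)) (𝓡 (2 * n + 1)).tangent k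
      (fun x => (⟨x, X x⟩ : TangentBundle (𝓡 (2 * n + 1)) M))
      (chartPt c y) ↔ ContDiffAt ℝ k (fieldRep c X) y := by
  have := isManifold_one (n := n) (M := M)
  set e := trivializationAt (ModelE n) (TangentSpace (𝓡 (2 * n + 1)) : M → Type _) c
  have hx := (extChartAt (𝓡 (2 * n + 1)) c).map_target hy
  have hxe : (extChartAt (𝓡 (2 * n + 1)) c).symm y ∈ e.baseSet := by
    simpa [e, extChartAt_source] using hx
  rw [e.contMDiffAt_section_iff hxe]
  have hev : (fun x => (e ⟨x, X x⟩).2) =ᶠ[𝓝 (chartPt c y)]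
      fun x => chartDiff c x (X x) := by
    filter_upwards [(isOpen_extChartAt_source c).mem_nhds hx] with z hz
    exact section_trivialization c hz _
  rw [hev.contMDiffAt_iff, ← contMDiffAt_iff_contDiffAt]
  constructor
  · intro h
    exact h.comp y ((contMDiffAt_chartPt c hy).of_le (by exact_mod_cast le_top))
  · intro h
    have h' : ContMDiffAt 𝓘(ℝ, ModelE n) 𝓘(ℝ, ModelE n) k (fieldRep c X)
      (extChartAt (𝓡 (2 * n + 1)) c (chartPt c y)) := by
      rwa [(extChartAt (𝓡 (2 * n + 1)) c).right_inv hy]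
    have h2 := h'.comp _ ((contMDiffAt_extChartAt' (I := 𝓡 (2 * n + 1)) (n := ∞) (by
      rwa [← extChartAt_source (𝓡 (2 * n + 1))])).of_le (by exact_mod_cast le_top))
    refine h2.congr_of_eventuallyEq ?_
    filter_upwards [(isOpen_extChartAt_source c).mem_nhds hx] with z hz
    simp only [Function.comp, fieldRep]
    rw [chartPt, (extChartAt (𝓡 (2 * n + 1)) c).left_inv hz]

lemma contDiffAt_fieldRep_extendVec (c : M) {y : ModelE n}
    (hy : y ∈ chartTarget c)
    (v : TangentSpace (𝓡 (2 * n + 1)) (chartPt c y)) :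
    ContDiffAt ℝ ∞ (fieldRep c (extendVec v)) y := by
  have := isManifold_one (n := n) (M := M)
  exact (contMDiffAt_field_iff c hy).1
    (FiberBundle.contMDiffAt_extend (𝓡 (2 * n + 1)) (ModelE n) v)

lemma fieldRep_extendVec (c : M) {y : ModelE n}
    (v : TangentSpace (𝓡 (2 * n + 1)) (chartPt c y)) :
    fieldRep c (extendVec v) y = chartDiff c _ v := by
  have := isManifold_one (n := n) (M := M)
  rw [fieldRep, extendVec, FiberBundle.extend_apply_self]

/-- The vector field with constant representation `v` in the chart at `c`.
`ContinuousLinearMap.inverse` makes it total; it is meaningful only on the domain of the chart. -/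
def coordField (c : M) (v : ModelE n) : VField n M := fun x =>
  (chartDiff c x).inverse v

lemma coordField_symm (c : M) {y : ModelE n} (hy : y ∈ chartTarget c)
    (v : ModelE n) : coordField c v (chartPt c y) = chartFrame c y v := by
  let e : TangentSpace (𝓡 (2 * n + 1)) (chartPt c y) ≃L[ℝ] ModelE n :=
    ContinuousLinearEquiv.equivOfInverse (chartDiff c _) (chartFrame c y)
      (chartFrame_chartDiff c hy) (chartDiff_chartFrame c hy)
  change (e : _ →L[ℝ] _).inverse v = e.symm v
  rw [ContinuousLinearMap.inverse_equiv]; rfl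

lemma fieldRep_coordField (c : M) {y : ModelE n}
    (hy : y ∈ chartTarget c) (v : ModelE n) :
    fieldRep c (coordField c v) y = v := by
  rw [fieldRep, coordField_symm c hy, chartDiff_chartFrame c hy]

lemma contMDiffAt_coordField (c : M) {y : ModelE n}
    (hy : y ∈ chartTarget c) (v : ModelE n) :
    ContMDiffAt (𝓡 (2 * n + 1)) (𝓡 (2 * n + 1)).tangent ∞
      (fun x => (⟨x, coordField c v x⟩ : TangentBundle (𝓡 (2 * n + 1)) M))
      (chartPt c y) := by
  refine (contMDiffAt_field_iff (k := ⊤) c hy).2 ?_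
  refine (contDiffAt_const (c := v)).congr_of_eventuallyEq ?_
  filter_upwards [(isOpen_extChartAt_target c).mem_nhds hy] with z hz
  exact fieldRep_coordField c hz v

namespace StrictlyPseudoconvexCR
variable (S : StrictlyPseudoconvexCR n M)

/-- The contact form in the chart at `c`. -/
def thetaRep (c : M) (y : ModelE n) : ModelE n →L[ℝ] ℝ := (S.theta _).comp (chartFrame c y)

/-- The field `J` in the chart at `c`. -/
def JRep (c : M) (y : ModelE n) : ModelE n →L[ℝ] ModelE n :=
  (chartDiff c _).comp ((S.J _).comp (chartFrame c y))

lemma contDiffAt_thetaRep (c : M) {y : ModelE n}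
    (hy : y ∈ chartTarget c) : ContDiffAt ℝ ∞ (S.thetaRep c) y := by
  have := isManifold_one (n := n) (M := M)
  refine ContDiffAt.of_clm_apply fun v => ?_
  have h := (S.smooth_theta (chartPt c y)).clm_bundle_apply
    (contMDiffAt_coordField c hy v)
  rw [Bundle.contMDiffAt_section] at h
  have h2 : ContMDiffAt 𝓘(ℝ, ModelE n) 𝓘(ℝ, ℝ) ∞ _ y := h.comp y (contMDiffAt_chartPt c hy)
  refine h2.contDiffAt.congr_of_eventuallyEq ?_
  filter_upwards [(isOpen_extChartAt_target c).mem_nhds hy] with z hz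
  change S.theta _ (chartFrame c z v) = S.theta _ (coordField c v _)
  rw [coordField_symm c hz v]

lemma contDiffAt_JRep (c : M) {y : ModelE n}
    (hy : y ∈ chartTarget c) : ContDiffAt ℝ ∞ (S.JRep c) y := by
  have := isManifold_one (n := n) (M := M)
  refine ContDiffAt.of_clm_apply fun v => ?_
  have h := (S.smooth_J (chartPt c y)).clm_bundle_apply
    (contMDiffAt_coordField c hy v)
  have h2 := (contMDiffAt_field_iff (k := ⊤) c hy).1 h
  refine h2.congr_of_eventuallyEq ?_
  filter_upwards [(isOpen_extChartAt_target c).mem_nhds hy] with z hz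
  change chartDiff c _ (S.J _ (chartFrame c z v)) = chartDiff c _ (S.J _ (coordField c v _))
  rw [coordField_symm c hz v]

end StrictlyPseudoconvexCR

end Charts

/-! ### Linear algebra of contact forms and the Webster metric in charts -/

section ContactLinearAlgebra

section LinearAlgebra

variable {E : Type*} [NormedAddCommGroup E] [NormedSpace ℝ E]

/-- The contact condition in linear algebra: if `dθ = σ` is positive on `ker θ` through `J`, then
`σ + θ ⊗ θ` is nondegenerate. -/
lemma injective_add_smulRight {θ : E →L[ℝ] ℝ} {σ : E →L[ℝ] E →L[ℝ] ℝ} {J : E →L[ℝ] E}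
    (hσ : ∀ v, σ v v = 0) (hJ : ∀ v, θ v = 0 → θ (J v) = 0)
    (hJ2 : ∀ v, θ v = 0 → J (J v) = -v) (hpos : ∀ v, θ v = 0 → v ≠ 0 → 0 < -σ (J v) v) :
    Function.Injective (σ + θ.smulRight θ) := by
  rw [injective_iff_map_eq_zero]
  intro v hv
  have hv' : ∀ w, σ v w + θ v * θ w = 0 := fun w => by simpa using DFunLike.congr_fun hv w
  have h0 : θ v = 0 := by
    have := hv' v
    rw [hσ, zero_add] at this
    exact mul_self_eq_zero.1 this
  by_contra hne
  have h1 : J v ≠ 0 := fun h => hne (by simpa [h] using (hJ2 v h0).symm)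
  have h2 := hpos (J v) (hJ v h0) h1
  rw [hJ2 v h0] at h2
  have h3 := hv' (J v)
  rw [h0] at h3
  simp only [map_neg, neg_apply, neg_neg] at h2
  linarith

lemma exists_equiv_of_injective [FiniteDimensional ℝ E] {B : E →L[ℝ] E →L[ℝ] ℝ}
    (hB : Function.Injective B) :
    ∃ e : E ≃L[ℝ] (E →L[ℝ] ℝ), (e : E →L[ℝ] E →L[ℝ] ℝ) = B := by
  have hd : Module.finrank ℝ E = Module.finrank ℝ (E →L[ℝ] ℝ) := by
    rw [← (LinearMap.toContinuousLinearMap (𝕜 := ℝ) (E := E) (F' := ℝ)).finrank_eq]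
    exact (Subspace.dual_finrank_eq (K := ℝ) (V := E)).symm
  refine ⟨(LinearEquiv.ofInjectiveOfFinrankEq (B : E →ₗ[ℝ] E →L[ℝ] ℝ) hB
    hd).toContinuousLinearEquiv, ?_⟩
  ext v w
  rfl

/-- The Reeb vector is the solution of the linear equation `(σ + θ ⊗ θ) ξ' = θ`, which shows both
that it is unique and that it depends smoothly on `θ` and `σ`. -/
lemma reeb_unique {θ : E →L[ℝ] ℝ} {σ : E →L[ℝ] E →L[ℝ] ℝ}
    (hinj : Function.Injective (σ + θ.smulRight θ)) {ξ ξ' : E}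
    (h : θ ξ = 1 ∧ ∀ w, σ ξ w = 0) (h' : (σ + θ.smulRight θ) ξ' = θ) : ξ' = ξ := by
  apply hinj
  rw [h']
  ext w
  simp [h.1, h.2]

lemma exists_reeb [FiniteDimensional ℝ E] {θ : E →L[ℝ] ℝ} {σ : E →L[ℝ] E →L[ℝ] ℝ} {J : E →L[ℝ] E}
    (hσ : ∀ v w, σ v w = -σ w v) (hθ : θ ≠ 0) (hJ : ∀ v, θ v = 0 → θ (J v) = 0)
    (hJ2 : ∀ v, θ v = 0 → J (J v) = -v) (hpos : ∀ v, θ v = 0 → v ≠ 0 → 0 < -σ (J v) v) :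
    ∃ ξ, θ ξ = 1 ∧ ∀ w, σ ξ w = 0 := by
  have hσ' : ∀ v, σ v v = 0 := fun v => by linarith [hσ v v]
  obtain ⟨e, he⟩ := exists_equiv_of_injective (injective_add_smulRight hσ' hJ hJ2 hpos)
  obtain ⟨ξ, hξ⟩ := e.surjective θ
  have h : ∀ w, σ ξ w + θ ξ * θ w = θ w := fun w => by
    have : e ξ = (σ + θ.smulRight θ) ξ := DFunLike.congr_fun he ξ
    simpa [hξ] using (DFunLike.congr_fun this w).symm
  have h1 : θ ξ = 1 := by
    have h2 := h ξ
    rw [hσ', zero_add] at h2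
    rcases eq_or_ne (θ ξ) 0 with h0 | h0
    · exfalso
      have h3 : ξ = 0 := by
        by_contra hne
        have h1 : J ξ ≠ 0 := fun hh => hne (by simpa [hh] using (hJ2 ξ h0).symm)
        have h4 := hpos _ (hJ ξ h0) h1
        rw [hJ2 ξ h0] at h4
        have h5 := h (J ξ)
        rw [h0, hJ ξ h0] at h5
        simp only [map_neg, neg_apply, neg_neg] at h4
        linarith
      apply hθ
      ext w
      simpa [h3] using (h w).symm
    · exact mul_right_cancel₀ h0 (by rw [h2, one_mul])
  refine ⟨ξ, h1, fun w => ?_⟩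
  have := h w
  rw [h1] at this
  linarith

lemma finrank_ker_of_ne_zero {d : ℕ} (hd : Module.finrank ℝ E = d + 1) {θ : E →L[ℝ] ℝ}
    (hθ : θ ≠ 0) : Module.finrank ℝ (LinearMap.ker (θ : E →ₗ[ℝ] ℝ)) = d := by
  have := FiniteDimensional.of_finrank_pos (K := ℝ) (V := E) (by omega)
  have h1 := LinearMap.finrank_range_add_finrank_ker (θ : E →ₗ[ℝ] ℝ)
  have h2 : LinearMap.range (θ : E →ₗ[ℝ] ℝ) = ⊤ := by
    rw [LinearMap.range_eq_top]
    exact LinearMap.surjective (fun h => hθ (by ext v; exact DFunLike.congr_fun h v))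
  rw [h2, finrank_top, Module.finrank_self] at h1
  omega

/-- Existence of the horizontal orthonormal bases on which `StrictlyPseudoconvexCR.onb` relies. -/
lemma exists_orthonormal_ker {d : ℕ} (hd : Module.finrank ℝ E = d + 1) {θ : E →L[ℝ] ℝ}
    (hθ : θ ≠ 0) (g : E →L[ℝ] E →L[ℝ] ℝ) (hsymm : ∀ v w, g v w = g w v)
    (hpos : ∀ v, θ v = 0 → v ≠ 0 → 0 < g v v) :
    ∃ e : Fin d → E, (∀ i, θ (e i) = 0) ∧ ∀ i j, g (e i) (e j) = if i = j then 1 else 0 := by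
  classical
  let K : Submodule ℝ E := LinearMap.ker (θ : E →ₗ[ℝ] ℝ)
  have hK : Module.finrank ℝ K = d := finrank_ker_of_ne_zero hd hθ
  have := FiniteDimensional.of_finrank_pos (K := ℝ) (V := E) (by omega)
  let B : LinearMap.BilinForm ℝ K := LinearMap.mk₂ ℝ (fun v w => g v w)
    (by intros; simp) (by intros; simp) (by intros; simp) (by intros; simp)
  have hB : LinearMap.IsSymm B := ⟨fun v w => by simp [B, hsymm (v : E) w]⟩
  obtain ⟨b, hb⟩ := LinearMap.BilinForm.exists_orthogonal_basis hB
  let b' := b.reindex (finCongr hK)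
  have hmem : ∀ i, θ (b' i) = 0 := fun i => LinearMap.mem_ker.1 (b' i).2
  have hp : ∀ i, 0 < g (b' i) (b' i) := fun i =>
    hpos _ (hmem i) (fun h => b'.ne_zero i (Subtype.ext h))
  refine ⟨fun i => (Real.sqrt (g (b' i) (b' i)))⁻¹ • (b' i : E), fun i => by simp [hmem i],
    fun i j => ?_⟩
  simp only [map_smul, smul_apply, smul_eq_mul]
  split_ifs with hij
  · subst hij
    have h1 := Real.mul_self_sqrt (hp i).le
    have h2 : Real.sqrt (g (b' i) (b' i)) ≠ 0 := (Real.sqrt_pos.2 (hp i)).ne'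
    field_simp
    linarith
  · have : g (b' i) (b' j) = 0 := by
      have := hb (i := (finCongr hK).symm i) (j := (finCongr hK).symm j) (by simpa using hij)
      simpa [B, b', Function.onFun] using this
    rw [this]; simp

lemma eq_sum_of_orthonormal_ker {d : ℕ} (hd : Module.finrank ℝ E = d + 1) {θ : E →L[ℝ] ℝ}
    {g : E →L[ℝ] E →L[ℝ] ℝ} {e : Fin d → E}
    (he : ∀ i, θ (e i) = 0) (hon : ∀ i j, g (e i) (e j) = if i = j then 1 else 0) {v : E}
    (hθ : θ ≠ 0) (hv : θ v = 0) : v = ∑ i, g v (e i) • e i := by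
  classical
  let K : Submodule ℝ E := LinearMap.ker (θ : E →ₗ[ℝ] ℝ)
  have hK : Module.finrank ℝ K = d := finrank_ker_of_ne_zero hd hθ
  have := FiniteDimensional.of_finrank_pos (K := ℝ) (V := E) (by omega)
  have hli : LinearIndependent ℝ e := by
    rw [Fintype.linearIndependent_iff]
    intro a ha i
    have := congrArg (fun w => g w (e i)) ha
    simpa [hon] using this
  let e' : Fin d → K := fun i => ⟨e i, LinearMap.mem_ker.2 (he i)⟩
  have hli' : LinearIndependent ℝ e' := by
    apply LinearIndependent.of_comp K.subtype
    exact hli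
  have hspan := hli'.span_eq_top_of_card_eq_finrank' (by simp [hK])
  have hmem : (⟨v, LinearMap.mem_ker.2 hv⟩ : K) ∈ Submodule.span ℝ (range e') := by
    rw [hspan]; trivial
  obtain ⟨a, ha⟩ := (Submodule.mem_span_range_iff_exists_fun ℝ).1 hmem
  have ha' : v = ∑ i, a i • e i := by
    have := congrArg (fun w : K => (w : E)) ha
    simpa [e'] using this.symm
  have : ∀ i, g v (e i) = a i := fun i => by rw [ha']; simp [hon]
  simp only [this]
  exact ha'

end LinearAlgebra

variable {n : ℕ} {M : Type*} [TopologicalSpace M] [ChartedSpace (ModelE n) M]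
  [IsManifold (𝓡 (2 * n + 1)) ∞ M]

/-- The directional derivative in coordinates, for any function `w` that represents `u` near the
point. -/
lemma dirDeriv_eq_fderiv {F : Type*} [NormedAddCommGroup F] [NormedSpace ℝ F] (c : M)
    {y : ModelE n} (hy : y ∈ chartTarget c) {u : M → F} {w : ModelE n → F}
    (huw : u ∘ chartPt c =ᶠ[𝓝 y] w) (hw : DifferentiableAt ℝ w y)
    (v : TangentSpace (𝓡 (2 * n + 1)) (chartPt c y)) :
    dirDeriv u _ v = fderiv ℝ w y (chartDiff c _ v) := by
  have hd : DifferentiableAt ℝ (u ∘ chartPt c) y := hw.congr_of_eventuallyEq huw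
  have hx := (extChartAt (𝓡 (2 * n + 1)) c).map_target hy
  have hM : MDifferentiableAt (𝓡 (2 * n + 1)) 𝓘(ℝ, F) u (chartPt c y) := by
    have h1 : MDifferentiableAt 𝓘(ℝ, ModelE n) 𝓘(ℝ, F) (u ∘ chartPt c)
        (extChartAt (𝓡 (2 * n + 1)) c (chartPt c y)) := by
      rw [chartPt, (extChartAt (𝓡 (2 * n + 1)) c).right_inv hy]
      exact hd.mdifferentiableAt
    have h2 := h1.comp (chartPt c y) ((contMDiffAt_extChartAt' (I := 𝓡 (2 * n + 1)) (n := ∞) (by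
      rwa [← extChartAt_source (𝓡 (2 * n + 1))])).mdifferentiableAt (by simp))
    refine h2.congr_of_eventuallyEq ?_
    filter_upwards [(isOpen_extChartAt_source c).mem_nhds hx] with z hz
    simp only [Function.comp, chartPt]
    rw [(extChartAt (𝓡 (2 * n + 1)) c).left_inv hz]
  rw [← huw.fderiv_eq, ← dirDeriv_chartFrame c hy hM, chartFrame_chartDiff c hy]

omit [IsManifold (𝓡 (2 * n + 1)) ∞ M] in
lemma chartTarget_mem_nhds {c : M} {y : ModelE n} (hy : y ∈ chartTarget c) :
    chartTarget c ∈ 𝓝 y := (isOpen_extChartAt_target c).mem_nhds hy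

namespace StrictlyPseudoconvexCR
variable (S : StrictlyPseudoconvexCR n M)

/-- The two-form `dθ` in the chart at `c`, as the antisymmetrization of the derivative of `θ`. -/
def omegaRep (c : M) (y : ModelE n) : ModelE n →L[ℝ] ModelE n →L[ℝ] ℝ :=
  fderiv ℝ (S.thetaRep c) y - (fderiv ℝ (S.thetaRep c) y).flip

variable (c : M) {y : ModelE n}

lemma omegaRep_apply (v w : ModelE n) : S.omegaRep c y v w =
    fderiv ℝ (S.thetaRep c) y v w - fderiv ℝ (S.thetaRep c) y w v := rfl

lemma thetaRep_chartDiff (hy : y ∈ chartTarget c)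
    (v : TangentSpace (𝓡 (2 * n + 1)) (chartPt c y)) :
    S.thetaRep c y (chartDiff c _ v) = S.theta _ v := by
  change S.theta _ (chartFrame c y _) = _
  rw [chartFrame_chartDiff c hy]

lemma JRep_chartDiff (hy : y ∈ chartTarget c)
    (v : TangentSpace (𝓡 (2 * n + 1)) (chartPt c y)) :
    S.JRep c y (chartDiff c _ v) = chartDiff c _ (S.J _ v) := by
  change chartDiff c _ (S.J _ (chartFrame c y _)) = _
  rw [chartFrame_chartDiff c hy]

lemma differentiableAt_thetaRep (hy : y ∈ chartTarget c) :
    DifferentiableAt ℝ (S.thetaRep c) y :=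
  (S.contDiffAt_thetaRep c hy).differentiableAt (by simp)

lemma contDiffAt_omegaRep (hy : y ∈ chartTarget c) : ContDiffAt ℝ ∞ (S.omegaRep c) y := by
  have h := (S.contDiffAt_thetaRep c hy).fderiv_right (m := ∞) (by simp)
  refine ContDiffAt.of_clm_apply fun v => ContDiffAt.of_clm_apply fun w => ?_
  simp only [omegaRep_apply]
  exact ((h.clm_apply contDiffAt_const).clm_apply contDiffAt_const).sub
    ((h.clm_apply contDiffAt_const).clm_apply contDiffAt_const)

lemma dirDeriv_theta_field (hy : y ∈ chartTarget c) {W : VField n M}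
    (hW : DifferentiableAt ℝ (fieldRep c W) y)
    (v : TangentSpace (𝓡 (2 * n + 1)) (chartPt c y)) :
    dirDeriv (fun x => S.theta x (W x)) (chartPt c y) v =
      fderiv ℝ (S.thetaRep c) y (chartDiff c _ v) (fieldRep c W y) +
      S.thetaRep c y (fderiv ℝ (fieldRep c W) y (chartDiff c _ v)) := by
  have h1 := S.differentiableAt_thetaRep c hy
  rw [dirDeriv_eq_fderiv c hy (w := fun z => S.thetaRep c z (fieldRep c W z)) _ (h1.clm_apply hW),
    fderiv_clm_apply h1 hW]
  · simp [add_comm]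
  · filter_upwards [chartTarget_mem_nhds hy] with z hz
    exact (S.thetaRep_chartDiff c hz _).symm

lemma extDerivOneForm_theta (hy : y ∈ chartTarget c)
    (v w : TangentSpace (𝓡 (2 * n + 1)) (chartPt c y)) :
    extDerivOneForm S.theta (chartPt c y) v w =
      S.omegaRep c y (chartDiff c _ v) (chartDiff c _ w) := by
  have hv := contDiffAt_fieldRep_extendVec c hy v
  have hw := contDiffAt_fieldRep_extendVec c hy w
  have hv' := ((contMDiffAt_field_iff (k := ⊤) c hy).2 hv).mdifferentiableAt (by simp)
  have hw' := ((contMDiffAt_field_iff (k := ⊤) c hy).2 hw).mdifferentiableAt (by simp)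
  rw [extDerivOneForm, S.dirDeriv_theta_field c hy (hw.differentiableAt (by simp)),
    S.dirDeriv_theta_field c hy (hv.differentiableAt (by simp)),
    ← S.thetaRep_chartDiff c hy (bracket _ _ _)]
  have hb := fieldRep_bracket c hy hv' hw'
  rw [fieldRep] at hb
  rw [hb, VectorField.lieBracket_eq, omegaRep_apply]
  simp only [fieldRep_extendVec, map_sub]
  ring

lemma thetaRep_ne_zero (hy : y ∈ chartTarget c) : S.thetaRep c y ≠ 0 := fun h =>
  S.theta_ne_zero (chartPt c y) (by
    ext v
    rw [← S.thetaRep_chartDiff c hy, h]; rfl)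

lemma thetaRep_JRep (hy : y ∈ chartTarget c) {v : ModelE n} (hv : S.thetaRep c y v = 0) :
    S.thetaRep c y (S.JRep c y v) = 0 := by
  rw [← chartDiff_chartFrame c hy v] at hv ⊢
  rw [S.JRep_chartDiff c hy, S.thetaRep_chartDiff c hy]
  rw [S.thetaRep_chartDiff c hy] at hv
  exact S.J_mem _ _ hv

lemma JRep_JRep (hy : y ∈ chartTarget c) {v : ModelE n} (hv : S.thetaRep c y v = 0) :
    S.JRep c y (S.JRep c y v) = -v := by
  rw [← chartDiff_chartFrame c hy v] at hv ⊢
  rw [S.JRep_chartDiff c hy, S.JRep_chartDiff c hy]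
  rw [S.thetaRep_chartDiff c hy] at hv
  rw [S.J_sq _ _ hv, map_neg]

lemma omegaRep_JRep_pos (hy : y ∈ chartTarget c) {v : ModelE n} (hv : S.thetaRep c y v = 0)
    (hne : v ≠ 0) : 0 < -S.omegaRep c y (S.JRep c y v) v := by
  rw [← chartDiff_chartFrame c hy v] at hv ⊢
  rw [S.JRep_chartDiff c hy, ← S.extDerivOneForm_theta c hy]
  rw [S.thetaRep_chartDiff c hy] at hv
  refine S.levi_pos _ _ hv fun h => hne ?_
  rw [← chartDiff_chartFrame c hy v, h, map_zero]

lemma omegaRep_antisymm (v w : ModelE n) : S.omegaRep c y v w = -S.omegaRep c y w v := by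
  simp [omegaRep_apply]

lemma injective_omegaRep_add (hy : y ∈ chartTarget c) :
    Function.Injective (S.omegaRep c y + (S.thetaRep c y).smulRight (S.thetaRep c y)) :=
  injective_add_smulRight (J := S.JRep c y) (fun v => by simp [omegaRep_apply])
    (fun _ => S.thetaRep_JRep c hy) (fun _ => S.JRep_JRep c hy)
    (fun _ => S.omegaRep_JRep_pos c hy)

/-- The `Classical.epsilon` in the definition of `reeb` does pick the Reeb vector. -/
lemma reeb_spec_chartPt (hy : y ∈ chartTarget c) : S.theta (chartPt c y) (S.reeb _) = 1 ∧
    ∀ w, extDerivOneForm S.theta (chartPt c y) (S.reeb _) w = 0 := by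
  obtain ⟨ξ, h1, h2⟩ := exists_reeb (J := S.JRep c y) (S.omegaRep_antisymm c)
    (S.thetaRep_ne_zero c hy) (fun _ => S.thetaRep_JRep c hy) (fun _ => S.JRep_JRep c hy)
    (fun _ => S.omegaRep_JRep_pos c hy)
  refine Classical.epsilon_spec (p := fun v => S.theta (chartPt c y) v = 1 ∧
    ∀ w, extDerivOneForm S.theta (chartPt c y) v w = 0) ⟨chartFrame c y ξ, h1, fun w => ?_⟩
  rw [S.extDerivOneForm_theta c hy, chartDiff_chartFrame c hy, h2]

/-- The Reeb field in the chart at `c`. -/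
def reebRep (c : M) (y : ModelE n) : ModelE n := chartDiff c _ (S.reeb (chartPt c y))

lemma thetaRep_reebRep (hy : y ∈ chartTarget c) : S.thetaRep c y (S.reebRep c y) = 1 := by
  rw [reebRep, S.thetaRep_chartDiff c hy, (S.reeb_spec_chartPt c hy).1]

lemma omegaRep_reebRep (hy : y ∈ chartTarget c) (w : ModelE n) :
    S.omegaRep c y (S.reebRep c y) w = 0 := by
  rw [← chartDiff_chartFrame c hy w, reebRep, ← S.extDerivOneForm_theta c hy,
    (S.reeb_spec_chartPt c hy).2]

lemma contDiffAt_reebRep (hy : y ∈ chartTarget c) : ContDiffAt ℝ ∞ (S.reebRep c) y := by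
  let B := fun z => S.omegaRep c z + (S.thetaRep c z).smulRight (S.thetaRep c z)
  have hB : ContDiffAt ℝ ∞ B y := by
    refine ContDiffAt.of_clm_apply fun v => ContDiffAt.of_clm_apply fun w => ?_
    have h1 := S.contDiffAt_omegaRep c hy
    have h2 := S.contDiffAt_thetaRep c hy
    exact ((h1.clm_apply contDiffAt_const).clm_apply contDiffAt_const).add
      ((h2.clm_apply contDiffAt_const).mul (h2.clm_apply contDiffAt_const))
  obtain ⟨e, he⟩ := exists_equiv_of_injective (S.injective_omegaRep_add c hy)
  have h1 : ContDiffAt ℝ ∞ (fun z => (B z).inverse (S.thetaRep c z)) y := by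
    refine ContDiffAt.clm_apply ?_ (S.contDiffAt_thetaRep c hy)
    exact ContDiffAt.comp y (g := ContinuousLinearMap.inverse) (by
      change ContDiffAt ℝ ∞ _ (S.omegaRep c y + _)
      rw [← he]; exact contDiffAt_map_inverse e) hB
  refine h1.congr_of_eventuallyEq ?_
  filter_upwards [chartTarget_mem_nhds hy] with z hz
  obtain ⟨e, he⟩ := exists_equiv_of_injective (S.injective_omegaRep_add c hz)
  refine (reeb_unique (S.injective_omegaRep_add c hz)
    ⟨S.thetaRep_reebRep c hz, S.omegaRep_reebRep c hz⟩ ?_).symm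
  change B z _ = _
  rw [show B z = _ from he.symm, ContinuousLinearMap.inverse_equiv]
  exact e.apply_symm_apply _

lemma smoothField_reeb : SmoothField S.reeb := fun x => by
  have h := (contMDiffAt_field_iff (k := ⊤) x (mem_extChartAt_target x)).2
    (S.contDiffAt_reebRep x (mem_extChartAt_target x))
  rwa [chartPt, extChartAt_to_inv] at h

/-- The horizontal projection `v ↦ v - θ(v) ξ` in the chart at `c`. -/
def projRep (c : M) (y : ModelE n) : ModelE n →L[ℝ] ModelE n :=
  ContinuousLinearMap.id ℝ _ - (S.thetaRep c y).smulRight (S.reebRep c y)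

lemma projRep_apply (v : ModelE n) :
    S.projRep c y v = v - S.thetaRep c y v • S.reebRep c y := rfl

lemma chartDiff_hproj (hy : y ∈ chartTarget c)
    (v : TangentSpace (𝓡 (2 * n + 1)) (chartPt c y)) :
    chartDiff c _ (S.hproj _ v) = S.projRep c y (chartDiff c _ v) := by
  rw [hproj, projRep_apply, map_sub, map_smul, S.thetaRep_chartDiff c hy]; rfl

lemma thetaRep_projRep (hy : y ∈ chartTarget c) (v : ModelE n) :
    S.thetaRep c y (S.projRep c y v) = 0 := by
  simp [projRep_apply, S.thetaRep_reebRep c hy]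

lemma projRep_of_horizontal {v : ModelE n} (hv : S.thetaRep c y v = 0) :
    S.projRep c y v = v := by simp [projRep_apply, hv]

/-- The Webster metric in the chart at `c`, as a bilinear map. -/
def metricRep (c : M) (y : ModelE n) : ModelE n →L[ℝ] ModelE n →L[ℝ] ℝ :=
  -(S.omegaRep c y).bilinearComp ((S.JRep c y).comp (S.projRep c y)) (S.projRep c y)
    + (S.thetaRep c y).smulRight (S.thetaRep c y)

lemma metricRep_apply (v w : ModelE n) : S.metricRep c y v w =
    -S.omegaRep c y (S.JRep c y (S.projRep c y v)) (S.projRep c y w)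
      + S.thetaRep c y v * S.thetaRep c y w := rfl

lemma levi_eq (hy : y ∈ chartTarget c) (v w : TangentSpace (𝓡 (2 * n + 1)) (chartPt c y)) :
    S.levi _ v w = -S.omegaRep c y (S.JRep c y (chartDiff c _ v)) (chartDiff c _ w) := by
  rw [levi, S.extDerivOneForm_theta c hy, S.JRep_chartDiff c hy]

lemma webster_eq (hy : y ∈ chartTarget c) (v w : TangentSpace (𝓡 (2 * n + 1)) (chartPt c y)) :
    S.webster _ v w = S.metricRep c y (chartDiff c _ v) (chartDiff c _ w) := by
  rw [webster, S.levi_eq c hy, S.chartDiff_hproj c hy, S.chartDiff_hproj c hy, metricRep_apply,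
    S.thetaRep_chartDiff c hy, S.thetaRep_chartDiff c hy]

lemma contDiffAt_metricRep (hy : y ∈ chartTarget c) : ContDiffAt ℝ ∞ (S.metricRep c) y := by
  have h1 := S.contDiffAt_omegaRep c hy
  have h2 := S.contDiffAt_thetaRep c hy
  have h3 := S.contDiffAt_reebRep c hy
  have h4 := S.contDiffAt_JRep c hy
  have hP : ∀ v, ContDiffAt ℝ ∞ (fun z => S.projRep c z v) y := fun v =>
    contDiffAt_const.sub ((h2.clm_apply contDiffAt_const).smul h3)
  refine ContDiffAt.of_clm_apply fun v => ContDiffAt.of_clm_apply fun w => ?_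
  simp only [metricRep_apply]
  exact ((h1.clm_apply (h4.clm_apply (hP v))).clm_apply (hP w)).neg.add
    ((h2.clm_apply contDiffAt_const).mul (h2.clm_apply contDiffAt_const))

/-- A horizontal vector extends to a global smooth horizontal field: cut off the local extension by
a bump function and project. The integrability axioms concern global fields, so they reach single
vectors only through such extensions. -/
lemma exists_horizontal_extension [T2Space M] (x : M) (v : TangentSpace (𝓡 (2 * n + 1)) x)
    (hv : S.theta x v = 0) :
    ∃ X : VField n M, SmoothField X ∧ (∀ z, S.theta z (X z) = 0) ∧ X x = v := by
  have := isManifold_one (n := n) (M := M)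
  obtain ⟨s, hs, hsm⟩ := FiberBundle.exists_contMDiffOn_extend (k := ∞) (𝓡 (2 * n + 1))
    (ModelE n) v
  obtain ⟨ρ, hρ⟩ := (SmoothBumpFunction.nhds_basis_tsupport (I := 𝓡 (2 * n + 1)) x).mem_iff.1
    (interior_mem_nhds.2 hs)
  have hX : SmoothField ((ρ : M → ℝ) • extendVec v) :=
    ContMDiffOn.smul_section_of_tsupport ρ.contMDiff.contMDiffOn isOpen_interior hρ.2
      (hsm.mono interior_subset)
  refine ⟨fun z => S.hproj z (((ρ : M → ℝ) • extendVec v) z), ?_, fun z => ?_, ?_⟩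
  · have hθ : ContMDiff (𝓡 (2 * n + 1)) 𝓘(ℝ, ℝ) ∞
        (fun z => S.theta z (((ρ : M → ℝ) • extendVec v) z)) := by
      have h := S.smooth_theta.clm_bundle_apply hX
      intro z
      exact (Bundle.contMDiffAt_section z).1 (h z)
    exact hX.sub_section (hθ.smul_section S.smoothField_reeb)
  · obtain ⟨y, hy, hyz⟩ : ∃ y, y ∈ chartTarget z ∧ chartPt z y = z :=
      ⟨extChartAt (𝓡 (2 * n + 1)) z z, mem_extChartAt_target z, extChartAt_to_inv z⟩
    have h := (S.reeb_spec_chartPt z hy).1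
    rw [hyz] at h
    simp [hproj, h]
  · simp [hproj, extendVec, hv]

end StrictlyPseudoconvexCR

end ContactLinearAlgebra

/-! ### Symmetry of the Levi form, horizontal frames and the Koszul formula -/

section HorizontalFrames

variable {n : ℕ} {M : Type*} [TopologicalSpace M] [ChartedSpace (ModelE n) M]
  [IsManifold (𝓡 (2 * n + 1)) ∞ M]

namespace StrictlyPseudoconvexCR
variable (S : StrictlyPseudoconvexCR n M) (c : M) {y : ModelE n}

lemma smoothField_J {X : VField n M} (hX : SmoothField X) :
    SmoothField (fun z => S.J z (X z)) :=
  S.smooth_J.clm_bundle_apply hX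

/-- For horizontal fields `θ([X, Y]) = -dθ(X, Y)`. -/
lemma theta_bracket (hy : y ∈ chartTarget c) {X Y : VField n M} (hX : SmoothField X)
    (hY : SmoothField Y) (hX0 : ∀ z, S.theta z (X z) = 0) (hY0 : ∀ z, S.theta z (Y z) = 0) :
    S.theta (chartPt c y) (bracket X Y (chartPt c y)) =
      -S.omegaRep c y (fieldRep c X y) (fieldRep c Y y) := by
  have hdX := (contMDiffAt_field_iff (k := ⊤) c hy).1 (hX _)
  have hdY := (contMDiffAt_field_iff (k := ⊤) c hy).1 (hY _)
  have h0 : ∀ {Z : VField n M}, SmoothField Z → (∀ z, S.theta z (Z z) = 0) → ∀ v,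
      fderiv ℝ (S.thetaRep c) y v (fieldRep c Z y) +
        S.thetaRep c y (fderiv ℝ (fieldRep c Z) y v) = 0 := by
    intro Z hZ hZ0 v
    have hd := ((contMDiffAt_field_iff (k := ⊤) c hy).1 (hZ _)).differentiableAt (by simp)
    have h1 := S.differentiableAt_thetaRep c hy
    have h2 := fderiv_clm_apply h1 hd
    have h3 : (fun z => S.thetaRep c z (fieldRep c Z z)) =ᶠ[𝓝 y] fun _ => 0 := by
      filter_upwards [chartTarget_mem_nhds hy] with z hz
      rw [fieldRep, S.thetaRep_chartDiff c hz, hZ0]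
    rw [h3.fderiv_eq] at h2
    have h4 := DFunLike.congr_fun h2 v
    simp at h4
    linarith
  rw [← S.thetaRep_chartDiff c hy]
  have hb := fieldRep_bracket c hy ((hX _).mdifferentiableAt (by simp))
    ((hY _).mdifferentiableAt (by simp))
  rw [fieldRep] at hb
  rw [hb, VectorField.lieBracket_eq, omegaRep_apply, map_sub]
  linarith [h0 hX hX0 (fieldRep c Y y), h0 hY hY0 (fieldRep c X y)]

/-- `dθ` is `J`-invariant on `ker θ`; this is what integrability says about the `θ`-component of
brackets, and it makes the Levi form symmetric. -/
lemma omegaRep_JRep_JRep [T2Space M] (hy : y ∈ chartTarget c) {v w : ModelE n}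
    (hv : S.thetaRep c y v = 0) (hw : S.thetaRep c y w = 0) :
    S.omegaRep c y (S.JRep c y v) (S.JRep c y w) = S.omegaRep c y v w := by
  obtain ⟨X, hX, hX0, hXv⟩ := S.exists_horizontal_extension (chartPt c y) (chartFrame c y v) hv
  obtain ⟨Y, hY, hY0, hYw⟩ := S.exists_horizontal_extension (chartPt c y) (chartFrame c y w) hw
  have h := S.integrable_mem X Y hX hY hX0 hY0 (chartPt c y)
  have hJX0 : ∀ z, S.theta z (S.J z (X z)) = 0 := fun z => S.J_mem _ _ (hX0 z)
  have hJY0 : ∀ z, S.theta z (S.J z (Y z)) = 0 := fun z => S.J_mem _ _ (hY0 z)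
  rw [map_sub, S.theta_bracket c hy hX hY hX0 hY0, S.theta_bracket c hy (S.smoothField_J hX)
    (S.smoothField_J hY) hJX0 hJY0] at h
  simp only [fieldRep, hXv, hYw, chartDiff_chartFrame c hy, ← S.JRep_chartDiff c hy] at h
  linarith

lemma metricRep_symm [T2Space M] (hy : y ∈ chartTarget c) (v w : ModelE n) :
    S.metricRep c y v w = S.metricRep c y w v := by
  rw [metricRep_apply, metricRep_apply]
  have hv := S.thetaRep_projRep c hy v
  have hw := S.thetaRep_projRep c hy w
  have h := S.omegaRep_JRep_JRep c hy (S.thetaRep_JRep c hy hv) hw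
  rw [S.JRep_JRep c hy hv, map_neg, neg_apply] at h
  rw [← h, S.omegaRep_antisymm c (S.JRep c y (S.projRep c y w))]
  ring

lemma metricRep_reebRep_left (hy : y ∈ chartTarget c) (v : ModelE n) :
    S.metricRep c y (S.reebRep c y) v = S.thetaRep c y v := by
  rw [metricRep_apply]
  have : S.projRep c y (S.reebRep c y) = 0 := by
    simp [projRep_apply, S.thetaRep_reebRep c hy]
  simp [this, S.thetaRep_reebRep c hy]

lemma metricRep_reebRep_right (hy : y ∈ chartTarget c) (v : ModelE n) :
    S.metricRep c y v (S.reebRep c y) = S.thetaRep c y v := by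
  rw [metricRep_apply]
  have : S.projRep c y (S.reebRep c y) = 0 := by
    simp [projRep_apply, S.thetaRep_reebRep c hy]
  simp [this, S.thetaRep_reebRep c hy]

lemma metricRep_of_horizontal {v w : ModelE n} (hv : S.thetaRep c y v = 0)
    (hw : S.thetaRep c y w = 0) :
    S.metricRep c y v w = -S.omegaRep c y (S.JRep c y v) w := by
  rw [metricRep_apply, S.projRep_of_horizontal c hv, S.projRep_of_horizontal c hw, hv]; ring

lemma metricRep_pos (hy : y ∈ chartTarget c) {v : ModelE n} (hv : v ≠ 0) :
    0 < S.metricRep c y v v := by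
  rw [metricRep_apply]
  rcases eq_or_ne (S.projRep c y v) 0 with h | h
  · have : S.thetaRep c y v ≠ 0 := by
      intro h0
      rw [S.projRep_of_horizontal c h0] at h
      exact hv h
    simp only [h, map_zero, neg_zero, zero_add]
    exact mul_self_pos.2 this
  · have := S.omegaRep_JRep_pos c hy (S.thetaRep_projRep c hy v) h
    nlinarith [mul_self_nonneg (S.thetaRep c y v)]

/-- The chosen horizontal orthonormal basis in the chart at `c`. It need not depend continuously on
the point, so it is never differentiated. -/
def onbRep (c : M) (y : ModelE n) (i : Fin (2 * n)) : ModelE n :=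
  chartDiff c _ (S.onb (chartPt c y) i)

lemma finrank_modelE : Module.finrank ℝ (ModelE n) = 2 * n + 1 := by simp

/-- The `Classical.epsilon` in the definition of `onb` does pick an orthonormal basis. -/
lemma isHorizontalONB_chartPt [T2Space M] (hy : y ∈ chartTarget c) :
    S.IsHorizontalONB (chartPt c y) (S.onb (chartPt c y)) := by
  obtain ⟨e, he, hon⟩ := exists_orthonormal_ker finrank_modelE (S.thetaRep_ne_zero c hy)
    (S.metricRep c y) (S.metricRep_symm c hy) (fun v _ hv => S.metricRep_pos c hy hv)
  refine Classical.epsilon_spec (p := fun e => S.IsHorizontalONB (chartPt c y) e)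
    ⟨fun i => chartFrame c y (e i), he, fun i j => ?_⟩
  rw [S.levi_eq c hy, chartDiff_chartFrame c hy, chartDiff_chartFrame c hy,
    ← S.metricRep_of_horizontal c (he i) (he j), hon]

lemma thetaRep_onbRep [T2Space M] (hy : y ∈ chartTarget c) (i : Fin (2 * n)) :
    S.thetaRep c y (S.onbRep c y i) = 0 := by
  rw [onbRep, S.thetaRep_chartDiff c hy, (S.isHorizontalONB_chartPt c hy).1]

lemma metricRep_onbRep [T2Space M] (hy : y ∈ chartTarget c) (i j : Fin (2 * n)) :
    S.metricRep c y (S.onbRep c y i) (S.onbRep c y j) = if i = j then 1 else 0 := by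
  rw [S.metricRep_of_horizontal c (S.thetaRep_onbRep c hy i) (S.thetaRep_onbRep c hy j), onbRep,
    onbRep, ← S.levi_eq c hy, (S.isHorizontalONB_chartPt c hy).2]

lemma projRep_eq_sum [T2Space M] (hy : y ∈ chartTarget c) (v : ModelE n) :
    S.projRep c y v = ∑ i, S.metricRep c y v (S.onbRep c y i) • S.onbRep c y i := by
  have h := eq_sum_of_orthonormal_ker finrank_modelE (S.thetaRep_onbRep c hy)
    (S.metricRep_onbRep c hy) (S.thetaRep_ne_zero c hy) (S.thetaRep_projRep c hy v)
  refine h.trans (Finset.sum_congr rfl fun i _ => ?_)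
  congr 1
  rw [projRep_apply, map_sub, map_smul, sub_apply, smul_apply,
    S.metricRep_reebRep_left c hy, S.thetaRep_onbRep c hy, smul_zero, sub_zero]

/-- The Christoffel symbols of the first kind of the Webster metric in the chart at `c`. -/
def gammaRep (c : M) (y : ModelE n) (a b d : ModelE n) : ℝ :=
  (1 / 2) * (fderiv ℝ (S.metricRep c) y a b d + fderiv ℝ (S.metricRep c) y b a d
    - fderiv ℝ (S.metricRep c) y d a b)

lemma differentiableAt_metricRep (hy : y ∈ chartTarget c) :
    DifferentiableAt ℝ (S.metricRep c) y :=
  (S.contDiffAt_metricRep c hy).differentiableAt (by simp)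

lemma fderiv_metricRep_symm [T2Space M] (hy : y ∈ chartTarget c) (a v w : ModelE n) :
    fderiv ℝ (S.metricRep c) y a v w = fderiv ℝ (S.metricRep c) y a w v := by
  have hd := S.differentiableAt_metricRep c hy
  have key : ∀ v w, fderiv ℝ (fun z => S.metricRep c z v w) y a =
      fderiv ℝ (S.metricRep c) y a v w := by
    intro v w
    rw [fderiv_clm_apply (hd.clm_apply (differentiableAt_const v)) (differentiableAt_const w),
      fderiv_clm_apply hd (differentiableAt_const v)]
    simp
  rw [← key, ← key]
  congr 1
  apply Filter.EventuallyEq.fderiv_eq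
  filter_upwards [chartTarget_mem_nhds hy] with z hz
  exact S.metricRep_symm c hz v w

lemma fderiv_metric_fields {g : ModelE n → ModelE n →L[ℝ] ModelE n →L[ℝ] ℝ}
    {X Y : ModelE n → ModelE n} (hg : DifferentiableAt ℝ g y) (hX : DifferentiableAt ℝ X y)
    (hY : DifferentiableAt ℝ Y y) (a : ModelE n) :
    fderiv ℝ (fun z => g z (X z) (Y z)) y a =
      fderiv ℝ g y a (X y) (Y y) + g y (fderiv ℝ X y a) (Y y) + g y (X y) (fderiv ℝ Y y a) := by
  rw [fderiv_clm_apply (hg.clm_apply hX) hY, fderiv_clm_apply hg hX]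
  simp
  ring

/-- The Koszul expression in coordinates: `g(D_X Y, Z) + Γ(X, Y, Z)`. -/
lemma koszul_eq [T2Space M] (hy : y ∈ chartTarget c) {X Y Z : VField n M}
    (hX : ContDiffAt ℝ ∞ (fieldRep c X) y) (hY : ContDiffAt ℝ ∞ (fieldRep c Y) y)
    (hZ : ContDiffAt ℝ ∞ (fieldRep c Z) y) :
    S.koszul X Y Z (chartPt c y) =
      S.metricRep c y (fderiv ℝ (fieldRep c Y) y (fieldRep c X y)) (fieldRep c Z y)
        + S.gammaRep c y (fieldRep c X y) (fieldRep c Y y) (fieldRep c Z y) := by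
  have hg := S.differentiableAt_metricRep c hy
  have dX := hX.differentiableAt (by simp)
  have dY := hY.differentiableAt (by simp)
  have dZ := hZ.differentiableAt (by simp)
  have mX := ((contMDiffAt_field_iff (k := ⊤) c hy).2 hX).mdifferentiableAt (by simp)
  have mY := ((contMDiffAt_field_iff (k := ⊤) c hy).2 hY).mdifferentiableAt (by simp)
  have mZ := ((contMDiffAt_field_iff (k := ⊤) c hy).2 hZ).mdifferentiableAt (by simp)
  have hD : ∀ {U W : VField n M}, DifferentiableAt ℝ (fieldRep c U) y →
      DifferentiableAt ℝ (fieldRep c W) y → ∀ v : TangentSpace (𝓡 (2 * n + 1)) (chartPt c y),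
      dirDeriv (fun x => S.webster x (U x) (W x)) (chartPt c y) v = _ :=
    fun {U W} hU hW v => (dirDeriv_eq_fderiv c hy
      (w := fun z => S.metricRep c z (fieldRep c U z) (fieldRep c W z)) (by
        filter_upwards [chartTarget_mem_nhds hy] with z hz
        exact S.webster_eq c hz _ _) ((hg.clm_apply hU).clm_apply hW) v).trans
      (fderiv_metric_fields hg hU hW _)
  have hB : ∀ {U W : VField n M}, MDifferentiableAt (𝓡 (2 * n + 1)) (𝓡 (2 * n + 1)).tangent
      (fun x => (⟨x, U x⟩ : TangentBundle (𝓡 (2 * n + 1)) M)) (chartPt c y) →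
      MDifferentiableAt (𝓡 (2 * n + 1)) (𝓡 (2 * n + 1)).tangent
      (fun x => (⟨x, W x⟩ : TangentBundle (𝓡 (2 * n + 1)) M)) (chartPt c y) →
      ∀ v : TangentSpace (𝓡 (2 * n + 1)) (chartPt c y),
      S.webster (chartPt c y) (bracket U W (chartPt c y)) v =
        S.metricRep c y (fderiv ℝ (fieldRep c W) y (fieldRep c U y)
          - fderiv ℝ (fieldRep c U) y (fieldRep c W y)) (chartDiff c _ v) := by
    intro U W hU hW v
    rw [S.webster_eq c hy]
    have hb := fieldRep_bracket c hy hU hW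
    rw [fieldRep] at hb
    rw [hb, VectorField.lieBracket_eq]
  rw [koszul, hD dY dZ, hD dX dZ, hD dX dY, hB mX mY, hB mX mZ, hB mY mZ, gammaRep]
  change (1 / 2) * _ = _
  have hX' : chartDiff c (chartPt c y) (X (chartPt c y)) = fieldRep c X y := rfl
  have hY' : chartDiff c (chartPt c y) (Y (chartPt c y)) = fieldRep c Y y := rfl
  have hZ' : chartDiff c (chartPt c y) (Z (chartPt c y)) = fieldRep c Z y := rfl
  rw [hX', hY', hZ']
  simp only [map_sub, sub_apply]
  have s1 := S.metricRep_symm c hy (fieldRep c X y) (fderiv ℝ (fieldRep c Z) y (fieldRep c Y y))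
  have s2 := S.metricRep_symm c hy (fieldRep c Y y) (fderiv ℝ (fieldRep c Z) y (fieldRep c X y))
  have s3 := S.metricRep_symm c hy (fieldRep c X y) (fderiv ℝ (fieldRep c Y) y (fieldRep c Z y))
  have s4 := S.metricRep_symm c hy (fieldRep c Y y) (fderiv ℝ (fieldRep c X) y (fieldRep c Z y))
  linarith

end StrictlyPseudoconvexCR

end HorizontalFrames

/-! ### The sub-Laplacian in charts -/

section ChartSubLaplacian

variable {n : ℕ} {M : Type*} [TopologicalSpace M] [ChartedSpace (ModelE n) M]
  [IsManifold (𝓡 (2 * n + 1)) ∞ M]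

lemma ContMDiff.contDiffAt_comp_chartPt {F : Type*} [NormedAddCommGroup F] [NormedSpace ℝ F]
    {u : M → F} {k : ℕ∞} (hu : ContMDiff (𝓡 (2 * n + 1)) 𝓘(ℝ, F) k u) (c : M) {y : ModelE n}
    (hy : y ∈ chartTarget c) : ContDiffAt ℝ k (u ∘ chartPt c) y :=
  ((hu _).comp y ((contMDiffAt_chartPt c hy).of_le (by exact_mod_cast le_top))).contDiffAt

namespace StrictlyPseudoconvexCR
variable (S : StrictlyPseudoconvexCR n M) (c : M) {y : ModelE n}

lemma fieldRep_hextend {z : ModelE n} (hz : z ∈ chartTarget c) {x : M}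
    (v : TangentSpace (𝓡 (2 * n + 1)) x) :
    fieldRep c (S.hextend v) z = S.projRep c z (fieldRep c (extendVec v) z) :=
  S.chartDiff_hproj c hz _

lemma contDiffAt_fieldRep_hextend (hy : y ∈ chartTarget c)
    (v : TangentSpace (𝓡 (2 * n + 1)) (chartPt c y)) :
    ContDiffAt ℝ ∞ (fieldRep c (S.hextend v)) y := by
  have h2 := S.contDiffAt_thetaRep c hy
  have h3 := S.contDiffAt_reebRep c hy
  have h4 := contDiffAt_fieldRep_extendVec c hy v
  refine (h4.sub ((h2.clm_apply h4).smul h3)).congr_of_eventuallyEq ?_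
  filter_upwards [chartTarget_mem_nhds hy] with z hz
  rw [S.fieldRep_hextend c hz]; rfl

lemma fieldRep_hextend_self (hy : y ∈ chartTarget c)
    {v : TangentSpace (𝓡 (2 * n + 1)) (chartPt c y)} (hv : S.thetaRep c y (chartDiff c _ v) = 0) :
    fieldRep c (S.hextend v) y = chartDiff c _ v := by
  rw [S.fieldRep_hextend c hy, fieldRep_extendVec, S.projRep_of_horizontal c hv]

lemma chartDiff_tanakaWebster [T2Space M] (hy : y ∈ chartTarget c) (i : Fin (2 * n)) :
    chartDiff c _ (S.tanakaWebster (S.hextend (S.onb (chartPt c y) i)) (chartPt c y)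
      (S.onb (chartPt c y) i)) =
    ∑ k, (S.metricRep c y (fderiv ℝ (fieldRep c (S.hextend (S.onb (chartPt c y) i))) y
        (S.onbRep c y i)) (S.onbRep c y k)
      + S.gammaRep c y (S.onbRep c y i) (S.onbRep c y i) (S.onbRep c y k)) • S.onbRep c y k := by
  rw [tanakaWebster, map_sum]
  refine Finset.sum_congr rfl fun k _ => ?_
  rw [map_smul, S.koszul_eq c hy (contDiffAt_fieldRep_extendVec c hy _)
    (S.contDiffAt_fieldRep_hextend c hy _) (contDiffAt_fieldRep_extendVec c hy _),
    fieldRep_extendVec, fieldRep_extendVec,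
    S.fieldRep_hextend_self c hy (S.thetaRep_onbRep c hy i)]
  rfl

/-- The diagonal entry `∇dw(e_i, e_i)` of the horizontal Hessian in the chart at `c`, in terms of
the vectors `e_i` alone. The term with `(D_{e_i} θ)(e_i)` is the Reeb component of the derivative of
a horizontal extension of `e_i`, which does not depend on the extension. -/
def hessRep {F : Type*} [NormedAddCommGroup F] [NormedSpace ℝ F] (c : M) (w : ModelE n → F)
    (y : ModelE n) (i : Fin (2 * n)) : F :=
  fderiv ℝ (fderiv ℝ w) y (S.onbRep c y i) (S.onbRep c y i)
    - fderiv ℝ (S.thetaRep c) y (S.onbRep c y i) (S.onbRep c y i) •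
      fderiv ℝ w y (S.reebRep c y)
    - ∑ k, S.gammaRep c y (S.onbRep c y i) (S.onbRep c y i) (S.onbRep c y k) •
      fderiv ℝ w y (S.onbRep c y k)

/-- The derivative `D_e E` of the horizontal extension `E` of `e` enters both terms on the left; its
horizontal part cancels, and its Reeb component is `-(D_e θ)(e)` because `θ(E) = 0`. -/
lemma hess_eq [T2Space M] {F : Type*} [NormedAddCommGroup F] [NormedSpace ℝ F]
    (hy : y ∈ chartTarget c) {u : M → F} (hu : ContMDiff (𝓡 (2 * n + 1)) 𝓘(ℝ, F) 2 u)
    (i : Fin (2 * n)) :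
    dirDeriv (fun x => dirDeriv u x (S.hextend (S.onb (chartPt c y) i) x)) (chartPt c y)
        (S.onb (chartPt c y) i)
      - dirDeriv u (chartPt c y) (S.tanakaWebster (S.hextend (S.onb (chartPt c y) i)) (chartPt c y)
        (S.onb (chartPt c y) i)) = S.hessRep c (u ∘ chartPt c) y i := by
  set w : ModelE n → F := u ∘ chartPt c
  set E := fieldRep c (S.hextend (S.onb (chartPt c y) i))
  set e := S.onbRep c y i
  have hw : ∀ {z}, z ∈ chartTarget c → ContDiffAt ℝ 2 w z := fun hz =>
    hu.contDiffAt_comp_chartPt (k := 2) c hz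
  have hE : ContDiffAt ℝ ∞ E y := S.contDiffAt_fieldRep_hextend c hy _
  have dE := hE.differentiableAt (by simp)
  have dw : DifferentiableAt ℝ (fderiv ℝ w) y :=
    ((hw hy).fderiv_right (m := 1) (by norm_num)).differentiableAt (by simp)
  have hEy : E y = e := S.fieldRep_hextend_self c hy (S.thetaRep_onbRep c hy i)
  have h1 : dirDeriv (fun x => dirDeriv u x (S.hextend (S.onb (chartPt c y) i) x)) (chartPt c y)
      (S.onb (chartPt c y) i) = fderiv ℝ (fderiv ℝ w) y e e + fderiv ℝ w y (fderiv ℝ E y e) := by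
    rw [dirDeriv_eq_fderiv c hy (w := fun z => fderiv ℝ w z (E z)) _ (dw.clm_apply dE),
      fderiv_clm_apply dw dE]
    · simp [hEy, add_comm]; rfl
    · filter_upwards [chartTarget_mem_nhds hy] with z hz
      exact dirDeriv_eq_fderiv c hz (EventuallyEq.refl _ _)
        ((hw hz).differentiableAt (by simp)) _
  have h2 : dirDeriv u (chartPt c y) (S.tanakaWebster (S.hextend (S.onb (chartPt c y) i))
      (chartPt c y) (S.onb (chartPt c y) i)) = _ :=
    dirDeriv_eq_fderiv c hy (EventuallyEq.refl _ w) ((hw hy).differentiableAt (by simp)) _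
  rw [h1, h2, S.chartDiff_tanakaWebster c hy]
  -- differentiate `θ(E) = 0` in the direction `e`
  have h3 : fderiv ℝ (S.thetaRep c) y e e + S.thetaRep c y (fderiv ℝ E y e) = 0 := by
    have hev : (fun z => S.thetaRep c z (E z)) =ᶠ[𝓝 y] fun _ => 0 := by
      filter_upwards [chartTarget_mem_nhds hy] with z hz
      rw [show E z = _ from S.fieldRep_hextend c hz _, S.thetaRep_projRep c hz]
    have h := fderiv_clm_apply (S.differentiableAt_thetaRep c hy) dE
    rw [hev.fderiv_eq] at h
    have h4 := DFunLike.congr_fun h e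
    simp [hEy] at h4
    linarith
  have h4 := S.projRep_eq_sum c hy (fderiv ℝ E y e)
  rw [projRep_apply] at h4
  have h5 : fderiv ℝ w y (fderiv ℝ E y e) = S.thetaRep c y (fderiv ℝ E y e) •
      fderiv ℝ w y (S.reebRep c y) + ∑ k, S.metricRep c y (fderiv ℝ E y e) (S.onbRep c y k) •
        fderiv ℝ w y (S.onbRep c y k) := by
    have := congrArg (fderiv ℝ w y) h4
    simp only [map_sub, map_smul, map_sum] at this
    rw [← this]; abel
  rw [h5, eq_neg_of_add_eq_zero_right h3, hessRep]
  simp only [add_smul, Finset.sum_add_distrib, map_add, map_sum, map_smul, neg_smul]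
  abel

lemma subLaplacian_eq_sum [T2Space M] (hy : y ∈ chartTarget c) {u : M → ℝ}
    (hu : ContMDiff (𝓡 (2 * n + 1)) 𝓘(ℝ, ℝ) 2 u) :
    S.subLaplacian u (chartPt c y) = ∑ i, S.hessRep c (u ∘ chartPt c) y i :=
  Finset.sum_congr rfl fun i _ => S.hess_eq c hy hu i

/-- The horizontal gradient in the chart at `c`. -/
def gradRep (c : M) (w : ModelE n → ℝ) (y : ModelE n) : ModelE n :=
  ∑ i, fderiv ℝ w y (S.onbRep c y i) • S.onbRep c y i

lemma thetaRep_gradRep [T2Space M] (hy : y ∈ chartTarget c) (w : ModelE n → ℝ) :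
    S.thetaRep c y (S.gradRep c w y) = 0 := by
  simp [gradRep, S.thetaRep_onbRep c hy]

/-- The basis-free characterization of the horizontal gradient. -/
lemma metricRep_gradRep [T2Space M] (hy : y ∈ chartTarget c) (w : ModelE n → ℝ) (v : ModelE n) :
    S.metricRep c y (S.gradRep c w y) v = fderiv ℝ w y (S.projRep c y v) := by
  rw [S.projRep_eq_sum c hy, gradRep]
  simp only [map_sum, map_smul, sum_apply, smul_apply, smul_eq_mul]
  exact Finset.sum_congr rfl fun i _ => by rw [S.metricRep_symm c hy v]; ring

lemma metricRep_injective (hy : y ∈ chartTarget c) : Function.Injective (S.metricRep c y) := by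
  rw [injective_iff_map_eq_zero]
  intro v hv
  by_contra h
  have := S.metricRep_pos c hy h
  rw [hv] at this
  exact lt_irrefl _ this

/-- Although `onb` is not continuous, the gradient is `C¹`: it solves a linear system with smooth
nondegenerate matrix and right-hand side `dw ∘ proj`. -/
lemma contDiffAt_gradRep [T2Space M] (hy : y ∈ chartTarget c) {w : ModelE n → ℝ}
    (hw : ContDiffAt ℝ 2 w y) : ContDiffAt ℝ 1 (S.gradRep c w) y := by
  have h1 : ContDiffAt ℝ 1 (fderiv ℝ w) y := hw.fderiv_right (by norm_num)
  have h2 := (S.contDiffAt_thetaRep c hy).of_le (m := 1) (by exact_mod_cast le_top)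
  have h3 := (S.contDiffAt_reebRep c hy).of_le (m := 1) (by exact_mod_cast le_top)
  have h4 := (S.contDiffAt_metricRep c hy).of_le (m := 1) (by exact_mod_cast le_top)
  have hP : ContDiffAt ℝ 1 (fun z => (fderiv ℝ w z).comp (S.projRep c z)) y := by
    refine ContDiffAt.of_clm_apply fun v => ?_
    exact h1.clm_apply (contDiffAt_const.sub ((h2.clm_apply contDiffAt_const).smul h3))
  obtain ⟨e, he⟩ := exists_equiv_of_injective (S.metricRep_injective c hy)
  have h5 : ContDiffAt ℝ 1 (fun z => (S.metricRep c z).inverse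
      ((fderiv ℝ w z).comp (S.projRep c z))) y := by
    refine ContDiffAt.clm_apply ?_ hP
    exact ContDiffAt.comp y (g := ContinuousLinearMap.inverse) (by
      rw [← he]; exact contDiffAt_map_inverse e) h4
  refine h5.congr_of_eventuallyEq ?_
  filter_upwards [chartTarget_mem_nhds hy] with z hz
  obtain ⟨e, he⟩ := exists_equiv_of_injective (S.metricRep_injective c hz)
  apply S.metricRep_injective c hz
  rw [← he, ContinuousLinearMap.inverse_equiv]
  change _ = e (e.symm _)
  rw [e.apply_symm_apply, he]
  ext v
  exact S.metricRep_gradRep c hz w v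

/-- Half the Lie derivative `(L_Z g)(v, v)` of the Webster metric along `Z`, in the chart at `c`.
Its trace is the Riemannian divergence of `Z`. -/
def strainRep (c : M) (Z : ModelE n → ModelE n) (y v : ModelE n) : ℝ :=
  S.metricRep c y (fderiv ℝ Z y v) v + (1 / 2) * fderiv ℝ (S.metricRep c) y (Z y) v v

/-- A horizontal field has no strain in the Reeb direction, so that the trace over horizontal
vectors alone is the full divergence. It follows from `g(ξ, ·) = θ` and `dθ(ξ, ·) = 0`. -/
lemma strainRep_reebRep [T2Space M] (hy : y ∈ chartTarget c) {Z : ModelE n → ModelE n}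
    (hZ : DifferentiableAt ℝ Z y) (hZ0 : ∀ᶠ z in 𝓝 y, S.thetaRep c z (Z z) = 0) :
    S.strainRep c Z y (S.reebRep c y) = 0 := by
  have dθ := S.differentiableAt_thetaRep c hy
  have dξ := (S.contDiffAt_reebRep c hy).differentiableAt (by simp)
  have dg := S.differentiableAt_metricRep c hy
  have h1 : fderiv ℝ (S.thetaRep c) y (S.reebRep c y) (Z y)
      + S.thetaRep c y (fderiv ℝ Z y (S.reebRep c y)) = 0 := by
    have h := fderiv_clm_apply dθ hZ
    rw [EventuallyEq.fderiv_eq (f := fun _ => (0 : ℝ)) hZ0] at h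
    have h4 := DFunLike.congr_fun h (S.reebRep c y)
    simp at h4
    linarith
  have h2 : fderiv ℝ (S.thetaRep c) y (Z y) (S.reebRep c y)
      + S.thetaRep c y (fderiv ℝ (S.reebRep c) y (Z y)) = 0 := by
    have h := fderiv_clm_apply dθ dξ
    have hev : (fun z => S.thetaRep c z (S.reebRep c z)) =ᶠ[𝓝 y] fun _ => 1 := by
      filter_upwards [chartTarget_mem_nhds hy] with z hz
      exact S.thetaRep_reebRep c hz
    rw [hev.fderiv_eq] at h
    have h4 := DFunLike.congr_fun h (Z y)
    simp at h4
    linarith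
  have h3 := fderiv_metric_fields dg dξ dξ (Z y)
  have hev : (fun z => S.metricRep c z (S.reebRep c z) (S.reebRep c z)) =ᶠ[𝓝 y] fun _ => 1 := by
    filter_upwards [chartTarget_mem_nhds hy] with z hz
    rw [S.metricRep_reebRep_left c hz, S.thetaRep_reebRep c hz]
  rw [hev.fderiv_eq, S.metricRep_reebRep_left c hy, S.metricRep_reebRep_right c hy] at h3
  simp at h3
  have h4 := S.omegaRep_reebRep c hy (Z y)
  rw [omegaRep_apply] at h4
  rw [strainRep, S.metricRep_reebRep_right c hy]
  linarith

/-- The sub-Laplacian is the trace of the strain of the horizontal gradient. -/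
lemma hessRep_eq_strainRep_sum [T2Space M] (hy : y ∈ chartTarget c) {w : ModelE n → ℝ}
    (hw : ContDiffAt ℝ 2 w y) :
    ∑ i, S.hessRep c w y i = ∑ i, S.strainRep c (S.gradRep c w) y (S.onbRep c y i) := by
  refine Finset.sum_congr rfl fun i _ => ?_
  set e := S.onbRep c y i
  set Z := S.gradRep c w
  have dZ : DifferentiableAt ℝ Z y := (S.contDiffAt_gradRep c hy hw).differentiableAt (by simp)
  have dθ := S.differentiableAt_thetaRep c hy
  have dξ := (S.contDiffAt_reebRep c hy).differentiableAt (by simp)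
  have dg := S.differentiableAt_metricRep c hy
  have dw : DifferentiableAt ℝ (fderiv ℝ w) y :=
    (hw.fderiv_right (m := 1) (by norm_num)).differentiableAt (by simp)
  have hθe : S.thetaRep c y e = 0 := S.thetaRep_onbRep c hy i
  -- differentiate `g(Z, v) = dw(v - θ(v) ξ)` with `v = e` constant, in the direction `e`
  have h1 : fderiv ℝ (S.metricRep c) y e (Z y) e + S.metricRep c y (fderiv ℝ Z y e) e =
      fderiv ℝ (fderiv ℝ w) y e e - fderiv ℝ (S.thetaRep c) y e e *
        fderiv ℝ w y (S.reebRep c y) := by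
    have h := fderiv_metric_fields dg dZ (differentiableAt_const e) e
    have hev : (fun z => S.metricRep c z (Z z) e) =ᶠ[𝓝 y]
        fun z => fderiv ℝ w z (e - S.thetaRep c z e • S.reebRep c z) := by
      filter_upwards [chartTarget_mem_nhds hy] with z hz
      exact S.metricRep_gradRep c hz w e
    have dP : DifferentiableAt ℝ (fun z => e - S.thetaRep c z e • S.reebRep c z) y :=
      (differentiableAt_const e).sub ((dθ.clm_apply (differentiableAt_const e)).smul dξ)
    rw [hev.fderiv_eq, fderiv_clm_apply dw dP, fderiv_const_sub,
      fderiv_fun_smul (dθ.clm_apply (differentiableAt_const e)) dξ,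
      fderiv_clm_apply dθ (differentiableAt_const e)] at h
    simp [hθe] at h
    linarith
  have h2 : ∑ k, S.gammaRep c y e e (S.onbRep c y k) • fderiv ℝ w y (S.onbRep c y k) =
      fderiv ℝ (S.metricRep c) y e e (Z y) - (1 / 2) * fderiv ℝ (S.metricRep c) y (Z y) e e := by
    have hZ : ∀ L : ModelE n →L[ℝ] ℝ, L (Z y) =
        ∑ k, fderiv ℝ w y (S.onbRep c y k) * L (S.onbRep c y k) := fun L => by
      simp only [Z, gradRep, map_sum, map_smul, smul_eq_mul]
    have hZ2 := hZ (((fderiv ℝ (S.metricRep c) y).flip e).flip e)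
    simp only [ContinuousLinearMap.flip_apply] at hZ2
    rw [hZ (fderiv ℝ (S.metricRep c) y e e), hZ2, Finset.mul_sum, ← Finset.sum_sub_distrib]
    refine Finset.sum_congr rfl fun k _ => ?_
    rw [gammaRep, smul_eq_mul]
    ring
  rw [hessRep, h2, strainRep, smul_eq_mul, S.fderiv_metricRep_symm c hy e e (Z y)]
  linarith

end StrictlyPseudoconvexCR

end ChartSubLaplacian

/-! ### The sub-Laplacian in divergence form -/

section DivergenceForm

section MatrixCalculus

variable {ι : Type*} [Fintype ι] [DecidableEq ι]

lemma contDiff_det : ContDiff ℝ ∞ (fun A : ι → ι → ℝ => (Matrix.of A).det) := by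
  simp only [Matrix.det_apply, Matrix.of_apply]
  refine ContDiff.sum fun σ _ => ContDiff.const_smul _ (contDiff_prod fun i _ => ?_)
  exact (contDiff_apply_apply ℝ ℝ (σ i) i)

/-- Jacobi's formula for the derivative of the determinant. -/
lemma fderiv_det_apply (A B : ι → ι → ℝ) (hA : IsUnit (Matrix.of A).det) :
    fderiv ℝ (fun A : ι → ι → ℝ => (Matrix.of A).det) A B =
      (Matrix.of A).det * ((Matrix.of A)⁻¹ * Matrix.of B).trace := by
  have h1 : HasDerivAt (fun t : ℝ => (Matrix.of (A + t • B)).det)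
      (fderiv ℝ (fun A : ι → ι → ℝ => (Matrix.of A).det) A B) 0 := by
    have hd : HasFDerivAt (fun A : ι → ι → ℝ => (Matrix.of A).det)
        (fderiv ℝ (fun A : ι → ι → ℝ => (Matrix.of A).det) A) (A + (0 : ℝ) • B) := by
      rw [zero_smul, add_zero]
      exact (contDiff_det.differentiable (by simp) A).hasFDerivAt
    have hl : HasDerivAt (fun t : ℝ => A + t • B) B 0 := by
      simpa using ((hasDerivAt_id (0 : ℝ)).smul_const B).const_add A
    exact hd.comp_hasDerivAt (0 : ℝ) hl
  set X := (Matrix.of A)⁻¹ * Matrix.of B with hX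
  set P := ((1 + (Polynomial.X : Polynomial ℝ) • X.map Polynomial.C).det.divX.divX) with hP
  have h2 : (fun t : ℝ => (Matrix.of (A + t • B)).det) =
      fun t => (Matrix.of A).det * (1 + X.trace * t + P.eval t * t ^ 2) := by
    funext t
    rw [← Matrix.det_one_add_smul, ← Matrix.det_mul]
    congr 1
    rw [mul_add, mul_one, Matrix.mul_smul, hX, ← mul_assoc, Matrix.mul_nonsing_inv _ hA, one_mul]
    rfl
  have h3 : HasDerivAt (fun t : ℝ => (Matrix.of A).det * (1 + X.trace * t + P.eval t * t ^ 2))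
      ((Matrix.of A).det * X.trace) 0 := by
    have ha := ((hasDerivAt_id (0 : ℝ)).const_mul X.trace).const_add 1
    have hb := (P.hasDerivAt 0).mul ((hasDerivAt_id (0 : ℝ)).pow 2)
    have := (ha.add hb).const_mul (Matrix.of A).det
    simpa using this
  rw [h2] at h1
  exact h1.unique h3

lemma fderiv_det {X : Type*} [NormedAddCommGroup X] [NormedSpace ℝ X] {A : X → Matrix ι ι ℝ}
    {x : X} (hA : ∀ i j, DifferentiableAt ℝ (fun z => A z i j) x) (hdet : IsUnit (A x).det)
    (v : X) : fderiv ℝ (fun z => (A z).det) x v =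
      (A x).det * ((A x)⁻¹ * Matrix.of fun i j => fderiv ℝ (fun z => A z i j) x v).trace := by
  have hA1 : ∀ i, DifferentiableAt ℝ (fun z => (A z) i) x := fun i =>
    differentiableAt_pi.2 fun j => hA i j
  have hA' : DifferentiableAt ℝ (fun z => (fun i j => A z i j : ι → ι → ℝ)) x :=
    differentiableAt_pi.2 hA1
  have h := fderiv_comp x (g := fun A : ι → ι → ℝ => (Matrix.of A).det)
    (contDiff_det.differentiable (by simp) _) hA'
  have h' := DFunLike.congr_fun h v
  refine h'.trans ?_
  rw [ContinuousLinearMap.comp_apply, fderiv_det_apply _ _ hdet]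
  congr 3
  ext i j
  have e1 : fderiv ℝ (fun z => (fun i j => A z i j : ι → ι → ℝ)) x v i =
      fderiv ℝ (fun z => A z i) x v := by
    rw [fderiv_pi hA1]; rfl
  have e2 : fderiv ℝ (fun z => A z i) x v j = fderiv ℝ (fun z => A z i j) x v := by
    rw [fderiv_pi (hA i)]; rfl
  rw [Matrix.of_apply, Matrix.of_apply, e1, e2]

/-- The trace of a bilinear form in a basis that is orthonormal for `G`. The basis may be indexed by
any type of the right cardinality. -/
lemma trace_transpose_mul_mul {κ : Type*} [Fintype κ] [DecidableEq κ]
    (hcard : Fintype.card κ = Fintype.card ι) {G : Matrix ι ι ℝ} {E : Matrix ι κ ℝ}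
    (hE : E.transpose * G * E = 1) (B : Matrix ι ι ℝ) :
    (E.transpose * B * E).trace = (B * G⁻¹).trace := by
  have h1 : E * (E.transpose * G) = 1 :=
    (Matrix.mul_eq_one_comm_of_card_eq _ _ _ hcard).1 hE
  have h2 : G⁻¹ = E * E.transpose := Matrix.inv_eq_left_inv (by rw [Matrix.mul_assoc, h1])
  rw [h2, Matrix.mul_assoc, Matrix.trace_mul_comm, Matrix.mul_assoc]

end MatrixCalculus

variable {n : ℕ} {M : Type*} [TopologicalSpace M] [ChartedSpace (ModelE n) M]
  [IsManifold (𝓡 (2 * n + 1)) ∞ M]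

lemma modelE_eq_sum (v : ModelE n) :
    v = ∑ i, v i • (EuclideanSpace.single i (1 : ℝ) : ModelE n) := by
  ext j
  simp [Finset.sum_apply, Pi.single_apply]

/-- The matrix of a bilinear form in the standard basis. -/
def bilinMatrix (b : ModelE n →L[ℝ] ModelE n →L[ℝ] ℝ) :
    Matrix (Fin (2 * n + 1)) (Fin (2 * n + 1)) ℝ :=
  Matrix.of fun i j => b (EuclideanSpace.single i 1) (EuclideanSpace.single j 1)

lemma bilinMatrix_transpose_mul_mul {κ : Type*} (b : ModelE n →L[ℝ] ModelE n →L[ℝ] ℝ)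
    (e : κ → ModelE n) (k l : κ) :
    ((Matrix.of fun i k => e k i).transpose * bilinMatrix b * Matrix.of fun i k => e k i :
      Matrix κ κ ℝ) k l = b (e k) (e l) := by
  conv_rhs => rw [modelE_eq_sum (e k), modelE_eq_sum (e l)]
  simp only [map_sum, map_smul, sum_apply, smul_apply, smul_eq_mul, Matrix.mul_apply,
    Matrix.transpose_apply, Matrix.of_apply, bilinMatrix]
  refine Finset.sum_congr rfl fun j _ => ?_
  rw [Finset.mul_sum, Finset.sum_mul]
  exact Finset.sum_congr rfl fun i _ => by ring

namespace StrictlyPseudoconvexCR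
variable (S : StrictlyPseudoconvexCR n M) (c : M) {y : ModelE n}

/-- The Gram matrix of the Webster metric in the chart at `c`. -/
def gramRep (c : M) (y : ModelE n) : Matrix (Fin (2 * n + 1)) (Fin (2 * n + 1)) ℝ :=
  bilinMatrix (S.metricRep c y)

/-- The `g_θ`-orthonormal basis of the whole tangent space that consists of the horizontal basis and
the Reeb vector. -/
def frameRep (c : M) (y : ModelE n) : Fin (2 * n) ⊕ Unit → ModelE n :=
  Sum.elim (S.onbRep c y) fun _ => S.reebRep c y

lemma metricRep_frameRep [T2Space M] (hy : y ∈ chartTarget c) (k l : Fin (2 * n) ⊕ Unit) :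
    S.metricRep c y (S.frameRep c y k) (S.frameRep c y l) = if k = l then 1 else 0 := by
  rcases k with k | k <;> rcases l with l | l
  · simp [frameRep, S.metricRep_onbRep c hy]
  · simp [frameRep, S.metricRep_reebRep_right c hy, S.thetaRep_onbRep c hy]
  · simp [frameRep, S.metricRep_reebRep_left c hy, S.thetaRep_onbRep c hy]
  · simp [frameRep, S.metricRep_reebRep_left c hy, S.thetaRep_reebRep c hy]

lemma sum_frameRep [T2Space M] (hy : y ∈ chartTarget c)
    (b : ModelE n →L[ℝ] ModelE n →L[ℝ] ℝ) :
    ∑ k, b (S.frameRep c y k) (S.frameRep c y k) =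
      (bilinMatrix b * (S.gramRep c y)⁻¹).trace := by
  rw [← trace_transpose_mul_mul (κ := Fin (2 * n) ⊕ Unit)
    (E := Matrix.of fun i k => S.frameRep c y k i) (by simp)]
  · rw [Matrix.trace]
    exact Finset.sum_congr rfl fun k _ => (bilinMatrix_transpose_mul_mul b _ k k).symm
  · ext k l
    rw [gramRep, bilinMatrix_transpose_mul_mul, S.metricRep_frameRep c hy, Matrix.one_apply]

lemma posDef_gramRep [T2Space M] (hy : y ∈ chartTarget c) : (S.gramRep c y).PosDef := by
  refine Matrix.PosDef.of_dotProduct_mulVec_pos ?_ ?_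
  · ext i j
    simp [gramRep, bilinMatrix, S.metricRep_symm c hy (EuclideanSpace.single i 1)]
  · intro x hx
    have h := S.metricRep_pos c hy (v := WithLp.toLp 2 x) (by simpa using hx)
    rw [modelE_eq_sum (WithLp.toLp 2 x)] at h
    simp only [map_sum, map_smul, sum_apply, smul_apply, smul_eq_mul] at h
    simp only [Finset.mul_sum] at h
    rw [Finset.sum_comm] at h
    simpa [dotProduct, Matrix.mulVec, gramRep, bilinMatrix, Finset.mul_sum, mul_comm,
      mul_left_comm] using h

/-- The density `√(det g)` of the Riemannian volume in the chart at `c`. -/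
def densRep (c : M) (y : ModelE n) : ℝ := Real.sqrt (S.gramRep c y).det

lemma densRep_pos [T2Space M] (hy : y ∈ chartTarget c) : 0 < S.densRep c y :=
  Real.sqrt_pos.2 (S.posDef_gramRep c hy).det_pos

lemma chartDensity_eq (hy : y ∈ chartTarget c) :
    S.chartDensity c y = ENNReal.ofReal (S.densRep c y) := by
  rw [chartDensity, densRep]
  congr 3
  ext i j
  rw [Matrix.of_apply, S.webster_eq c hy, gramRep, bilinMatrix, Matrix.of_apply]
  congr 1
  · congr 1
    exact chartDiff_chartFrame c hy _
  · exact chartDiff_chartFrame c hy _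

lemma contDiffAt_gramRep_det (hy : y ∈ chartTarget c) :
    ContDiffAt ℝ ∞ (fun z => (S.gramRep c z).det) y := by
  have h : ContDiffAt ℝ ∞ (fun z i j => S.gramRep c z i j) y :=
    contDiffAt_pi.2 fun i => contDiffAt_pi.2 fun j =>
      ((S.contDiffAt_metricRep c hy).clm_apply contDiffAt_const).clm_apply contDiffAt_const
  exact contDiff_det.contDiffAt.comp y h

lemma contDiffAt_densRep [T2Space M] (hy : y ∈ chartTarget c) :
    ContDiffAt ℝ ∞ (S.densRep c) y :=
  (S.contDiffAt_gramRep_det c hy).sqrt (S.posDef_gramRep c hy).det_pos.ne'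

/-- The logarithmic derivative of the density is half the trace of the derivative of the metric. -/
lemma fderiv_densRep [T2Space M] (hy : y ∈ chartTarget c) (v : ModelE n) :
    fderiv ℝ (S.densRep c) y v = S.densRep c y *
      ∑ k, (1 / 2) * fderiv ℝ (S.metricRep c) y v (S.frameRep c y k) (S.frameRep c y k) := by
  have hpos := (S.posDef_gramRep c hy).det_pos
  have hg := S.differentiableAt_metricRep c hy
  have hB : bilinMatrix (fderiv ℝ (S.metricRep c) y v) =
      Matrix.of fun i j => fderiv ℝ (fun z => S.gramRep c z i j) y v := by
    ext i j
    have := fderiv_metric_fields hg (differentiableAt_const (EuclideanSpace.single i (1 : ℝ)))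
      (differentiableAt_const (EuclideanSpace.single j (1 : ℝ))) v
    simp only [fderiv_fun_const, Pi.zero_apply, zero_apply, map_zero, add_zero] at this
    exact this.symm
  have hd := fderiv_det (A := S.gramRep c) (x := y) (fun i j =>
    (hg.clm_apply (differentiableAt_const _)).clm_apply (differentiableAt_const _))
    hpos.ne'.isUnit v
  have h1 : fderiv ℝ (S.densRep c) y v = _ := DFunLike.congr_fun (fderiv_sqrt
    ((S.contDiffAt_gramRep_det c hy).differentiableAt (by simp)) hpos.ne') v
  rw [h1, ← Finset.mul_sum, S.sum_frameRep c hy, Matrix.trace_mul_comm, hB, smul_apply, hd,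
    smul_eq_mul, densRep]
  have h2 := Real.mul_self_sqrt hpos.le
  have h3 : Real.sqrt (S.gramRep c y).det ≠ 0 := (Real.sqrt_pos.2 hpos).ne'
  field_simp
  rw [sq, h2]

lemma sum_metricRep_frameRep [T2Space M] (hy : y ∈ chartTarget c)
    (L : ModelE n →L[ℝ] ModelE n) :
    ∑ k, S.metricRep c y (L (S.frameRep c y k)) (S.frameRep c y k) =
      ∑ a, L (EuclideanSpace.single a 1) a := by
  have h := S.sum_frameRep c hy ((S.metricRep c y).comp L)
  refine h.trans ?_
  have h2 : bilinMatrix ((S.metricRep c y).comp L) =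
      (Matrix.of fun a i => L (EuclideanSpace.single i 1) a).transpose * S.gramRep c y := by
    ext i j
    rw [bilinMatrix, Matrix.of_apply, ContinuousLinearMap.comp_apply,
      modelE_eq_sum (L (EuclideanSpace.single i 1))]
    simp [Matrix.mul_apply, gramRep, bilinMatrix]
  rw [h2, Matrix.mul_nonsing_inv_cancel_right _ _ (S.posDef_gramRep c hy).det_pos.ne'.isUnit]
  rfl

/-- The sub-Laplacian in divergence form, `√g Δ_b u = ∑ ∂_a (√g Z_a)` with `Z` the horizontal
gradient of `u` and the derivative of the product expanded. -/
lemma sum_fderiv_densRep_gradRep [T2Space M] (hy : y ∈ chartTarget c) {u : M → ℝ}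
    (hu : ContMDiff (𝓡 (2 * n + 1)) 𝓘(ℝ, ℝ) 2 u) :
    fderiv ℝ (S.densRep c) y (S.gradRep c (u ∘ chartPt c) y) + S.densRep c y *
      ∑ a, fderiv ℝ (S.gradRep c (u ∘ chartPt c)) y (EuclideanSpace.single a 1) a =
      S.densRep c y * S.subLaplacian u (chartPt c y) := by
  set w : ModelE n → ℝ := u ∘ chartPt c
  have hw : ContDiffAt ℝ 2 w y := hu.contDiffAt_comp_chartPt (k := 2) c hy
  have h0 := S.strainRep_reebRep c hy (Z := S.gradRep c w)
    ((S.contDiffAt_gradRep c hy hw).differentiableAt (by simp)) (by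
      filter_upwards [chartTarget_mem_nhds hy] with z hz
      exact S.thetaRep_gradRep c hz w)
  rw [S.subLaplacian_eq_sum c hy hu, S.hessRep_eq_strainRep_sum c hy hw, S.fderiv_densRep c hy,
    ← S.sum_metricRep_frameRep c hy, ← mul_add, ← Finset.sum_add_distrib,
    Fintype.sum_sum_type]
  have h1 : ∀ v, 1 / 2 * fderiv ℝ (S.metricRep c) y (S.gradRep c w y) v v +
      S.metricRep c y (fderiv ℝ (S.gradRep c w) y v) v = S.strainRep c (S.gradRep c w) y v :=
    fun v => add_comm _ _
  simp only [h1]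
  simp [frameRep, h0]

end StrictlyPseudoconvexCR

end DivergenceForm

/-! ### The carré du champ and Green's formula in a chart -/

section CarreDuChamp

lemma integral_fderiv_eq_zero {E : Type*} [NormedAddCommGroup E] [NormedSpace ℝ E]
    [FiniteDimensional ℝ E] [MeasurableSpace E] [BorelSpace E] (ν : Measure E)
    [ν.IsAddHaarMeasure] {g : E → ℝ} (hg : ContDiff ℝ 1 g) (hc : HasCompactSupport g) (v : E) :
    ∫ y, fderiv ℝ g y v ∂ν = 0 := by
  have hi : Integrable (fun y => fderiv ℝ g y v) ν :=
    ((hg.continuous_fderiv (by simp)).clm_apply continuous_const).integrable_of_hasCompactSupport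
      (hc.fderiv_apply ℝ v)
  have h := integral_mul_fderiv_eq_neg_fderiv_mul_of_integrable (μ := ν) (f := fun _ => (1 : ℝ))
    (g := g) (v := v) (by simp) (by simpa using hi)
    (by simpa using hg.continuous.integrable_of_hasCompactSupport hc)
    (fun _ _ => differentiableAt_const _) (fun y _ => hg.differentiable (by simp) y)
  simpa using h

variable {n : ℕ} {M : Type*} [TopologicalSpace M] [ChartedSpace (ModelE n) M]
  [IsManifold (𝓡 (2 * n + 1)) ∞ M]

omit [IsManifold (𝓡 (2 * n + 1)) ∞ M] in
lemma continuous_of_comp_chartPt {X : Type*} [TopologicalSpace X] {g : M → X}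
    (h : ∀ (c : M) (y : ModelE n), y ∈ chartTarget c → ContinuousAt (g ∘ chartPt c) y) :
    Continuous g := by
  rw [continuous_iff_continuousAt]
  intro x
  have h1 := (h x _ (mem_extChartAt_target (I := 𝓡 (2 * n + 1)) x)).comp
    (continuousAt_extChartAt (I := 𝓡 (2 * n + 1)) x)
  refine h1.congr ?_
  filter_upwards [extChartAt_source_mem_nhds (I := 𝓡 (2 * n + 1)) x] with z hz
  exact congrArg g ((extChartAt (𝓡 (2 * n + 1)) x).left_inv hz)

omit [IsManifold (𝓡 (2 * n + 1)) ∞ M] in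
lemma exists_chartPt (x : M) : ∃ c : M, ∃ y ∈ chartTarget (n := n) c, chartPt c y = x :=
  ⟨x, _, mem_extChartAt_target (I := 𝓡 (2 * n + 1)) x, extChartAt_to_inv (I := 𝓡 (2 * n + 1)) x⟩

namespace StrictlyPseudoconvexCR
variable (S : StrictlyPseudoconvexCR n M) (c : M) {y : ModelE n}

/-- The carré du champ `Γ(φ, ψ) = ⟨∇^H φ, ∇^H ψ⟩ = ∑ (e_i φ)(e_i ψ)` of the sub-Laplacian. -/
def carre (φ ψ : M → ℝ) (x : M) : ℝ :=
  ∑ i, dirDeriv φ x (S.onb x i) * dirDeriv ψ x (S.onb x i)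

lemma carre_comm (φ ψ : M → ℝ) (x : M) : S.carre φ ψ x = S.carre ψ φ x :=
  Finset.sum_congr rfl fun _ _ => mul_comm _ _

omit [IsManifold (𝓡 (2 * n + 1)) ∞ M] in
lemma dirDeriv_mul {φ ψ : M → ℝ} {x : M}
    (hφ : MDifferentiableAt (𝓡 (2 * n + 1)) 𝓘(ℝ, ℝ) φ x)
    (hψ : MDifferentiableAt (𝓡 (2 * n + 1)) 𝓘(ℝ, ℝ) ψ x) (v : TangentSpace (𝓡 (2 * n + 1)) x) :
    dirDeriv (φ * ψ) x v = φ x * dirDeriv ψ x v + ψ x * dirDeriv φ x v := by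
  rw [dirDeriv, mvfderiv_mul hφ hψ]; rfl

lemma carre_mul {φ ψ χ : M → ℝ} {x : M}
    (hφ : MDifferentiableAt (𝓡 (2 * n + 1)) 𝓘(ℝ, ℝ) φ x)
    (hψ : MDifferentiableAt (𝓡 (2 * n + 1)) 𝓘(ℝ, ℝ) ψ x) :
    S.carre χ (φ * ψ) x = φ x * S.carre χ ψ x + ψ x * S.carre χ φ x := by
  simp only [carre, Finset.mul_sum, ← Finset.sum_add_distrib, dirDeriv_mul hφ hψ]
  exact Finset.sum_congr rfl fun _ _ => by ring

lemma carre_add {φ ψ χ : M → ℝ} {x : M}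
    (hφ : MDifferentiableAt (𝓡 (2 * n + 1)) 𝓘(ℝ, ℝ) φ x)
    (hψ : MDifferentiableAt (𝓡 (2 * n + 1)) 𝓘(ℝ, ℝ) ψ x) :
    S.carre χ (φ + ψ) x = S.carre χ φ x + S.carre χ ψ x := by
  simp only [carre, ← Finset.sum_add_distrib]
  refine Finset.sum_congr rfl fun _ _ => ?_
  rw [← mul_add]
  congr 1
  have := mvfderiv_add hφ hψ
  rw [dirDeriv, this]; rfl

lemma carre_sub {φ ψ χ : M → ℝ} {x : M}
    (hφ : MDifferentiableAt (𝓡 (2 * n + 1)) 𝓘(ℝ, ℝ) φ x)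
    (hψ : MDifferentiableAt (𝓡 (2 * n + 1)) 𝓘(ℝ, ℝ) ψ x) :
    S.carre χ (φ - ψ) x = S.carre χ φ x - S.carre χ ψ x := by
  simp only [carre, ← Finset.sum_sub_distrib]
  refine Finset.sum_congr rfl fun _ _ => ?_
  rw [← mul_sub]
  congr 1
  have := mvfderiv_sub hφ hψ
  rw [dirDeriv, this]; rfl

lemma levi_hgrad [T2Space M] (φ : M → ℝ) (x : M) :
    S.levi x (S.hgrad φ x) (S.hgrad φ x) = S.carre φ φ x := by
  obtain ⟨c, y, hy, rfl⟩ := exists_chartPt (n := n) x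
  have h := (S.isHorizontalONB_chartPt c hy).2
  simp only [S.levi_eq c hy] at h
  rw [S.levi_eq c hy, hgrad]
  simp only [map_sum, map_smul, sum_apply, smul_apply, smul_eq_mul, ← Finset.sum_neg_distrib,
    ← mul_neg, h]
  simp [carre]

lemma carre_chartPt [T2Space M] (hy : y ∈ chartTarget c) {φ ψ : M → ℝ}
    (hφ : DifferentiableAt ℝ (φ ∘ chartPt c) y) (hψ : DifferentiableAt ℝ (ψ ∘ chartPt c) y) :
    S.carre φ ψ (chartPt c y) =
      fderiv ℝ (ψ ∘ chartPt c) y (S.gradRep c (φ ∘ chartPt c) y) := by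
  rw [gradRep, map_sum]
  refine Finset.sum_congr rfl fun i _ => ?_
  rw [map_smul, smul_eq_mul, dirDeriv_eq_fderiv c hy (EventuallyEq.refl _ _) hφ,
    dirDeriv_eq_fderiv c hy (EventuallyEq.refl _ _) hψ]
  rfl

lemma continuous_carre [T2Space M] {φ ψ : M → ℝ} (hφ : ContMDiff (𝓡 (2 * n + 1)) 𝓘(ℝ, ℝ) 2 φ)
    (hψ : ContMDiff (𝓡 (2 * n + 1)) 𝓘(ℝ, ℝ) 2 ψ) : Continuous (S.carre φ ψ) := by
  refine continuous_of_comp_chartPt (n := n) fun c y hy => ?_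
  have h1 : ∀ {z}, z ∈ chartTarget c → ContDiffAt ℝ 2 (φ ∘ chartPt c) z :=
    fun hz => hφ.contDiffAt_comp_chartPt (k := 2) c hz
  have h2 : ∀ {z}, z ∈ chartTarget c → ContDiffAt ℝ 2 (ψ ∘ chartPt c) z :=
    fun hz => hψ.contDiffAt_comp_chartPt (k := 2) c hz
  have h3 : ContinuousAt (fun z => fderiv ℝ (ψ ∘ chartPt c) z (S.gradRep c (φ ∘ chartPt c) z)) y :=
    (((h2 hy).fderiv_right (m := 1) (by norm_num)).continuousAt).clm_apply
      (S.contDiffAt_gradRep c hy (h1 hy)).continuousAt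
  refine h3.congr ?_
  filter_upwards [chartTarget_mem_nhds hy] with z hz
  exact (S.carre_chartPt c hz ((h1 hz).differentiableAt (by simp))
    ((h2 hz).differentiableAt (by simp))).symm

/-- The definition of the sub-Laplacian involves discontinuous choices; the divergence form shows
that it is continuous for `C²` functions. -/
lemma continuous_subLaplacian [T2Space M] {φ : M → ℝ}
    (hφ : ContMDiff (𝓡 (2 * n + 1)) 𝓘(ℝ, ℝ) 2 φ) : Continuous (S.subLaplacian φ) := by
  refine continuous_of_comp_chartPt (n := n) fun c y hy => ?_
  have h1 : ∀ {z}, z ∈ chartTarget c → ContDiffAt ℝ 2 (φ ∘ chartPt c) z :=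
    fun hz => hφ.contDiffAt_comp_chartPt (k := 2) c hz
  have hZ := S.contDiffAt_gradRep c hy (h1 hy)
  have hs := S.contDiffAt_densRep c hy
  have h3 : ContinuousAt (fun y => (fderiv ℝ (S.densRep c) y (S.gradRep c (φ ∘ chartPt c) y) +
      S.densRep c y *
      ∑ a, fderiv ℝ (S.gradRep c (φ ∘ chartPt c)) y (EuclideanSpace.single a 1) a) /
      S.densRep c y) y := by
    refine ContinuousAt.div (ContinuousAt.add ?_ (hs.continuousAt.mul ?_)) hs.continuousAt
      (S.densRep_pos c hy).ne'
    · exact (hs.fderiv_right (m := 0) (by simp)).continuousAt.clm_apply hZ.continuousAt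
    · refine tendsto_finsetSum _ fun a _ => ?_
      have h : ContinuousAt (fun y => fderiv ℝ (S.gradRep c (φ ∘ chartPt c)) y
          (EuclideanSpace.single a 1)) y :=
        (hZ.fderiv_right (m := 0) (by simp)).continuousAt.clm_apply continuousAt_const
      exact ((EuclideanSpace.proj (𝕜 := ℝ) a).continuous.continuousAt).comp h
  refine h3.congr ?_
  filter_upwards [chartTarget_mem_nhds hy] with z hz
  rw [S.sum_fderiv_densRep_gradRep c hz hφ]
  exact mul_div_cancel_left₀ _ (S.densRep_pos c hz).ne'

/-- Green's formula within one chart: the integrand is the divergence of the compactly supported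
field `ψ √g ∇^H φ`. -/
lemma setIntegral_densRep_mul [T2Space M] {φ ψ : M → ℝ}
    (hφ : ContMDiff (𝓡 (2 * n + 1)) 𝓘(ℝ, ℝ) 2 φ) (hψ : ContMDiff (𝓡 (2 * n + 1)) 𝓘(ℝ, ℝ) 2 ψ)
    (hc : HasCompactSupport ψ) (hs : tsupport ψ ⊆ (extChartAt (𝓡 (2 * n + 1)) c).source) :
    ∫ y in chartTarget c, S.densRep c y *
      (ψ (chartPt c y) * S.subLaplacian φ (chartPt c y) + S.carre φ ψ (chartPt c y)) = 0 := by
  -- extend `ψ` and the field `ψ √g Z` by zero from the range of the chart to all of `ℝ^(2n+1)`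
  set χ : ModelE n → ℝ := (chartTarget c).indicator (ψ ∘ chartPt c) with hχ
  set K : Set (ModelE n) := extChartAt (𝓡 (2 * n + 1)) c '' tsupport ψ
  have hKc : IsCompact K := hc.isCompact.image_of_continuousOn
    ((continuousOn_extChartAt (I := 𝓡 (2 * n + 1)) c).mono hs)
  have hKt : K ⊆ chartTarget c := by
    rintro _ ⟨x, hx, rfl⟩
    exact (extChartAt (𝓡 (2 * n + 1)) c).map_source (hs hx)
  have hK0 : ∀ y, y ∉ K → χ y = 0 := by
    intro y hy
    by_cases hyt : y ∈ chartTarget c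
    · rw [hχ, indicator_of_mem hyt]
      by_contra h
      refine hy ⟨chartPt c y, subset_tsupport _ h, (extChartAt (𝓡 (2 * n + 1)) c).right_inv hyt⟩
    · exact indicator_of_notMem hyt _
  have hχe : ∀ {y}, y ∈ chartTarget c → χ =ᶠ[𝓝 y] ψ ∘ chartPt c := fun hy => by
    filter_upwards [chartTarget_mem_nhds hy] with z hz
    exact indicator_of_mem hz _
  set Z := S.gradRep c (φ ∘ chartPt c)
  set s := S.densRep c
  set g : Fin (2 * n + 1) → ModelE n → ℝ := fun a y => χ y * (s y * Z y a)
  have hgc : ∀ a, HasCompactSupport (g a) := fun a =>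
    HasCompactSupport.intro hKc fun y hy => by simp [g, hK0 y hy]
  have hZ : ∀ {y}, y ∈ chartTarget c → ContDiffAt ℝ 1 Z y := fun hy =>
    S.contDiffAt_gradRep c hy (hφ.contDiffAt_comp_chartPt (k := 2) c hy)
  have hs' : ∀ {y}, y ∈ chartTarget c → ContDiffAt ℝ 1 s y := fun hy =>
    (S.contDiffAt_densRep c hy).of_le (by exact_mod_cast le_top)
  have hχ' : ∀ {y}, y ∈ chartTarget c → ContDiffAt ℝ 1 χ y := fun hy =>
    ((hψ.contDiffAt_comp_chartPt (k := 2) c hy).of_le (by norm_num)).congr_of_eventuallyEq (hχe hy)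
  have hZa : ∀ {y}, y ∈ chartTarget c → ∀ a, ContDiffAt ℝ 1 (fun z => Z z a) y := fun hy a =>
    (EuclideanSpace.proj (𝕜 := ℝ) a).contDiff.contDiffAt.comp _ (hZ hy)
  have hgd : ∀ a, ContDiff ℝ 1 (g a) := fun a => contDiff_iff_contDiffAt.2 fun y => by
    by_cases hy : y ∈ K
    · exact (hχ' (hKt hy)).mul ((hs' (hKt hy)).mul (hZa (hKt hy) a))
    · refine (contDiffAt_const (c := (0 : ℝ))).congr_of_eventuallyEq ?_
      filter_upwards [hKc.isClosed.isOpen_compl.mem_nhds hy] with z hz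
      simp [g, hK0 z hz]
  have hint : ∀ a, Integrable fun y => fderiv ℝ (g a) y (EuclideanSpace.single a 1) := fun a =>
    (((hgd a).continuous_fderiv (by simp)).clm_apply
      continuous_const).integrable_of_hasCompactSupport ((hgc a).fderiv_apply ℝ _)
  have h0 : ∫ y, ∑ a, fderiv ℝ (g a) y (EuclideanSpace.single a 1) = 0 := by
    rw [integral_finsetSum _ fun a _ => hint a]
    exact Finset.sum_eq_zero fun a _ => integral_fderiv_eq_zero volume (hgd a) (hgc a) _
  rw [← integral_indicator (isOpen_extChartAt_target c).measurableSet]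
  rw [← h0]
  congr 1
  funext y
  by_cases hy : y ∈ chartTarget c
  · rw [indicator_of_mem hy, mul_add, mul_left_comm, ← S.sum_fderiv_densRep_gradRep c hy hφ,
      S.carre_chartPt c hy ((hφ.contDiffAt_comp_chartPt (k := 2) c hy).differentiableAt (by simp))
      ((hψ.contDiffAt_comp_chartPt (k := 2) c hy).differentiableAt (by simp))]
    have hd : ∀ a v, fderiv ℝ (g a) y v = χ y * (s y * fderiv ℝ Z y v a + Z y a * fderiv ℝ s y v)
        + s y * Z y a * fderiv ℝ χ y v := by
      intro a v
      have d1 := (hχ' hy).differentiableAt (by simp)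
      have d2 := (hs' hy).differentiableAt (by simp)
      have d3 := (hZa hy a).differentiableAt (by simp)
      have e3 : fderiv ℝ (fun z => Z z a) y v = fderiv ℝ Z y v a := by
        have := ((EuclideanSpace.proj (𝕜 := ℝ) a).hasFDerivAt.comp y
          ((hZ hy).differentiableAt (by simp)).hasFDerivAt).fderiv
        exact DFunLike.congr_fun this v
      have := fderiv_fun_mul d1 (d2.mul d3)
      rw [show fderiv ℝ (g a) y = _ from this, ← e3]
      have h2 := fderiv_mul d2 d3
      simp only [_root_.add_apply, smul_apply, smul_eq_mul, h2, Pi.mul_apply]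
    have hl : ∀ L : ModelE n →L[ℝ] ℝ, L (Z y) = ∑ a, Z y a * L (EuclideanSpace.single a 1) := by
      intro L
      conv_lhs => rw [modelE_eq_sum (Z y)]
      simp
    simp only [hd, Finset.sum_add_distrib, ← Finset.mul_sum]
    have e1 : ∑ a, s y * Z y a * fderiv ℝ χ y (EuclideanSpace.single a 1) =
        s y * fderiv ℝ χ y (Z y) := by
      rw [hl, Finset.mul_sum]; exact Finset.sum_congr rfl fun _ _ => by ring
    rw [e1, ← hl, (hχe hy).fderiv_eq, (hχe hy).eq_of_nhds]
    simp only [Function.comp_apply]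
    ring
  · rw [indicator_of_notMem hy]
    have : y ∉ K := fun h => hy (hKt h)
    refine (Finset.sum_eq_zero fun a _ => ?_).symm
    have : g a =ᶠ[𝓝 y] fun _ => 0 := by
      filter_upwards [hKc.isClosed.isOpen_compl.mem_nhds this] with z hz
      simp [g, hK0 z hz]
    rw [this.fderiv_eq]; simp

end StrictlyPseudoconvexCR

end CarreDuChamp

/-! ### The Riemannian volume of the Webster metric -/

section VolumeMeasure

variable {n : ℕ} {M : Type*} [TopologicalSpace M] [ChartedSpace (ModelE n) M]
  [IsManifold (𝓡 (2 * n + 1)) ∞ M]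

/-- The domain of the preferred chart at `c`. -/
abbrev chartSource (c : M) : Set M := (extChartAt (𝓡 (2 * n + 1)) c).source

lemma det_eq_det_of_single (T : ModelE n →L[ℝ] ModelE n) :
    T.det = (Matrix.of fun i k => T (EuclideanSpace.single k 1) i :
      Matrix (Fin (2 * n + 1)) (Fin (2 * n + 1)) ℝ).det := by
  rw [ContinuousLinearMap.det, ← LinearMap.det_toMatrix
    (EuclideanSpace.basisFun (Fin (2 * n + 1)) ℝ).toBasis]
  congr 1

omit [IsManifold (𝓡 (2 * n + 1)) ∞ M] in
lemma iUnion_chartSource [SecondCountableTopology M] [Nonempty M] :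
    ∃ k : ℕ → M, ⋃ i, chartSource (n := n) (k i) = univ := by
  obtain ⟨s, hs, hu⟩ := TopologicalSpace.countable_cover_nhds
    (fun c : M => extChartAt_source_mem_nhds (I := 𝓡 (2 * n + 1)) c)
  have hne : s.Nonempty := by
    by_contra h
    rw [not_nonempty_iff_eq_empty.1 h] at hu
    simp only [mem_empty_iff_false, iUnion_of_empty, iUnion_empty] at hu
    exact empty_ne_univ hu
  obtain ⟨k, rfl⟩ := hs.exists_eq_range hne
  exact ⟨k, by rwa [biUnion_range] at hu⟩

namespace StrictlyPseudoconvexCR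
variable (S : StrictlyPseudoconvexCR n M) (c c' : M) {y : ModelE n}

lemma webster_eq_of_mem_source {x : M} (hx : x ∈ chartSource (n := n) c)
    (v w : TangentSpace (𝓡 (2 * n + 1)) x) :
    S.webster x v w = S.metricRep c (extChartAt (𝓡 (2 * n + 1)) c x) (chartDiff c x v)
      (chartDiff c x w) := by
  obtain ⟨y, hy, rfl⟩ : ∃ y ∈ chartTarget (n := n) c, chartPt c y = x :=
    ⟨_, (extChartAt (𝓡 (2 * n + 1)) c).map_source hx,
      (extChartAt (𝓡 (2 * n + 1)) c).left_inv hx⟩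
  rw [chartPt, (extChartAt (𝓡 (2 * n + 1)) c).right_inv hy]
  exact S.webster_eq c hy v w

/-- Change of variables for the density under a transition map. -/
lemma densRep_change (hy : y ∈ chartTarget c) (hy' : chartPt c y ∈ chartSource (n := n) c') :
    S.densRep c y = |(fderiv ℝ (extChartAt (𝓡 (2 * n + 1)) c' ∘ chartPt c) y).det| *
      S.densRep c' (extChartAt (𝓡 (2 * n + 1)) c' (chartPt c y)) := by
  set T := fderiv ℝ (extChartAt (𝓡 (2 * n + 1)) c' ∘ chartPt c) y
  have hT : ∀ v, T v = chartDiff c' _ (chartFrame c y v) := by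
    intro v
    have h := (contMDiffAt_extChartAt' (I := 𝓡 (2 * n + 1)) (n := ∞)
      (by rwa [chartSource, extChartAt_source] at hy')).mdifferentiableAt (by simp)
    exact (dirDeriv_chartFrame c hy h v).symm
  have hg : S.gramRep c y = (Matrix.of fun i k => T (EuclideanSpace.single k 1) i).transpose *
      S.gramRep c' (extChartAt (𝓡 (2 * n + 1)) c' (chartPt c y)) *
      Matrix.of fun i k => T (EuclideanSpace.single k 1) i := by
    ext k l
    rw [gramRep, gramRep, bilinMatrix_transpose_mul_mul, hT, hT,
      ← S.webster_eq_of_mem_source c' hy', S.webster_eq c hy, chartDiff_chartFrame c hy,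
      chartDiff_chartFrame c hy]
    rfl
  rw [densRep, densRep, hg, Matrix.det_mul, Matrix.det_mul, Matrix.det_transpose,
    ← det_eq_det_of_single, mul_right_comm, Real.sqrt_mul (mul_self_nonneg _),
    Real.sqrt_mul_self_eq_abs]

set_option linter.unusedSectionVars false
variable [MeasurableSpace M] [BorelSpace M] [T2Space M]

omit [IsManifold (𝓡 (2 * n + 1)) ∞ M] [T2Space M] in
lemma aemeasurable_chartPt :
    AEMeasurable (chartPt (n := n) c) ((volume : Measure (ModelE n)).restrict (chartTarget c)) :=
  (continuousOn_extChartAt_symm c).aemeasurable (isOpen_extChartAt_target c).measurableSet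

lemma aemeasurable_densRep :
    AEMeasurable (S.densRep c) ((volume : Measure (ModelE n)).restrict (chartTarget c)) :=
  ContinuousOn.aemeasurable (fun _ hy =>
    (S.contDiffAt_densRep c hy).continuousAt.continuousWithinAt)
      (isOpen_extChartAt_target c).measurableSet

lemma chartVolume_eq : S.chartVolume c = Measure.map (chartPt c)
    (((volume : Measure (ModelE n)).restrict (chartTarget c)).withDensity
      fun y => ENNReal.ofReal (S.densRep c y)) := by
  rw [chartVolume]
  congr 1
  refine withDensity_congr_ae ?_
  filter_upwards [ae_restrict_mem (isOpen_extChartAt_target c).measurableSet] with y hy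
  exact S.chartDensity_eq c hy

lemma aemeasurable_chartPt_withDensity : AEMeasurable (chartPt c)
    (((volume : Measure (ModelE n)).restrict (chartTarget c)).withDensity
      fun y => ENNReal.ofReal (S.densRep c y)) :=
  (aemeasurable_chartPt c).mono_ac (withDensity_absolutelyContinuous _ _)

lemma lintegral_chartVolume {g : M → ℝ≥0∞} (hg : Measurable g) :
    ∫⁻ x, g x ∂S.chartVolume c = ∫⁻ y in chartTarget (n := n) c,
      ENNReal.ofReal (S.densRep c y) * g (chartPt c y) := by
  rw [S.chartVolume_eq, lintegral_map' hg.aemeasurable (S.aemeasurable_chartPt_withDensity c),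
    lintegral_withDensity_eq_lintegral_mul₀ (g := fun y => g (chartPt c y))
      (S.aemeasurable_densRep c).ennreal_ofReal (hg.comp_aemeasurable (aemeasurable_chartPt c))]
  rfl

lemma chartVolume_compl_source : S.chartVolume c (chartSource (n := n) c)ᶜ = 0 := by
  rw [← lintegral_indicator_one (isOpen_extChartAt_source c).measurableSet.compl,
    S.lintegral_chartVolume c (measurable_one.indicator
      (isOpen_extChartAt_source c).measurableSet.compl)]
  refine (setLIntegral_congr_fun (isOpen_extChartAt_target c).measurableSet fun y hy => ?_).trans
    lintegral_zero
  rw [indicator_of_notMem, mul_zero]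
  exact fun h => h ((extChartAt (𝓡 (2 * n + 1)) c).map_target hy)

lemma chartVolume_inter_source (B : Set M) :
    S.chartVolume c (B ∩ chartSource (n := n) c) = S.chartVolume c B :=
  measure_inter_conull (S.chartVolume_compl_source c)

/-- Two chart volumes agree on the overlap of their charts. -/
lemma chartVolume_congr {B : Set M} (hB : MeasurableSet B)
    (h1 : B ⊆ chartSource (n := n) c) (h2 : B ⊆ chartSource (n := n) c') :
    S.chartVolume c B = S.chartVolume c' B := by
  set τ : ModelE n → ModelE n := extChartAt (𝓡 (2 * n + 1)) c' ∘ chartPt c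
  set D : Set (ModelE n) := chartTarget c ∩ chartPt c ⁻¹' chartSource (n := n) c'
  set D' : Set (ModelE n) := chartTarget c' ∩ chartPt c' ⁻¹' chartSource (n := n) c
  have hD : IsOpen D := (continuousOn_extChartAt_symm c).isOpen_inter_preimage
    (isOpen_extChartAt_target c) (isOpen_extChartAt_source c')
  have hD' : IsOpen D' := (continuousOn_extChartAt_symm c').isOpen_inter_preimage
    (isOpen_extChartAt_target c') (isOpen_extChartAt_source c)
  have him : τ '' D = D' := by
    ext z
    constructor
    · rintro ⟨y, ⟨hy1, hy2⟩, rfl⟩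
      refine ⟨(extChartAt (𝓡 (2 * n + 1)) c').map_source hy2, ?_⟩
      change chartPt c' (extChartAt (𝓡 (2 * n + 1)) c' (chartPt c y)) ∈ chartSource c
      rw [chartPt, (extChartAt (𝓡 (2 * n + 1)) c').left_inv hy2]
      exact (extChartAt (𝓡 (2 * n + 1)) c).map_target hy1
    · rintro ⟨hz1, hz2⟩
      refine ⟨extChartAt (𝓡 (2 * n + 1)) c (chartPt c' z),
        ⟨(extChartAt (𝓡 (2 * n + 1)) c).map_source hz2, ?_⟩, ?_⟩
      · change chartPt c (extChartAt (𝓡 (2 * n + 1)) c (chartPt c' z)) ∈ chartSource c'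
        rw [chartPt, (extChartAt (𝓡 (2 * n + 1)) c).left_inv hz2]
        exact (extChartAt (𝓡 (2 * n + 1)) c').map_target hz1
      · change extChartAt (𝓡 (2 * n + 1)) c' (chartPt c
          (extChartAt (𝓡 (2 * n + 1)) c (chartPt c' z))) = z
        rw [chartPt, (extChartAt (𝓡 (2 * n + 1)) c).left_inv hz2,
          (extChartAt (𝓡 (2 * n + 1)) c').right_inv hz1]
  have hinj : InjOn τ D := by
    intro a ha b hb hab
    have := (extChartAt (𝓡 (2 * n + 1)) c').injOn ha.2 hb.2 hab
    exact (extChartAt (𝓡 (2 * n + 1)) c).symm.injOn ha.1 hb.1 this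
  have hder : ∀ y ∈ D, HasFDerivWithinAt τ (fderiv ℝ τ y) D y := by
    intro y hy
    have h := (contMDiffAt_extChartAt' (I := 𝓡 (2 * n + 1)) (n := ∞)
      (by have := hy.2; rwa [mem_preimage, chartSource, extChartAt_source] at this)).comp y
        (contMDiffAt_chartPt c hy.1)
    exact ((h.contDiffAt).differentiableAt (by simp)).hasFDerivAt.hasFDerivWithinAt
  have hg : Measurable (B.indicator (1 : M → ℝ≥0∞)) := measurable_one.indicator hB
  have hred : ∀ (a b : M) (_ : B ⊆ chartSource (n := n) b), S.chartVolume a B =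
      ∫⁻ y in chartTarget (n := n) a ∩ chartPt a ⁻¹' chartSource (n := n) b,
      ENNReal.ofReal (S.densRep a y) * B.indicator (1 : M → ℝ≥0∞) (chartPt a y) := by
    intro a b hb
    rw [← lintegral_indicator_one hB, S.lintegral_chartVolume a hg,
      ← lintegral_indicator (isOpen_extChartAt_target a).measurableSet,
      ← lintegral_indicator (((continuousOn_extChartAt_symm a).isOpen_inter_preimage
        (isOpen_extChartAt_target a) (isOpen_extChartAt_source b)).measurableSet)]
    congr 1
    funext y
    by_cases h : chartPt a y ∈ B
    · by_cases h' : y ∈ chartTarget (n := n) a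
      · have h'' : y ∈ chartTarget (n := n) a ∩ chartPt a ⁻¹' chartSource (n := n) b := ⟨h', hb h⟩
        rw [indicator_of_mem h', indicator_of_mem h'']
      · rw [indicator_of_notMem h', indicator_of_notMem fun h => h' h.1]
    · have : ∀ s : Set (ModelE n), s.indicator (fun y => ENNReal.ofReal (S.densRep a y) *
          B.indicator (1 : M → ℝ≥0∞) (chartPt a y)) y = 0 := fun s =>
        indicator_apply_eq_zero.2 fun _ => by rw [indicator_of_notMem h, mul_zero]
      rw [this, this]
  rw [hred c c' h2, hred c' c h1]
  change _ = ∫⁻ y in D', _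
  rw [← him, lintegral_image_eq_lintegral_abs_det_fderiv_mul volume hD.measurableSet hder hinj]
  refine setLIntegral_congr_fun hD.measurableSet fun y hy => ?_
  have e1 : chartPt (n := n) c' (τ y) = chartPt c y :=
    (extChartAt (𝓡 (2 * n + 1)) c').left_inv hy.2
  simp only [e1]
  rw [S.densRep_change c c' hy.1 hy.2, ENNReal.ofReal_mul (abs_nonneg _), mul_assoc]
  rfl

variable [SecondCountableTopology M]

/-- A supremum of measures may exceed each of them; the glued volume does not, because the chart
volumes are compatible and a countable gluing of them is an upper bound. -/
lemma vol_apply_of_subset_source {B : Set M} (hB : MeasurableSet B)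
    (hs : B ⊆ chartSource (n := n) c) : S.vol B = S.chartVolume c B := by
  refine le_antisymm ?_ (Measure.le_iff'.1 (le_iSup S.chartVolume c) B)
  have : Nonempty M := ⟨c⟩
  obtain ⟨k, hk⟩ := iUnion_chartSource (n := n) (M := M)
  set A : ℕ → Set M := disjointed fun i => chartSource (n := n) (k i)
  have hA : ∀ i, MeasurableSet (A i) := MeasurableSet.disjointed fun i =>
    (isOpen_extChartAt_source (k i)).measurableSet
  have hAs : ∀ i, A i ⊆ chartSource (n := n) (k i) := disjointed_subset _
  have hAu : ⋃ i, A i = univ := by rw [← hk]; exact iUnion_disjointed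
  have hAd : Pairwise (Function.onFun Disjoint A) := disjoint_disjointed _
  -- the volume glued from the pieces `A i` of the charts dominates every chart volume
  set ν : Measure M := Measure.sum fun i => (S.chartVolume (k i)).restrict (A i)
  have hν : ∀ B, MeasurableSet B → ∀ c, ν (B ∩ chartSource (n := n) c) = S.chartVolume c B := by
    intro B hB c
    have hBc := hB.inter (isOpen_extChartAt_source (I := 𝓡 (2 * n + 1)) c).measurableSet
    rw [← S.chartVolume_inter_source c B, Measure.sum_apply _ hBc,
      ← (S.chartVolume c).restrict_univ, ← hAu, Measure.restrict_iUnion hAd hA,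
      Measure.sum_apply _ hBc]
    congr 1
    funext i
    rw [Measure.restrict_apply hBc, Measure.restrict_apply hBc]
    exact S.chartVolume_congr _ _ (hBc.inter (hA i)) (fun x hx => hAs i hx.2)
      (fun x hx => hx.1.2)
  have hle : S.vol ≤ ν := iSup_le fun c => Measure.le_iff.2 fun B hB => by
    rw [← hν B hB c]; exact measure_mono inter_subset_left
  rw [← hν B hB c, inter_eq_left.2 hs]
  exact Measure.le_iff'.1 hle B

lemma vol_restrict_source : S.vol.restrict (chartSource (n := n) c) = S.chartVolume c := by
  ext B hB
  have h := (isOpen_extChartAt_source (I := 𝓡 (2 * n + 1)) c).measurableSet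
  rw [Measure.restrict_apply hB, S.vol_apply_of_subset_source c (hB.inter h) inter_subset_right,
    S.chartVolume_inter_source]

lemma isLocallyFiniteMeasure_vol : IsLocallyFiniteMeasure S.vol := by
  refine ⟨fun x => ?_⟩
  set e := extChartAt (𝓡 (2 * n + 1)) x
  obtain ⟨ε, hε, hb⟩ := Metric.nhds_basis_closedBall.mem_iff.1
    (extChartAt_target_mem_nhds (I := 𝓡 (2 * n + 1)) x)
  refine ⟨e.source ∩ e ⁻¹' Metric.ball (e x) ε, ?_, ?_⟩
  · exact inter_mem (extChartAt_source_mem_nhds x)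
      ((continuousAt_extChartAt x).preimage_mem_nhds (Metric.ball_mem_nhds _ hε))
  · have ho : IsOpen (e.source ∩ e ⁻¹' Metric.ball (e x) ε) :=
      (continuousOn_extChartAt x).isOpen_inter_preimage (isOpen_extChartAt_source x)
        Metric.isOpen_ball
    rw [S.vol_apply_of_subset_source x ho.measurableSet inter_subset_left,
      ← lintegral_indicator_one ho.measurableSet,
      S.lintegral_chartVolume x (measurable_one.indicator ho.measurableSet)]
    obtain ⟨C, hC⟩ := (isCompact_closedBall (e x) ε).exists_bound_of_continuousOn
      (f := S.densRep x) fun y hy =>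
        (S.contDiffAt_densRep x (hb hy)).continuousAt.continuousWithinAt
    calc _ ≤ ∫⁻ y in chartTarget (n := n) x,
          (Metric.closedBall (e x) ε).indicator (fun _ => ENNReal.ofReal C) y := by
          refine setLIntegral_mono' (isOpen_extChartAt_target x).measurableSet fun y hy => ?_
          by_cases h : chartPt x y ∈ e.source ∩ e ⁻¹' Metric.ball (e x) ε
          · have hy' : y ∈ Metric.closedBall (e x) ε := by
              have := h.2
              rw [mem_preimage, chartPt, e.right_inv hy] at this
              exact Metric.ball_subset_closedBall this
            rw [indicator_of_mem h, indicator_of_mem hy', Pi.one_apply, mul_one]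
            exact ENNReal.ofReal_le_ofReal ((le_abs_self _).trans (hC y hy'))
          · rw [indicator_of_notMem h, mul_zero]; exact zero_le
      _ ≤ ∫⁻ y, (Metric.closedBall (e x) ε).indicator (fun _ => ENNReal.ofReal C) y :=
          setLIntegral_le_lintegral _ _
      _ < ⊤ := by
          rw [lintegral_indicator_const measurableSet_closedBall]
          exact ENNReal.mul_lt_top ENNReal.ofReal_lt_top measure_closedBall_lt_top

lemma integral_vol_of_support {G : M → ℝ} (hG : Continuous G)
    (hs : ∀ x, x ∉ chartSource (n := n) c → G x = 0) :
    ∫ x, G x ∂S.vol = ∫ y in chartTarget (n := n) c, S.densRep c y * G (chartPt c y) := by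
  rw [← setIntegral_eq_integral_of_forall_compl_eq_zero hs, S.vol_restrict_source, S.chartVolume_eq,
    integral_map (S.aemeasurable_chartPt_withDensity c) hG.aestronglyMeasurable,
    integral_withDensity_eq_integral_toReal_smul₀ (S.aemeasurable_densRep c).ennreal_ofReal
      (ae_of_all _ fun _ => ENNReal.ofReal_lt_top)]
  refine setIntegral_congr_fun (isOpen_extChartAt_target c).measurableSet fun y hy => ?_
  simp only [smul_eq_mul, ENNReal.toReal_ofReal (S.densRep_pos c hy).le]

end StrictlyPseudoconvexCR

end VolumeMeasure

/-! ### Green's formula -/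

section GreenFormula

variable {n : ℕ} {M : Type*} [TopologicalSpace M] [ChartedSpace (ModelE n) M]
  [IsManifold (𝓡 (2 * n + 1)) ∞ M]

namespace StrictlyPseudoconvexCR
variable (S : StrictlyPseudoconvexCR n M)

lemma carre_eq_zero_of_notMem_tsupport (φ : M → ℝ) {ψ : M → ℝ} {x : M}
    (hx : x ∉ tsupport ψ) : S.carre φ ψ x = 0 := by
  have h : ψ =ᶠ[𝓝 x] fun _ => 0 := notMem_tsupport_iff_eventuallyEq.1 hx
  refine Finset.sum_eq_zero fun i _ => ?_
  have : dirDeriv ψ x (S.onb x i) = 0 := by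
    have h2 : mfderiv (𝓡 (2 * n + 1)) 𝓘(ℝ, ℝ) ψ x = 0 := by
      rw [h.mfderiv_eq]; exact mfderiv_const
    rw [dirDeriv, mvfderiv, h2]
    simp
  rw [this, mul_zero]

lemma hasCompactSupport_carre (φ : M → ℝ) {ψ : M → ℝ} (hψ : HasCompactSupport ψ) :
    HasCompactSupport (S.carre φ ψ) :=
  hψ.mono' fun x hx => by
    by_contra h; exact hx (S.carre_eq_zero_of_notMem_tsupport φ h)

variable [T2Space M] [SecondCountableTopology M] [MeasurableSpace M] [BorelSpace M]

lemma integrable_vol {G : M → ℝ} (hG : Continuous G) (hc : HasCompactSupport G) :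
    Integrable G S.vol :=
  have := S.isLocallyFiniteMeasure_vol
  hG.integrable_of_hasCompactSupport hc

omit [MeasurableSpace M] [BorelSpace M] [SecondCountableTopology M] in
lemma continuous_green {φ ψ : M → ℝ} (hφ : ContMDiff (𝓡 (2 * n + 1)) 𝓘(ℝ, ℝ) 2 φ)
    (hψ : ContMDiff (𝓡 (2 * n + 1)) 𝓘(ℝ, ℝ) 2 ψ) :
    Continuous fun x => ψ x * S.subLaplacian φ x + S.carre φ ψ x :=
  (hψ.continuous.mul (S.continuous_subLaplacian hφ)).add (S.continuous_carre hφ hψ)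

lemma integral_green_of_tsupport_subset (c : M) {φ ψ : M → ℝ}
    (hφ : ContMDiff (𝓡 (2 * n + 1)) 𝓘(ℝ, ℝ) 2 φ)
    (hψ : ContMDiff (𝓡 (2 * n + 1)) 𝓘(ℝ, ℝ) 2 ψ) (hc : HasCompactSupport ψ)
    (hs : tsupport ψ ⊆ chartSource (n := n) c) :
    ∫ x, (ψ x * S.subLaplacian φ x + S.carre φ ψ x) ∂S.vol = 0 := by
  rw [S.integral_vol_of_support c (S.continuous_green hφ hψ)]
  · exact S.setIntegral_densRep_mul c hφ hψ hc hs
  · intro x hx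
    have hx' : x ∉ tsupport ψ := fun h => hx (hs h)
    rw [S.carre_eq_zero_of_notMem_tsupport φ hx', image_eq_zero_of_notMem_tsupport hx']
    simp

/-- Green's formula, reduced to a single chart by a partition of unity on the support of `ψ`. -/
lemma integral_green {φ ψ : M → ℝ}
    (hφ : ContMDiff (𝓡 (2 * n + 1)) 𝓘(ℝ, ℝ) 2 φ)
    (hψ : ContMDiff (𝓡 (2 * n + 1)) 𝓘(ℝ, ℝ) 2 ψ) (hc : HasCompactSupport ψ) :
    ∫ x, (ψ x * S.subLaplacian φ x + S.carre φ ψ x) ∂S.vol = 0 := by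
  have := Manifold.locallyCompact_of_finiteDimensional (M := M) (𝓡 (2 * n + 1))
  obtain ⟨ρ, hρ⟩ := SmoothPartitionOfUnity.exists_isSubordinate (𝓡 (2 * n + 1))
    (isClosed_tsupport ψ) (fun c : M => chartSource (n := n) c)
    (fun c => isOpen_extChartAt_source c)
    (fun x _ => mem_iUnion.2 ⟨x, mem_extChartAt_source x⟩)
  set I := (ρ.locallyFinite.finite_nonempty_inter_compact hc.isCompact).toFinset
  have hψ2 : ψ = ∑ c ∈ I, ⇑(ρ c) * ψ := by
    funext x
    simp only [Finset.sum_apply, Pi.mul_apply, ← Finset.sum_mul]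
    by_cases hx : ψ x = 0
    · rw [hx, mul_zero]
    · have hxt : x ∈ tsupport ψ := subset_tsupport _ hx
      have h1 := ρ.sum_eq_one hxt
      rw [finsum_eq_sum_of_support_subset (s := I)] at h1
      · rw [h1, one_mul]
      · intro c hcx
        simp only [I, Finite.coe_toFinset]
        exact ⟨x, hcx, hxt⟩
  have hsm : ∀ c, ContMDiff (𝓡 (2 * n + 1)) 𝓘(ℝ, ℝ) 2 (⇑(ρ c) * ψ) := fun c =>
    ((ρ c).contMDiff.of_le (m := ((2 : ℕ∞) : WithTop ℕ∞)) (by exact_mod_cast le_top)).mul hψ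
  have hcs : ∀ c, HasCompactSupport (⇑(ρ c) * ψ) := fun c => hc.mul_left
  have hind : ∀ J : Finset M, ContMDiff (𝓡 (2 * n + 1)) 𝓘(ℝ, ℝ) 2 (∑ c ∈ J, ⇑(ρ c) * ψ) ∧
      HasCompactSupport (∑ c ∈ J, ⇑(ρ c) * ψ) ∧
      ∫ x, ((∑ c ∈ J, ⇑(ρ c) * ψ) x * S.subLaplacian φ x +
        S.carre φ (∑ c ∈ J, ⇑(ρ c) * ψ) x) ∂S.vol = 0 := by
    classical
    intro J
    induction J using Finset.induction_on with
    | empty =>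
      refine ⟨contMDiff_const, HasCompactSupport.zero, ?_⟩
      have : ∀ x, S.carre φ (0 : M → ℝ) x = 0 := fun x =>
        S.carre_eq_zero_of_notMem_tsupport φ (by simp [tsupport])
      simp [this]
    | insert c J hcJ ih =>
      obtain ⟨h1, h2, h3⟩ := ih
      rw [Finset.sum_insert hcJ]
      refine ⟨(hsm c).add h1, (hcs c).add h2, ?_⟩
      have h4 := S.integral_green_of_tsupport_subset c hφ (hsm c) (hcs c)
        ((tsupport_mul_subset_left).trans (hρ c))
      have hi : ∀ χ : M → ℝ, ContMDiff (𝓡 (2 * n + 1)) 𝓘(ℝ, ℝ) 2 χ → HasCompactSupport χ →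
          Integrable (fun x => χ x * S.subLaplacian φ x + S.carre φ χ x) S.vol := fun χ ha hb =>
        S.integrable_vol (S.continuous_green hφ ha)
          (hb.mul_right.add (S.hasCompactSupport_carre φ hb))
      have h5 := integral_add (hi _ (hsm c) (hcs c)) (hi _ h1 h2)
      rw [h3, h4, add_zero] at h5
      rw [← h5]
      congr 1
      funext x
      rw [S.carre_add ((hsm c).mdifferentiable (by simp) x) (h1.mdifferentiable (by simp) x),
        Pi.add_apply]
      ring
  have h := (hind I).2.2
  rwa [← hψ2] at h

lemma integral_mul_subLaplacian {φ ψ : M → ℝ}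
    (hφ : ContMDiff (𝓡 (2 * n + 1)) 𝓘(ℝ, ℝ) 2 φ)
    (hψ : ContMDiff (𝓡 (2 * n + 1)) 𝓘(ℝ, ℝ) 2 ψ) (hc : HasCompactSupport ψ) :
    ∫ x, ψ x * S.subLaplacian φ x ∂S.vol = -∫ x, S.carre φ ψ x ∂S.vol := by
  have h := S.integral_green hφ hψ hc
  rw [integral_add] at h
  · linarith
  · exact S.integrable_vol (hψ.continuous.mul (S.continuous_subLaplacian hφ)) hc.mul_right
  · exact S.integrable_vol (S.continuous_carre hφ hψ) (S.hasCompactSupport_carre φ hc)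

end StrictlyPseudoconvexCR

end GreenFormula

/-! ### Horizontal semi-isometric maps into the Heisenberg group -/

section HeisenbergMaps

namespace Heis

variable {m : ℕ}

/-- The horizontal coordinates `2 x_j` and `2 y_j`, as linear functionals. The factor `2` makes them
an orthonormal coframe of the Levi distribution of `ℍ^m`. -/
def coord : Fin m ⊕ Fin m → Heis m →L[ℝ] ℝ :=
  Sum.elim
    (fun j => (2 : ℝ) • (ContinuousLinearMap.proj j).comp
      (ContinuousLinearMap.fst ℝ (Fin m → ℝ) ((Fin m → ℝ) × ℝ)))
    (fun j => (2 : ℝ) • (ContinuousLinearMap.proj j).comp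
      ((ContinuousLinearMap.fst ℝ (Fin m → ℝ) ℝ).comp
        (ContinuousLinearMap.snd ℝ (Fin m → ℝ) ((Fin m → ℝ) × ℝ))))

@[simp] lemma coord_inl (j : Fin m) (a : Heis m) : coord (Sum.inl j) a = 2 * a.1 j := rfl
@[simp] lemma coord_inr (j : Fin m) (a : Heis m) : coord (Sum.inr j) a = 2 * a.2.1 j := rfl

lemma metric_eq (p a b : Heis m) :
    metric p a b = ∑ α, coord α a * coord α b + theta p a * theta p b := by
  rw [metric, Fintype.sum_sum_type, ← Finset.sum_add_distrib, Finset.mul_sum]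
  congr 1
  refine Finset.sum_congr rfl fun j _ => ?_
  simp only [coord_inl, coord_inr]
  ring

/-- The bilinear form `(p, a) ↦ 2 ∑ (x_j(p) y_j(a) - y_j(p) x_j(a))`, the nonlinear part of the
contact form. -/
def area : Heis m →L[ℝ] Heis m →L[ℝ] ℝ :=
  (LinearMap.mk₂ ℝ (fun p a : Heis m => 2 * ∑ j, (p.1 j * a.2.1 j - p.2.1 j * a.1 j))
    (fun p q a => by
      simp only [Prod.fst_add, Prod.snd_add, Pi.add_apply, ← mul_add, ← Finset.sum_add_distrib]
      congr 1; exact Finset.sum_congr rfl fun _ _ => by ring)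
    (fun r p a => by
      simp only [Prod.smul_fst, Prod.smul_snd, Pi.smul_apply, smul_eq_mul, Finset.mul_sum]
      exact Finset.sum_congr rfl fun _ _ => by ring)
    (fun p a b => by
      simp only [Prod.fst_add, Prod.snd_add, Pi.add_apply, ← mul_add, ← Finset.sum_add_distrib]
      congr 1; exact Finset.sum_congr rfl fun _ _ => by ring)
    (fun r p a => by
      simp only [Prod.smul_fst, Prod.smul_snd, Pi.smul_apply, smul_eq_mul, Finset.mul_sum]
      exact Finset.sum_congr rfl fun _ _ => by ring)).toContinuousBilinearMap

lemma area_apply (p a : Heis m) :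
    area p a = 2 * ∑ j, (p.1 j * a.2.1 j - p.2.1 j * a.1 j) := rfl

lemma area_self (a : Heis m) : area a a = 0 := by
  rw [area_apply, Finset.sum_eq_zero fun j _ => by ring, mul_zero]

/-- The last coordinate `t`. -/
def tLin : Heis m →L[ℝ] ℝ :=
  (ContinuousLinearMap.snd ℝ (Fin m → ℝ) ℝ).comp
    (ContinuousLinearMap.snd ℝ (Fin m → ℝ) ((Fin m → ℝ) × ℝ))

lemma theta_eq (p a : Heis m) : theta p a = tLin a + area p a := rfl

lemma hasFDerivAt_metric (p a b : Heis m) :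
    HasFDerivAt (fun q => metric q a b)
      (theta p a • area.flip b + theta p b • area.flip a) p := by
  have h : ∀ a : Heis m, HasFDerivAt (fun q => theta q a) (area.flip a) p := fun a =>
    ((area.flip a).hasFDerivAt (x := p)).const_add (tLin a)
  simp only [metric_eq]
  exact ((h a).mul (h b)).const_add _

/-- The Christoffel symbol vanishes on the diagonal in horizontal directions: horizontal straight
lines are geodesics of `ℍ^m`. Hence the Levi tension of a horizontal map is its coordinatewise
Laplacian. -/
lemma christoffel_self {p a : Heis m} (ha : theta p a = 0) : christoffel p a a = 0 := by
  have h : ∀ c, christoffelFirst p a a c = 0 := by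
    intro c
    rw [christoffelFirst, (hasFDerivAt_metric p a c).fderiv, (hasFDerivAt_metric p a a).fderiv]
    simp [ha, area_self]
  simp [christoffel, h]

end Heis

variable {n : ℕ} {M : Type*} [TopologicalSpace M] [ChartedSpace (ModelE n) M]
  [IsManifold (𝓡 (2 * n + 1)) ∞ M]

lemma dirDeriv_clm {F G : Type*} [NormedAddCommGroup F] [NormedSpace ℝ F]
    [NormedAddCommGroup G] [NormedSpace ℝ G] (ℓ : F →L[ℝ] G) {u : M → F}
    (hu : ContMDiff (𝓡 (2 * n + 1)) 𝓘(ℝ, F) 2 u) (x : M) (v : TangentSpace (𝓡 (2 * n + 1)) x) :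
    dirDeriv (fun y => ℓ (u y)) x v = ℓ (dirDeriv u x v) := by
  obtain ⟨c, y, hy, rfl⟩ := exists_chartPt (n := n) x
  have hd : DifferentiableAt ℝ (u ∘ chartPt c) y :=
    (hu.contDiffAt_comp_chartPt (k := 2) c hy).differentiableAt (by simp)
  rw [dirDeriv_eq_fderiv c hy (EventuallyEq.refl _ _) hd,
    dirDeriv_eq_fderiv c hy (w := ℓ ∘ (u ∘ chartPt c)) (EventuallyEq.refl _ _)
      (ℓ.differentiableAt.comp y hd), (ℓ.hasFDerivAt.comp y hd.hasFDerivAt).fderiv]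
  rfl

namespace StrictlyPseudoconvexCR
variable (S : StrictlyPseudoconvexCR n M)

lemma hessRep_clm {F G : Type*} [NormedAddCommGroup F] [NormedSpace ℝ F]
    [NormedAddCommGroup G] [NormedSpace ℝ G] (ℓ : F →L[ℝ] G) (c : M) {y : ModelE n}
    {w : ModelE n → F} (hw : ContDiffAt ℝ 2 w y) (i : Fin (2 * n)) :
    S.hessRep c (fun z => ℓ (w z)) y i = ℓ (S.hessRep c w y i) := by
  have h1 : ∀ᶠ z in 𝓝 y, fderiv ℝ (fun z => ℓ (w z)) z = ℓ.comp (fderiv ℝ w z) := by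
    filter_upwards [hw.eventually (by simp)] with z hz
    exact (ℓ.hasFDerivAt.comp z (hz.differentiableAt (by simp)).hasFDerivAt).fderiv
  have h2 : fderiv ℝ (fderiv ℝ (fun z => ℓ (w z))) y =
      (ContinuousLinearMap.compL ℝ (ModelE n) F G ℓ).comp (fderiv ℝ (fderiv ℝ w) y) := by
    rw [EventuallyEq.fderiv_eq h1]
    exact ((ContinuousLinearMap.compL ℝ (ModelE n) F G ℓ).hasFDerivAt.comp y
      ((hw.fderiv_right (m := 1) (by norm_num)).differentiableAt (by simp)).hasFDerivAt).fderiv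
  rw [hessRep, hessRep, h2, h1.self_of_nhds]
  simp [map_sub, map_sum, map_smul]

variable {m : ℕ} {f : M → Heis m}

/-- For a horizontal map `β_f(e, e)` is the coordinate Hessian of `f`, without correction from the
target. -/
lemma beta_onb [T2Space M] (hf : ContMDiff (𝓡 (2 * n + 1)) 𝓘(ℝ, Heis m) 2 f)
    (hhor : S.PreservesHorizontal f) (c : M) {y : ModelE n} (hy : y ∈ chartTarget c)
    (i : Fin (2 * n)) :
    S.beta f (chartPt c y) (S.onb _ i) (S.onb _ i) = S.hessRep c (f ∘ chartPt c) y i := by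
  rw [← S.hess_eq c hy hf i, beta, Heis.christoffel_self, add_zero]
  exact hhor _ _ ((S.isHorizontalONB_chartPt c hy).1 i)

/-- The coordinates of the Levi tension are the sub-Laplacians of the coordinates of `f`. -/
lemma clm_leviTension [T2Space M] (hf : ContMDiff (𝓡 (2 * n + 1)) 𝓘(ℝ, Heis m) 2 f)
    (hhor : S.PreservesHorizontal f) (ℓ : Heis m →L[ℝ] ℝ) (x : M) :
    ℓ (S.leviTension f x) = S.subLaplacian (fun y => ℓ (f y)) x := by
  obtain ⟨c, y, hy, rfl⟩ := exists_chartPt (n := n) x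
  rw [leviTension, S.subLaplacian_eq_sum c hy (u := fun y => ℓ (f y))
    (ℓ.contDiff.contMDiff.comp hf), map_sum]
  refine Finset.sum_congr rfl fun i _ => ?_
  rw [S.beta_onb hf hhor c hy]
  exact (S.hessRep_clm ℓ c (hf.contDiffAt_comp_chartPt (k := 2) c hy) i).symm

/-- The Levi tension is horizontal: differentiate `θ(df(E)) = 0` and use the antisymmetry of the
area form. -/
lemma theta_leviTension [T2Space M] (hf : ContMDiff (𝓡 (2 * n + 1)) 𝓘(ℝ, Heis m) 2 f)
    (hhor : S.PreservesHorizontal f) (x : M) : Heis.theta (f x) (S.leviTension f x) = 0 := by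
  obtain ⟨c, y, hy, rfl⟩ := exists_chartPt (n := n) x
  have hlin : ∀ p : Heis m, ∀ a,
      Heis.theta p a = (Heis.tLin + Heis.area p : Heis m →L[ℝ] ℝ) a := fun _ _ => rfl
  rw [leviTension, hlin, map_sum]
  refine Finset.sum_eq_zero fun i _ => ?_
  rw [← hlin]
  set w : ModelE n → Heis m := f ∘ chartPt c with hwdef
  set E := fieldRep c (S.hextend (S.onb (chartPt c y) i))
  set e := S.onbRep c y i
  have hw : ∀ {z}, z ∈ chartTarget c → ContDiffAt ℝ 2 w z := fun hz =>
    hf.contDiffAt_comp_chartPt (k := 2) c hz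
  have dE : DifferentiableAt ℝ E y :=
    (S.contDiffAt_fieldRep_hextend c hy _).differentiableAt (by simp)
  have dw' : DifferentiableAt ℝ (fderiv ℝ w) y :=
    ((hw hy).fderiv_right (m := 1) (by norm_num)).differentiableAt (by simp)
  have dw : DifferentiableAt ℝ w y := (hw hy).differentiableAt (by simp)
  have hEy : E y = e := S.fieldRep_hextend_self c hy (S.thetaRep_onbRep c hy i)
  have hDw : ∀ z ∈ chartTarget c, ∀ v, dirDeriv f (chartPt c z) v =
      fderiv ℝ w z (chartDiff c _ v) := fun z hz v =>
    dirDeriv_eq_fderiv c hz (EventuallyEq.refl _ _) ((hw hz).differentiableAt (by simp)) v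
  set G : ModelE n → Heis m := fun z => fderiv ℝ w z (E z)
  have dG : DifferentiableAt ℝ G y := dw'.clm_apply dE
  have h1 : dirDeriv (fun x => dirDeriv f x (S.hextend (S.onb (chartPt c y) i) x)) (chartPt c y)
      (S.onb (chartPt c y) i) = fderiv ℝ G y e := by
    rw [dirDeriv_eq_fderiv c hy (w := G) _ dG]
    · rfl
    · filter_upwards [chartTarget_mem_nhds hy] with z hz
      exact hDw z hz _
  have h2 : ∀ᶠ z in 𝓝 y, Heis.theta (w z) (G z) = 0 := by
    filter_upwards [chartTarget_mem_nhds hy] with z hz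
    have h := hhor (chartPt c z) (S.hextend (S.onb (chartPt c y) i) (chartPt c z)) (by
      rw [← S.thetaRep_chartDiff c hz]
      change S.thetaRep c z (fieldRep c (S.hextend (S.onb (chartPt c y) i)) z) = 0
      rw [S.fieldRep_hextend c hz, S.thetaRep_projRep c hz])
    rw [hDw z hz] at h
    exact h
  -- the derivative of the coefficients of the contact form contributes `area (G y) (G y) = 0`
  have h3 : Heis.theta (w y) (fderiv ℝ G y e) = 0 := by
    have ha : HasFDerivAt (fun z => Heis.theta (w z) (G z)) (0 : ModelE n →L[ℝ] ℝ) y :=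
      (hasFDerivAt_const (0 : ℝ) y).congr_of_eventuallyEq h2
    have hb : HasFDerivAt (fun z => Heis.theta (w z) (G z)) _ y :=
      (Heis.tLin.hasFDerivAt.comp y dG.hasFDerivAt).add
        ((Heis.area.hasFDerivAt.comp y dw.hasFDerivAt).clm_apply dG.hasFDerivAt)
    have h4 := DFunLike.congr_fun (ha.unique hb) e
    have h5 : G y = fderiv ℝ w y e := by simp only [G, hEy]
    simp [h5, Heis.area_self] at h4
    rw [Heis.theta_eq]
    linarith
  have h4 : Heis.theta (w y) (dirDeriv f (chartPt c y) (S.tanakaWebster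
      (S.hextend (S.onb (chartPt c y) i)) (chartPt c y) (S.onb (chartPt c y) i))) = 0 := by
    refine hhor _ _ ?_
    rw [tanakaWebster, map_sum]
    refine Finset.sum_eq_zero fun k _ => ?_
    rw [map_smul, (S.isHorizontalONB_chartPt c hy).1, smul_zero]
  rw [beta, Heis.christoffel_self (hhor _ _ ((S.isHorizontalONB_chartPt c hy).1 i)), add_zero,
    hlin, map_sub, ← hlin, ← hlin, h1]
  rw [show f (chartPt c y) = w y from rfl, h3, h4, sub_zero]

/-- The functions `2 x_j ∘ f` and `2 y_j ∘ f` on `M`, with which the operator is commuted. -/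
abbrev coordFn (f : M → Heis m) (α : Fin m ⊕ Fin m) (x : M) : ℝ := Heis.coord α (f x)

lemma leviTensionSq_eq [T2Space M] (hf : ContMDiff (𝓡 (2 * n + 1)) 𝓘(ℝ, Heis m) 2 f)
    (hhor : S.PreservesHorizontal f) (x : M) :
    S.leviTensionSq f x = ∑ α, S.subLaplacian (coordFn f α) x ^ 2 := by
  rw [leviTensionSq, Heis.metric_eq, S.theta_leviTension hf hhor, mul_zero, add_zero]
  refine Finset.sum_congr rfl fun α _ => ?_
  rw [S.clm_leviTension hf hhor, sq]

omit [IsManifold (𝓡 (2 * n + 1)) ∞ M] in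
lemma contMDiff_coordFn (hf : ContMDiff (𝓡 (2 * n + 1)) 𝓘(ℝ, Heis m) 2 f) (α : Fin m ⊕ Fin m) :
    ContMDiff (𝓡 (2 * n + 1)) 𝓘(ℝ, ℝ) 2 (coordFn f α) :=
  (Heis.coord α).contDiff.contMDiff.comp hf

/-- The differentials of the horizontal coordinates preserve the inner product of horizontal vectors
(by polarization of the semi-isometry condition). -/
lemma sum_coord_dirDeriv [T2Space M] (hiso : S.SemiIsometric f) (hhor : S.PreservesHorizontal f)
    (x : M) (i j : Fin (2 * n)) :
    ∑ α, Heis.coord α (dirDeriv f x (S.onb x i)) * Heis.coord α (dirDeriv f x (S.onb x j)) =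
      if i = j then 1 else 0 := by
  obtain ⟨c, y, hy, rfl⟩ := exists_chartPt (n := n) x
  obtain ⟨hh, ho⟩ := S.isHorizontalONB_chartPt c hy
  set e := S.onb (chartPt c y)
  have key : ∀ v, S.theta _ v = 0 → ∑ α, Heis.coord α (dirDeriv f (chartPt c y) v) *
      Heis.coord α (dirDeriv f (chartPt c y) v) =
        S.metricRep c y (chartDiff c _ v) (chartDiff c _ v) := by
    intro v hv
    have h1 := (hiso _ v hv).1
    rw [Heis.metric_eq, hhor _ v hv, mul_zero, add_zero] at h1
    rw [h1, S.levi_eq c hy, S.metricRep_of_horizontal c] <;>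
    rw [S.thetaRep_chartDiff c hy, hv]
  -- polarization
  have h2 := key (e i + e j) (by rw [map_add, hh, hh, add_zero])
  have h3 := key (e i) (hh i)
  have h4 := key (e j) (hh j)
  have a1 := S.metricRep_onbRep c hy i i
  have a2 := S.metricRep_onbRep c hy j j
  have a3 := S.metricRep_onbRep c hy i j
  have a4 := S.metricRep_symm c hy (S.onbRep c y i) (S.onbRep c y j)
  simp only [onbRep] at a1 a2 a3 a4
  simp only [map_add, add_apply, dirDeriv, mul_add, add_mul, Finset.sum_add_distrib] at h2 h3 h4 ⊢
  have h5 : ∑ α, Heis.coord α (mvfderiv (𝓡 (2 * n + 1)) f (chartPt c y) (e j)) *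
      Heis.coord α (mvfderiv (𝓡 (2 * n + 1)) f (chartPt c y) (e i)) = ∑ α, Heis.coord α
      (mvfderiv (𝓡 (2 * n + 1)) f (chartPt c y) (e i)) * Heis.coord α
      (mvfderiv (𝓡 (2 * n + 1)) f (chartPt c y) (e j)) :=
    Finset.sum_congr rfl fun _ _ => mul_comm _ _
  rw [h5] at h2
  linarith

lemma sum_coord_dirDeriv_reeb (hiso : S.SemiIsometric f) (hhor : S.PreservesHorizontal f)
    {x : M} {v : TangentSpace (𝓡 (2 * n + 1)) x} (hv : S.theta x v = 0) :
    ∑ α, Heis.coord α (dirDeriv f x v) * Heis.coord α (dirDeriv f x (S.reeb x)) = 0 := by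
  have h := (hiso x v hv).2
  rwa [Heis.metric_eq, hhor x v hv, zero_mul, add_zero] at h

/-- The gradients of the coordinate functions form a Parseval frame of the Levi distribution. -/
lemma sum_carre_mul_carre [T2Space M] (hf : ContMDiff (𝓡 (2 * n + 1)) 𝓘(ℝ, Heis m) 2 f)
    (hiso : S.SemiIsometric f) (hhor : S.PreservesHorizontal f) (φ ψ : M → ℝ) (x : M) :
    ∑ α, S.carre (coordFn f α) φ x * S.carre (coordFn f α) ψ x = S.carre φ ψ x := by
  simp only [carre, dirDeriv_clm _ hf, Finset.sum_mul_sum]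
  rw [Finset.sum_comm]
  refine Finset.sum_congr rfl fun i _ => ?_
  rw [Finset.sum_comm, Finset.sum_eq_single i]
  · rw [← one_mul (dirDeriv φ x (S.onb x i) * _)]
    have h := S.sum_coord_dirDeriv hiso hhor x i i
    rw [if_pos rfl] at h
    rw [← h, Finset.sum_mul]
    exact Finset.sum_congr rfl fun _ _ => by ring
  · intro j _ hj
    have h := S.sum_coord_dirDeriv hiso hhor x i j
    rw [if_neg hj.symm] at h
    rw [← zero_mul (dirDeriv φ x (S.onb x i) * dirDeriv ψ x (S.onb x j)), ← h, Finset.sum_mul]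
    exact Finset.sum_congr rfl fun _ _ => by ring
  · simp

lemma sum_carre_self [T2Space M] (hf : ContMDiff (𝓡 (2 * n + 1)) 𝓘(ℝ, Heis m) 2 f)
    (hiso : S.SemiIsometric f) (hhor : S.PreservesHorizontal f) (x : M) :
    ∑ α, S.carre (coordFn f α) (coordFn f α) x = 2 * n := by
  simp only [carre, dirDeriv_clm _ hf]
  rw [Finset.sum_comm]
  simp [S.sum_coord_dirDeriv hiso hhor]

/-- The pulled-back horizontal metric `∑ dF_α ⊗ dF_α` in the chart at `c`, where
`F_α = coordFn f α`. -/
def pullRep (f : M → Heis m) (c : M) (y : ModelE n) : ModelE n →L[ℝ] ModelE n →L[ℝ] ℝ :=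
  ∑ α, (fderiv ℝ (coordFn f α ∘ chartPt c) y).smulRight (fderiv ℝ (coordFn f α ∘ chartPt c) y)

omit [IsManifold (𝓡 (2 * n + 1)) ∞ M] in
lemma pullRep_apply (c : M) (y v w : ModelE n) :
    pullRep f c y v w = ∑ α, fderiv ℝ (coordFn f α ∘ chartPt c) y v *
      fderiv ℝ (coordFn f α ∘ chartPt c) y w := by
  simp [pullRep]

lemma differentiableAt_fderiv_coordFn (hf : ContMDiff (𝓡 (2 * n + 1)) 𝓘(ℝ, Heis m) 2 f) (c : M)
    {y : ModelE n} (hy : y ∈ chartTarget c) (α : Fin m ⊕ Fin m) :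
    DifferentiableAt ℝ (fderiv ℝ (coordFn f α ∘ chartPt c)) y :=
  (((contMDiff_coordFn hf α).contDiffAt_comp_chartPt (k := 2) c hy).fderiv_right (m := 1)
    (by norm_num)).differentiableAt (by simp)

lemma differentiableAt_pullRep (hf : ContMDiff (𝓡 (2 * n + 1)) 𝓘(ℝ, Heis m) 2 f) (c : M)
    {y : ModelE n} (hy : y ∈ chartTarget c) : DifferentiableAt ℝ (pullRep f c) y := by
  have h : ContDiffAt ℝ 1 (pullRep f c) y := by
    refine ContDiffAt.of_clm_apply fun v => ContDiffAt.of_clm_apply fun w => ?_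
    simp only [pullRep_apply]
    have hd : ∀ α, ContDiffAt ℝ 1 (fderiv ℝ (coordFn f α ∘ chartPt c)) y := fun α =>
      ((contMDiff_coordFn hf α).contDiffAt_comp_chartPt (k := 2) c hy).fderiv_right (by norm_num)
    exact ContDiffAt.sum fun α _ =>
      ((hd α).clm_apply contDiffAt_const).mul ((hd α).clm_apply contDiffAt_const)
  exact h.differentiableAt (by simp)

lemma fderiv_pullRep (hf : ContMDiff (𝓡 (2 * n + 1)) 𝓘(ℝ, Heis m) 2 f) (c : M)
    {y : ModelE n} (hy : y ∈ chartTarget c) (a v w : ModelE n) :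
    fderiv ℝ (pullRep f c) y a v w = ∑ α,
      (fderiv ℝ (fderiv ℝ (coordFn f α ∘ chartPt c)) y a v * fderiv ℝ (coordFn f α ∘ chartPt c) y w
      + fderiv ℝ (coordFn f α ∘ chartPt c) y v *
        fderiv ℝ (fderiv ℝ (coordFn f α ∘ chartPt c)) y a w) := by
  have h := fderiv_metric_fields (differentiableAt_pullRep hf c hy) (differentiableAt_const v)
    (differentiableAt_const w) a
  simp only [fderiv_fun_const, Pi.zero_apply, zero_apply, map_zero, add_zero] at h
  rw [← h]
  simp only [pullRep_apply]
  have d := fun α => differentiableAt_fderiv_coordFn hf c hy α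
  have hd : ∀ α v, HasFDerivAt (fun z => fderiv ℝ (coordFn f α ∘ chartPt c) z v)
      ((fderiv ℝ (fderiv ℝ (coordFn f α ∘ chartPt c)) y).flip v) y := fun α v => by
    simpa using (d α).hasFDerivAt.clm_apply (hasFDerivAt_const v y)
  rw [(HasFDerivAt.fun_sum fun α (_ : α ∈ Finset.univ) => (hd α v).fun_mul (hd α w)).fderiv]
  simp only [sum_apply, _root_.add_apply, smul_apply, ContinuousLinearMap.flip_apply, smul_eq_mul]
  exact Finset.sum_congr rfl fun _ _ => by ring

/-- The Gauss-type formula: second derivatives paired with first derivatives are the Christoffel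
symbols of the pulled-back metric. -/
lemma sum_snd_mul_fst (hf : ContMDiff (𝓡 (2 * n + 1)) 𝓘(ℝ, Heis m) 2 f) (c : M)
    {y : ModelE n} (hy : y ∈ chartTarget c) (a b : ModelE n) :
    ∑ α, fderiv ℝ (fderiv ℝ (coordFn f α ∘ chartPt c)) y a a *
      fderiv ℝ (coordFn f α ∘ chartPt c) y b =
      (1 / 2) * (fderiv ℝ (pullRep f c) y a a b + fderiv ℝ (pullRep f c) y a a b
        - fderiv ℝ (pullRep f c) y b a a) := by
  simp only [fderiv_pullRep hf c hy, ← Finset.sum_add_distrib, ← Finset.sum_sub_distrib,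
    Finset.mul_sum]
  refine Finset.sum_congr rfl fun α _ => ?_
  have h : IsSymmSndFDerivAt ℝ (coordFn f α ∘ chartPt c) y :=
    ((contMDiff_coordFn hf α).contDiffAt_comp_chartPt (k := 2) c hy).isSymmSndFDerivAt (by simp)
  rw [h.eq b a]
  ring

lemma pullRep_chartDiff (hf : ContMDiff (𝓡 (2 * n + 1)) 𝓘(ℝ, Heis m) 2 f) (c : M)
    {y : ModelE n} (hy : y ∈ chartTarget c) (v w : TangentSpace (𝓡 (2 * n + 1)) (chartPt c y)) :
    pullRep f c y (chartDiff c _ v) (chartDiff c _ w) =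
      ∑ α, Heis.coord α (dirDeriv f _ v) * Heis.coord α (dirDeriv f _ w) := by
  rw [pullRep_apply]
  refine Finset.sum_congr rfl fun α _ => ?_
  have h : ∀ v, fderiv ℝ (coordFn f α ∘ chartPt c) y (chartDiff c _ v) =
      Heis.coord α (dirDeriv f _ v) := fun v => by
    rw [← dirDeriv_clm _ hf]
    exact (dirDeriv_eq_fderiv c hy (EventuallyEq.refl _ _)
      (((contMDiff_coordFn hf α).contDiffAt_comp_chartPt (k := 2) c hy).differentiableAt
        (by simp)) v).symm
  rw [h, h]

lemma pullRep_onbRep [T2Space M] (hf : ContMDiff (𝓡 (2 * n + 1)) 𝓘(ℝ, Heis m) 2 f)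
    (hiso : S.SemiIsometric f) (hhor : S.PreservesHorizontal f) (c : M)
    {y : ModelE n} (hy : y ∈ chartTarget c) (i j : Fin (2 * n)) :
    pullRep f c y (S.onbRep c y i) (S.onbRep c y j) = if i = j then 1 else 0 := by
  rw [onbRep, onbRep, pullRep_chartDiff hf c hy, S.sum_coord_dirDeriv hiso hhor]

/-- The pulled-back metric agrees with the Webster metric as soon as one argument is horizontal. For
the Reeb direction this uses the condition `df(H) ⊥ df(ξ)`. -/
lemma pullRep_sub_metricRep [T2Space M] (hf : ContMDiff (𝓡 (2 * n + 1)) 𝓘(ℝ, Heis m) 2 f)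
    (hiso : S.SemiIsometric f) (hhor : S.PreservesHorizontal f) (c : M)
    {y : ModelE n} (hy : y ∈ chartTarget c) {v : ModelE n} (hv : S.thetaRep c y v = 0)
    (w : ModelE n) : (pullRep f c y - S.metricRep c y) v w = 0 := by
  have hw : w = S.projRep c y w + S.thetaRep c y w • S.reebRep c y := by
    rw [projRep_apply]; abel
  have hv' : v = S.projRep c y v := by rw [projRep_apply, hv, zero_smul, sub_zero]
  have hξ : pullRep f c y v (S.reebRep c y) = 0 := by
    have := pullRep_chartDiff hf c hy (chartFrame c y v) (S.reeb (chartPt c y))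
    rw [chartDiff_chartFrame c hy] at this
    refine this.trans (S.sum_coord_dirDeriv_reeb hiso hhor ?_)
    rw [← S.thetaRep_chartDiff c hy, chartDiff_chartFrame c hy, hv]
  rw [hw, map_add, map_smul, sub_apply, sub_apply, sub_apply, hξ,
    S.metricRep_reebRep_right c hy, hv, sub_zero, smul_zero, add_zero, hv',
    S.projRep_eq_sum c hy v, S.projRep_eq_sum c hy w]
  simp only [map_sum, map_smul, sum_apply, smul_apply, S.pullRep_onbRep hf hiso hhor c hy,
    S.metricRep_onbRep c hy, sub_self]

/-- The two metrics have the same derivatives on horizontal vectors, in all directions. They differ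
by a multiple of `θ ⊗ θ`, whose derivative vanishes on `ker θ`; the horizontal projection makes this
precise. -/
lemma fderiv_pullRep_sub [T2Space M] (hf : ContMDiff (𝓡 (2 * n + 1)) 𝓘(ℝ, Heis m) 2 f)
    (hiso : S.SemiIsometric f) (hhor : S.PreservesHorizontal f) (c : M)
    {y : ModelE n} (hy : y ∈ chartTarget c) (a : ModelE n) {v w : ModelE n}
    (hv : S.thetaRep c y v = 0) (hw : S.thetaRep c y w = 0) :
    fderiv ℝ (pullRep f c) y a v w = fderiv ℝ (S.metricRep c) y a v w := by
  have d1 := differentiableAt_pullRep hf c hy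
  have d2 := S.differentiableAt_metricRep c hy
  have dP : ∀ v, DifferentiableAt ℝ (fun z => S.projRep c z v) y := fun v =>
    (differentiableAt_const v).sub
      (((S.differentiableAt_thetaRep c hy).clm_apply (differentiableAt_const v)).smul
      ((S.contDiffAt_reebRep c hy).differentiableAt (by simp)))
  have h1 := fderiv_metric_fields d1 (dP v) (dP w) a
  have h2 := fderiv_metric_fields d2 (dP v) (dP w) a
  have heq : ∀ {z}, z ∈ chartTarget c → ∀ {v}, S.thetaRep c z v = 0 → ∀ w,
      pullRep f c z v w = S.metricRep c z v w := fun hz v hv w =>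
    sub_eq_zero.1 (S.pullRep_sub_metricRep hf hiso hhor c hz hv w)
  have hev : (fun z => pullRep f c z (S.projRep c z v) (S.projRep c z w))
      =ᶠ[𝓝 y] fun z => S.metricRep c z (S.projRep c z v) (S.projRep c z w) := by
    filter_upwards [chartTarget_mem_nhds hy] with z hz
    exact heq hz (S.thetaRep_projRep c hz v) _
  have hsymm : ∀ u, pullRep f c y u w = S.metricRep c y u w := by
    intro u
    rw [S.metricRep_symm c hy u w, ← heq hy hw, pullRep_apply, pullRep_apply]
    exact Finset.sum_congr rfl fun _ _ => mul_comm _ _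
  have hpv : ∀ {v}, S.thetaRep c y v = 0 → S.projRep c y v = v := fun hv => by
    rw [projRep_apply, hv, zero_smul, sub_zero]
  rw [hpv hv, hpv hw, hsymm, heq hy hv, hev.fderiv_eq] at h1
  rw [hpv hv, hpv hw] at h2
  linarith

/-- The vectors `β_f(e_i, e_i)` are normal to `df(H(M))`: by `sum_snd_mul_fst` their tangential part
is the difference of the Christoffel symbols of the pulled-back metric and of the Webster metric. -/
lemma sum_hessRep_mul_fderiv [T2Space M] (hf : ContMDiff (𝓡 (2 * n + 1)) 𝓘(ℝ, Heis m) 2 f)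
    (hiso : S.SemiIsometric f) (hhor : S.PreservesHorizontal f) (c : M)
    {y : ModelE n} (hy : y ∈ chartTarget c) (i k : Fin (2 * n)) :
    ∑ α, S.hessRep c (coordFn f α ∘ chartPt c) y i *
      fderiv ℝ (coordFn f α ∘ chartPt c) y (S.onbRep c y k) = 0 := by
  have hθ := S.thetaRep_onbRep c hy
  have h1 := sum_snd_mul_fst hf c hy (S.onbRep c y i) (S.onbRep c y k)
  rw [S.fderiv_pullRep_sub hf hiso hhor c hy _ (hθ i) (hθ k),
    S.fderiv_pullRep_sub hf hiso hhor c hy _ (hθ i) (hθ i)] at h1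
  have h2 := S.pullRep_sub_metricRep hf hiso hhor c hy (hθ k) (S.reebRep c y)
  rw [sub_apply, sub_apply, S.metricRep_reebRep_right c hy, hθ, sub_zero, pullRep_apply] at h2
  have h3 := S.pullRep_onbRep hf hiso hhor c hy
  simp only [pullRep_apply] at h3
  have h4 : ∑ α, (∑ l, S.gammaRep c y (S.onbRep c y i) (S.onbRep c y i) (S.onbRep c y l) •
      fderiv ℝ (coordFn f α ∘ chartPt c) y (S.onbRep c y l)) *
      fderiv ℝ (coordFn f α ∘ chartPt c) y (S.onbRep c y k) =
      S.gammaRep c y (S.onbRep c y i) (S.onbRep c y i) (S.onbRep c y k) := by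
    simp only [Finset.sum_mul, smul_eq_mul]
    rw [Finset.sum_comm]
    simp only [mul_assoc, ← Finset.mul_sum, h3]
    simp
  have h5 : ∑ α, (fderiv ℝ (S.thetaRep c) y (S.onbRep c y i) (S.onbRep c y i) •
      fderiv ℝ (coordFn f α ∘ chartPt c) y (S.reebRep c y)) *
      fderiv ℝ (coordFn f α ∘ chartPt c) y (S.onbRep c y k) = 0 := by
    simp only [smul_eq_mul, mul_assoc, ← Finset.mul_sum]
    rw [Finset.sum_congr rfl fun α _ => mul_comm _ _, h2, mul_zero]
  simp only [hessRep, sub_mul, Finset.sum_sub_distrib]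
  rw [h4, h5, h1, gammaRep]
  ring

/-- The Levi tension is normal to `df(H(M))`; this removes the cross term in the norm of the
commutator. -/
lemma sum_subLaplacian_mul_carre [T2Space M] (hf : ContMDiff (𝓡 (2 * n + 1)) 𝓘(ℝ, Heis m) 2 f)
    (hiso : S.SemiIsometric f) (hhor : S.PreservesHorizontal f) (φ : M → ℝ) (x : M) :
    ∑ α, S.subLaplacian (coordFn f α) x * S.carre (coordFn f α) φ x = 0 := by
  obtain ⟨c, y, hy, rfl⟩ := exists_chartPt (n := n) x
  have h : ∀ k, ∑ α, S.subLaplacian (coordFn f α) (chartPt c y) *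
      dirDeriv (coordFn f α) (chartPt c y) (S.onb _ k) = 0 := by
    intro k
    have : ∀ α, S.subLaplacian (coordFn f α) (chartPt c y) *
        dirDeriv (coordFn f α) (chartPt c y) (S.onb _ k) =
        ∑ i, S.hessRep c (coordFn f α ∘ chartPt c) y i *
          fderiv ℝ (coordFn f α ∘ chartPt c) y (S.onbRep c y k) := fun α => by
      rw [S.subLaplacian_eq_sum c hy (contMDiff_coordFn hf α), Finset.sum_mul]
      rw [dirDeriv_eq_fderiv c hy (EventuallyEq.refl _ _)
        (((contMDiff_coordFn hf α).contDiffAt_comp_chartPt (k := 2) c hy).differentiableAt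
        (by simp))]
      rfl
    simp only [this]
    rw [Finset.sum_comm]
    exact Finset.sum_eq_zero fun i _ => S.sum_hessRep_mul_fderiv hf hiso hhor c hy i k
  simp only [carre, Finset.mul_sum]
  rw [Finset.sum_comm]
  refine Finset.sum_eq_zero fun k _ => ?_
  simp only [← mul_assoc, ← Finset.sum_mul, h, zero_mul]

end StrictlyPseudoconvexCR

end HeisenbergMaps

/-! ### The universal inequality from sum rules, and Riesz means -/

section CommutatorInequality

/-- Comparison of `∫_y^x t^(p-1)` with its trapezoidal value, by convexity of `t ↦ t^(p-1)`. -/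
lemma rpow_sub_rpow_le_of_two_le {p x y : ℝ} (hp : 2 ≤ p) (hy : 0 ≤ y) (hxy : y ≤ x) :
    x ^ p - y ^ p ≤ p / 2 * ((x - y) * (x ^ (p - 1) + y ^ (p - 1))) := by
  set g : ℝ → ℝ := fun t => p / 2 * ((t - y) * (t ^ (p - 1) + y ^ (p - 1))) - t ^ p with hg
  have hd : ∀ t, HasDerivAt g (p / 2 * (1 * (t ^ (p - 1) + y ^ (p - 1)) +
      (t - y) * ((p - 1) * t ^ (p - 1 - 1))) - p * t ^ (p - 1)) t := fun t =>
    ((((hasDerivAt_id t).sub_const y).mul ((Real.hasDerivAt_rpow_const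
      (Or.inr (by linarith))).add_const _)).const_mul (p / 2)).sub
        (Real.hasDerivAt_rpow_const (Or.inr (by linarith)))
  have hm : MonotoneOn g (Icc y x) := by
    refine monotoneOn_of_deriv_nonneg (convex_Icc y x)
      (fun t _ => (hd t).continuousAt.continuousWithinAt)
      (fun t _ => (hd t).differentiableAt.differentiableWithinAt) fun t ht => ?_
    rw [interior_Icc] at ht
    have ht0 : 0 < t := hy.trans_lt ht.1
    rw [(hd t).deriv]
    -- the tangent line of the convex function `s ↦ s ^ (p - 1)` at `t` lies below it at `y`
    have hb := one_add_mul_self_le_rpow_one_add (s := (y - t) / t) (by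
      rw [le_div_iff₀ ht0]; linarith) (p := p - 1) (by linarith)
    have h1 : 1 + (y - t) / t = y / t := by field_simp; ring
    rw [h1, Real.div_rpow hy ht0.le, le_div_iff₀ (Real.rpow_pos_of_pos ht0 _)] at hb
    have h2 : t ^ (p - 1) = t ^ (p - 1 - 1) * t := by
      rw [← Real.rpow_add_one ht0.ne']; ring_nf
    have h3 : (1 + (p - 1) * ((y - t) / t)) * t ^ (p - 1) =
        t ^ (p - 1) + (p - 1) * (y - t) * t ^ (p - 1 - 1) := by
      rw [h2]; field_simp
    rw [h3] at hb
    nlinarith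
  have h := hm (left_mem_Icc.2 hxy) (right_mem_Icc.2 hxy) hxy
  simp only [hg, sub_self, zero_mul, mul_zero] at h
  linarith

/-- For `p ≤ 2` the comparison reduces to the monotonicity of `t ↦ t^(p-2)`. -/
lemma rpow_sub_rpow_le_of_le_two {p x y : ℝ} (hp : p ≤ 2) (h0 : 1 ≤ p ∨ 0 < y) (hy : 0 ≤ y)
    (hxy : y ≤ x) : x ^ p - y ^ p ≤ (x - y) * (x ^ (p - 1) + y ^ (p - 1)) := by
  have hmul : ∀ t : ℝ, 0 ≤ t → (1 ≤ p ∨ 0 < t) → t ^ p = t * t ^ (p - 1) := by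
    intro t ht h
    rcases ht.eq_or_lt with rfl | ht'
    · have hp1 : 1 ≤ p := h.resolve_right (lt_irrefl _)
      rw [zero_mul, Real.zero_rpow (by linarith)]
    · rw [mul_comm, ← Real.rpow_add_one ht'.ne']; ring_nf
  have hx0 : 1 ≤ p ∨ 0 < x := h0.imp_right fun h => h.trans_le hxy
  have key : y * x ^ (p - 1) ≤ x * y ^ (p - 1) := by
    rcases hy.eq_or_lt with rfl | hy'
    · rw [zero_mul]; exact mul_nonneg hxy (Real.rpow_nonneg le_rfl _)
    · have hx' := hy'.trans_le hxy
      have h2 : x ^ (p - 2) ≤ y ^ (p - 2) :=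
        Real.rpow_le_rpow_of_nonpos hy' hxy (by linarith)
      have e : ∀ t : ℝ, 0 < t → t ^ (p - 1) = t ^ (p - 2) * t := fun t ht => by
        rw [← Real.rpow_add_one ht.ne']; ring_nf
      rw [e x hx', e y hy']
      nlinarith [mul_pos hx' hy']
  rw [hmul x (hy.trans hxy) hx0, hmul y hy h0]
  linarith

/-- The elementary inequality for pairs of eigenvalues below the threshold. -/
lemma rpow_sub_mul_sub_le {p x y : ℝ} (hx : 0 ≤ x) (hy : 0 ≤ y) (hx0 : 1 ≤ p ∨ 0 < x)
    (hy0 : 1 ≤ p ∨ 0 < y) :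
    (x ^ p - y ^ p) * (x - y) ≤ max 1 (p / 2) * ((x - y) ^ 2 * (x ^ (p - 1) + y ^ (p - 1))) := by
  wlog h : y ≤ x generalizing x y
  · have := this hy hx hy0 hx0 (le_of_not_ge h)
    linarith
  have h1 : x ^ p - y ^ p ≤ max 1 (p / 2) * ((x - y) * (x ^ (p - 1) + y ^ (p - 1))) := by
    have hnn : 0 ≤ (x - y) * (x ^ (p - 1) + y ^ (p - 1)) := mul_nonneg (by linarith)
      (add_nonneg (Real.rpow_nonneg hx _) (Real.rpow_nonneg hy _))
    rcases le_total p 2 with hp | hp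
    · refine (rpow_sub_rpow_le_of_le_two hp hy0 hy h).trans ?_
      exact le_mul_of_one_le_left hnn (le_max_left _ _)
    · exact (rpow_sub_rpow_le_of_two_le hp hy h).trans
        (mul_le_mul_of_nonneg_right (le_max_right _ _) hnn)
  nlinarith [mul_le_mul_of_nonneg_right h1 (sub_nonneg.2 h)]

/-- The universal inequality, from sum rules alone. Pairs with both indices in `F` are handled by
symmetry and `rpow_sub_mul_sub_le`; the remaining pairs contribute with a sign since
`λ_i ≤ z ≤ λ_j`. -/
theorem sum_rpow_le_of_commutator {lam c : ℕ → ℝ} {w : ℕ → ℕ → ℝ} {N : ℝ}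
    (hw : ∀ i j, 0 ≤ w i j) (hsymm : ∀ i j, w i j = w j i)
    (h1 : ∀ i, HasSum (fun j => (lam j - lam i) * w i j) N)
    (h2 : ∀ i, HasSum (fun j => (lam j - lam i) ^ 2 * w i j) (c i))
    {z p : ℝ} {F : Finset ℕ} (hF : ∀ i ∈ F, lam i ≤ z) (hF' : ∀ i, i ∉ F → z ≤ lam i)
    (hp : ∀ i ∈ F, 1 ≤ p ∨ lam i < z) :
    ∑ i ∈ F, (z - lam i) ^ p * N ≤ max 1 (p / 2) * ∑ i ∈ F, (z - lam i) ^ (p - 1) * c i := by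
  set C := max 1 (p / 2)
  have hC : 1 ≤ C := le_max_left _ _
  set T : ℕ → ℕ → ℝ := fun i j => C * ((z - lam i) ^ (p - 1) * ((lam j - lam i) ^ 2 * w i j)) -
    (z - lam i) ^ p * ((lam j - lam i) * w i j) with hT
  have hx : ∀ i ∈ F, 0 ≤ z - lam i := fun i hi => sub_nonneg.2 (hF i hi)
  have hx0 : ∀ i ∈ F, 1 ≤ p ∨ 0 < z - lam i := fun i hi => (hp i hi).imp_right sub_pos.2
  have hpart : ∀ i ∈ F, ∑ j ∈ F, T i j ≤
      C * ((z - lam i) ^ (p - 1) * c i) - (z - lam i) ^ p * N := by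
    intro i hi
    have hs : HasSum (T i) (C * ((z - lam i) ^ (p - 1) * c i) - (z - lam i) ^ p * N) :=
      (((h2 i).mul_left _).mul_left C).sub ((h1 i).mul_left _)
    refine sum_le_hasSum F (fun j hj => ?_) hs
    have hpow : (z - lam i) ^ p = (z - lam i) * (z - lam i) ^ (p - 1) := by
      rcases (hx i hi).eq_or_lt with h | h
      · have hp1 : 1 ≤ p := (hx0 i hi).resolve_right (by rw [← h]; exact lt_irrefl _)
        rw [← h, zero_mul, Real.zero_rpow (by linarith)]
      · rw [mul_comm, ← Real.rpow_add_one h.ne']; ring_nf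
    have hzj : z - lam i ≤ lam j - lam i := by linarith [hF' j hj]
    have hq : 0 ≤ (z - lam i) ^ (p - 1) * w i j :=
      mul_nonneg (Real.rpow_nonneg (hx i hi) _) (hw i j)
    have hj0 : 0 ≤ lam j - lam i := (hx i hi).trans hzj
    have e : T i j = (z - lam i) ^ (p - 1) * w i j *
        ((lam j - lam i) * (C * (lam j - lam i) - (z - lam i))) := by
      simp only [hT]; rw [hpow]; ring
    rw [e]
    refine mul_nonneg hq (mul_nonneg hj0 ?_)
    nlinarith
  have hsum : 0 ≤ ∑ i ∈ F, ∑ j ∈ F, T i j := by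
    -- symmetrize the double sum in `i` and `j`
    have hsw : ∑ i ∈ F, ∑ j ∈ F, T i j = ∑ i ∈ F, ∑ j ∈ F, T j i := Finset.sum_comm
    have h2 : 0 ≤ ∑ i ∈ F, ∑ j ∈ F, (T i j + T j i) := by
      refine Finset.sum_nonneg fun i hi => Finset.sum_nonneg fun j hj => ?_
      have h := rpow_sub_mul_sub_le (hx i hi) (hx j hj) (hx0 i hi) (hx0 j hj)
      have e : T i j + T j i = w i j * (max 1 (p / 2) *
          ((z - lam i - (z - lam j)) ^ 2 * ((z - lam i) ^ (p - 1) + (z - lam j) ^ (p - 1))) -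
          ((z - lam i) ^ p - (z - lam j) ^ p) * (z - lam i - (z - lam j))) := by
        simp only [hT]; rw [hsymm j i]; ring
      rw [e]
      exact mul_nonneg (hw i j) (sub_nonneg.2 h)
    simp only [Finset.sum_add_distrib] at h2
    linarith
  have := Finset.sum_le_sum hpart
  rw [Finset.sum_sub_distrib, ← Finset.mul_sum] at this
  linarith

end CommutatorInequality

section RieszMeans

variable {k : ℕ} {a : ℕ → ℝ} {z : ℝ}

lemma hasDerivAt_max_zero_sq (t : ℝ) : HasDerivAt (fun s : ℝ => max s 0 ^ 2) (2 * max t 0) t := by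
  rcases lt_trichotomy t 0 with h | rfl | h
  · rw [max_eq_right h.le, mul_zero]
    refine (hasDerivAt_const t (0 : ℝ)).congr_of_eventuallyEq ?_
    filter_upwards [eventually_lt_nhds h] with s hs
    rw [max_eq_right hs.le]; norm_num
  · rw [max_self, mul_zero, hasDerivAt_iff_isLittleO]
    simp only [max_self, sub_zero, smul_zero]
    have h0 : (fun s : ℝ => max s 0 ^ 2) =O[𝓝 0] fun s => s ^ 2 :=
      Asymptotics.IsBigO.of_bound 1 (Eventually.of_forall fun s => by
        rw [one_mul, Real.norm_of_nonneg (sq_nonneg _), Real.norm_of_nonneg (sq_nonneg _), sq_le_sq]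
        rcases le_total s 0 with h | h
        · rw [max_eq_right h, abs_zero]; exact abs_nonneg _
        · rw [max_eq_left h])
    simpa using h0.trans_isLittleO (Asymptotics.isLittleO_pow_id (𝕜 := ℝ) (n := 2) (by norm_num))
  · rw [max_eq_left h.le]
    have := hasDerivAt_pow 2 t
    norm_num at this
    refine this.congr_of_eventuallyEq ?_
    filter_upwards [eventually_gt_nhds h] with s hs
    rw [max_eq_left hs.le]

/-- With `R_ρ(z) = ∑ (z - a_i)_+^ρ`, the hypothesis makes `R_2(z) / z^(n+2)` nondecreasing on
`[z₀, a_k]`, where `z₀ = (1 + 2/n) a_0`. Comparison of the end points, with `R_2(z₀) ≥ (z₀ - a_0)²`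
below and `R_1² ≤ k R_2` above, gives the bound on `a_k`. -/
theorem le_mul_rpow_of_riesz {n : ℕ} (hn : 1 ≤ n) (hk : 1 ≤ k) (ha0 : 0 < a 0)
    (hR : ∀ z ≤ a k, (1 + 2 / (n : ℝ)) * ∑ i ∈ Finset.range k, max (z - a i) 0 ^ 2 ≤
      2 / (n : ℝ) * (z * ∑ i ∈ Finset.range k, max (z - a i) 0)) :
    a k ≤ (1 + 2 / (n : ℝ)) * (k : ℝ) ^ (1 / (n : ℝ)) * a 0 := by
  have hn0 : (0 : ℝ) < n := by exact_mod_cast hn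
  have hk1 : (1 : ℝ) ≤ k := by exact_mod_cast hk
  set z0 := (1 + 2 / (n : ℝ)) * a 0 with hz0
  have hz0p : 0 < z0 := by positivity
  have hkr : 1 ≤ (k : ℝ) ^ (1 / (n : ℝ)) := Real.one_le_rpow hk1 (by positivity)
  rw [mul_right_comm, ← hz0]
  -- the monotonicity is used on `[z0, a k]`; if this is empty, there is nothing to prove
  rcases le_total (a k) z0 with hle | hle
  · exact hle.trans (le_mul_of_one_le_right hz0p.le hkr)
  set R2 : ℝ → ℝ := fun z => ∑ i ∈ Finset.range k, max (z - a i) 0 ^ 2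
  set R1 : ℝ → ℝ := fun z => ∑ i ∈ Finset.range k, max (z - a i) 0
  have hd : ∀ z, HasDerivAt R2 (2 * R1 z) z := by
    intro z
    rw [Finset.mul_sum]
    refine HasDerivAt.fun_sum fun i _ => ?_
    have h := (hasDerivAt_max_zero_sq (z - a i)).comp z ((hasDerivAt_id z).sub_const (a i))
    rw [mul_one] at h
    exact h
  have hq : ∀ z, 0 < z → HasDerivAt (fun z => R2 z / z ^ (n + 2))
      ((2 * R1 z * z ^ (n + 2) - R2 z * ((n + 2 : ℕ) * z ^ (n + 1))) / (z ^ (n + 2)) ^ 2) z :=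
    fun z hz => (hd z).div (by simpa using hasDerivAt_pow (n + 2) z) (by positivity)
  have hmono : MonotoneOn (fun z => R2 z / z ^ (n + 2)) (Icc z0 (a k)) := by
    refine monotoneOn_of_deriv_nonneg (convex_Icc _ _)
      (fun t ht => (hq t (hz0p.trans_le ht.1)).continuousAt.continuousWithinAt)
      (fun t ht => (hq t
        (hz0p.trans_le (interior_subset ht).1)).differentiableAt.differentiableWithinAt)
      fun t ht => ?_
    have ht' := interior_subset ht
    have htp := hz0p.trans_le ht'.1
    rw [(hq t htp).deriv]
    refine div_nonneg ?_ (by positivity)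
    have h := hR t ht'.2
    change (1 + 2 / (n : ℝ)) * R2 t ≤ 2 / (n : ℝ) * (t * R1 t) at h
    have h2 : ((n : ℝ) + 2) * R2 t ≤ 2 * (t * R1 t) := by
      have := mul_le_mul_of_nonneg_left h hn0.le
      field_simp at this
      linarith
    have : 2 * R1 t * t ^ (n + 2) - R2 t * ((n + 2 : ℕ) * t ^ (n + 1)) =
        t ^ (n + 1) * (2 * (t * R1 t) - (n + 2) * R2 t) := by push_cast; ring
    rw [this]
    exact mul_nonneg (by positivity) (by linarith)
  have h1 := hmono (left_mem_Icc.2 hle) (right_mem_Icc.2 hle) hle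
  set z := a k with hz
  have hzp : 0 < z := hz0p.trans_le hle
  have h2 : (2 / (n : ℝ) * a 0) ^ 2 ≤ R2 z0 := by
    refine le_trans (le_of_eq ?_) (Finset.single_le_sum (f := fun i => max (z0 - a i) 0 ^ 2)
      (fun i _ => sq_nonneg _) (Finset.mem_range.2 (show 0 < k from hk)))
    have : z0 - a 0 = 2 / (n : ℝ) * a 0 := by rw [hz0]; ring
    simp only [this]
    rw [max_eq_left (by positivity)]
  have h3 := hR z le_rfl
  change (1 + 2 / (n : ℝ)) * R2 z ≤ 2 / (n : ℝ) * (z * R1 z) at h3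
  have h4 : R1 z ^ 2 ≤ k * R2 z := by
    have := sq_sum_le_card_mul_sum_sq (s := Finset.range k) (f := fun i => max (z - a i) 0)
    rwa [Finset.card_range] at this
  have hR2p : 0 < R2 z := by
    have : 0 < R2 z0 := (by positivity : (0 : ℝ) < (2 / (n : ℝ) * a 0) ^ 2).trans_le h2
    have h5 : 0 < R2 z / z ^ (n + 2) := (div_pos this (by positivity)).trans_le h1
    exact (div_pos_iff_of_pos_right (by positivity)).1 h5
  have hR1p : 0 ≤ R1 z := Finset.sum_nonneg fun _ _ => le_max_right _ _
  have h5 : ((n : ℝ) + 2) ^ 2 * R2 z ≤ 4 * z ^ 2 * k := by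
    have h6 : ((n : ℝ) + 2) * R2 z ≤ 2 * (z * R1 z) := by
      have := mul_le_mul_of_nonneg_left h3 hn0.le
      field_simp at this
      linarith
    have h7 : (((n : ℝ) + 2) * R2 z) ^ 2 ≤ (2 * (z * R1 z)) ^ 2 :=
      pow_le_pow_left₀ (by positivity) h6 2
    have h8 : (2 * (z * R1 z)) ^ 2 ≤ 4 * z ^ 2 * (k * R2 z) := by
      have := mul_le_mul_of_nonneg_left h4 (by positivity : 0 ≤ 4 * z ^ 2)
      linarith
    have h9 : R2 z * (((n : ℝ) + 2) ^ 2 * R2 z) ≤ R2 z * (4 * z ^ 2 * k) := by linarith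
    exact le_of_mul_le_mul_left h9 hR2p
  have h6 : (z / z0) ^ n ≤ k := by
    have h7 : (2 / (n : ℝ) * a 0) ^ 2 / z0 ^ (n + 2) ≤ R2 z / z ^ (n + 2) :=
      (div_le_div_of_nonneg_right h2 (by positivity)).trans h1
    rw [div_le_div_iff₀ (by positivity) (by positivity)] at h7
    have e1 : a 0 = n / (n + 2) * z0 := by rw [hz0]; field_simp
    have e2 : (2 / (n : ℝ) * a 0) ^ 2 = 4 / (n + 2) ^ 2 * z0 ^ 2 := by rw [e1]; field_simp; norm_num
    rw [e2] at h7
    have h8 : z0 ^ 2 * z ^ 2 * (4 * z ^ n) ≤ z0 ^ 2 * z ^ 2 * (4 * (k * z0 ^ n)) := by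
      have e3 : 4 / ((n : ℝ) + 2) ^ 2 * z0 ^ 2 * z ^ (n + 2) * (n + 2) ^ 2 =
        z0 ^ 2 * z ^ 2 * (4 * z ^ n) := by field_simp; ring
      rw [← e3]
      calc _ ≤ R2 z * z0 ^ (n + 2) * ((n : ℝ) + 2) ^ 2 :=
            mul_le_mul_of_nonneg_right h7 (by positivity)
        _ = (((n : ℝ) + 2) ^ 2 * R2 z) * z0 ^ (n + 2) := by ring
        _ ≤ 4 * z ^ 2 * k * z0 ^ (n + 2) := mul_le_mul_of_nonneg_right h5 (by positivity)
        _ = _ := by ring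
    have h9 := le_of_mul_le_mul_left h8 (by positivity)
    rw [div_pow, div_le_iff₀ (by positivity)]
    linarith
  have h7 : z / z0 ≤ (k : ℝ) ^ (1 / (n : ℝ)) := by
    rw [one_div, Real.le_rpow_inv_iff_of_pos (by positivity) (by positivity) hn0,
      Real.rpow_natCast]
    exact h6
  rw [div_le_iff₀ hz0p] at h7
  linarith

end RieszMeans

/-! ### Square-integrable functions -/

section SquareIntegrable

variable {X : Type*} [MeasurableSpace X] {μ : Measure X}

lemma lintegral_ofReal_sq (g : X → ℝ) :
    ∫⁻ x, ENNReal.ofReal (g x ^ 2) ∂μ = eLpNorm g 2 μ ^ (2 : ℝ) := by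
  rw [eLpNorm_eq_lintegral_rpow_enorm_toReal (by norm_num) (by norm_num), ← ENNReal.rpow_mul]
  norm_num
  refine lintegral_congr fun x => ?_
  rw [← ofReal_norm, ← ENNReal.ofReal_pow (norm_nonneg _), Real.norm_eq_abs, sq_abs]

lemma tendsto_lintegral_sq_iff {ι : Type*} {l : Filter ι} (g : ι → X → ℝ) :
    Tendsto (fun k => ∫⁻ x, ENNReal.ofReal (g k x ^ 2) ∂μ) l (𝓝 0) ↔
      Tendsto (fun k => eLpNorm (g k) 2 μ) l (𝓝 0) := by
  simp only [lintegral_ofReal_sq]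
  constructor
  · intro h
    have h2 := (ENNReal.continuous_rpow_const (y := (1 / 2 : ℝ))).tendsto (0 : ℝ≥0∞) |>.comp h
    rw [ENNReal.zero_rpow_of_pos (by norm_num)] at h2
    refine h2.congr fun k => ?_
    simp only [Function.comp_apply]
    rw [← ENNReal.rpow_mul]; norm_num
  · intro h
    have h2 := (ENNReal.continuous_rpow_const (y := (2 : ℝ))).tendsto (0 : ℝ≥0∞) |>.comp h
    rwa [ENNReal.zero_rpow_of_pos (by norm_num)] at h2

lemma inner_toLp {a b : X → ℝ} (ha : MemLp a 2 μ) (hb : MemLp b 2 μ) :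
    inner ℝ (ha.toLp a) (hb.toLp b) = ∫ x, a x * b x ∂μ := by
  rw [L2.inner_def]
  refine integral_congr_ae ?_
  filter_upwards [ha.coeFn_toLp, hb.coeFn_toLp] with x h1 h2
  rw [h1, h2]
  simp [mul_comm]

lemma MeasureTheory.MemLp.integrable_mul_two {a b : X → ℝ} (ha : MemLp a 2 μ) (hb : MemLp b 2 μ) :
    Integrable (fun x => a x * b x) μ :=
  ha.integrable_mul hb

lemma MeasureTheory.MemLp.bounded_mul {h a : X → ℝ} {C : ℝ} (ha : MemLp a 2 μ)
    (hm : AEStronglyMeasurable h μ) (hC : ∀ᵐ x ∂μ, |h x| ≤ C) :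
    MemLp (fun x => h x * a x) 2 μ := by
  refine ha.of_le_mul (c := C) (hm.mul ha.1) ?_
  filter_upwards [hC] with x hx
  rw [norm_mul]
  exact mul_le_mul_of_nonneg_right hx (norm_nonneg _)

/-- Parseval's identity for a complete orthonormal family of functions. -/
lemma hasSum_integral_mul {u : ℕ → X → ℝ} (hu : ∀ j, MemLp (u j) 2 μ)
    (hon : ∀ i j, ∫ x, u i x * u j x ∂μ = if i = j then 1 else 0)
    (hcomp : ∀ g : X → ℝ, MemLp g 2 μ → (∀ j, ∫ x, g x * u j x ∂μ = 0) → ∀ᵐ x ∂μ, g x = 0)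
    {g h : X → ℝ} (hg : MemLp g 2 μ) (hh : MemLp h 2 μ) :
    HasSum (fun j => (∫ x, g x * u j x ∂μ) * ∫ x, h x * u j x ∂μ) (∫ x, g x * h x ∂μ) := by
  set U : ℕ → Lp ℝ 2 μ := fun j => (hu j).toLp (u j)
  have hU : Orthonormal ℝ U := by
    classical
    rw [orthonormal_iff_ite]
    intro i j
    rw [inner_toLp, hon]
  have hbot : (Submodule.span ℝ (Set.range U))ᗮ = ⊥ := by
    rw [Submodule.eq_bot_iff]
    intro v hv
    have hv2 : ∀ᵐ x ∂μ, v x = 0 := by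
      refine hcomp _ (Lp.memLp v) fun j => ?_
      have h1 := Submodule.inner_left_of_mem_orthogonal
        (Submodule.subset_span (mem_range_self j) : U j ∈ _) hv
      have h2 := inner_toLp (Lp.memLp v) (hu j)
      rw [Lp.toLp_coeFn] at h2
      rw [← h2, h1]
    exact (Lp.eq_zero_iff_ae_eq_zero).2 hv2
  set B := HilbertBasis.mkOfOrthogonalEqBot hU hbot
  have hB : ∀ j, B j = U j := fun j => by simp [B]
  have hs := B.hasSum_inner_mul_inner (hg.toLp g) (hh.toLp h)
  rw [inner_toLp] at hs
  have hB' : (fun j => inner ℝ (hg.toLp g) (B j) * inner ℝ (B j) (hh.toLp h)) =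
      fun j => (∫ x, g x * u j x ∂μ) * ∫ x, h x * u j x ∂μ := funext fun j => by
    rw [hB, real_inner_comm _ (U j), inner_toLp, inner_toLp]
  rwa [hB'] at hs

/-- Convergence of functions in `L²(μ)`, recorded together with square integrability of all terms
and of the limit. -/
structure L2Lim (μ : Measure X) (a : ℕ → X → ℝ) (b : X → ℝ) : Prop where
  memLp_seq : ∀ k, MemLp (a k) 2 μ
  memLp : MemLp b 2 μ
  tendsto : Tendsto (fun k => ∫⁻ x, ENNReal.ofReal ((a k x - b x) ^ 2) ∂μ) atTop (𝓝 0)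

namespace L2Lim

variable {a a' : ℕ → X → ℝ} {b b' : X → ℝ}

lemma tendsto_toLp (h : L2Lim μ a b) :
    Tendsto (fun k => (h.memLp_seq k).toLp (a k)) atTop (𝓝 (h.memLp.toLp b)) :=
  (Lp.tendsto_Lp_iff_tendsto_eLpNorm'' a h.memLp_seq b h.memLp).2
    ((tendsto_lintegral_sq_iff fun k => a k - b).1 h.tendsto)

lemma of_tendsto_toLp (h1 : ∀ k, MemLp (a k) 2 μ) (h2 : MemLp b 2 μ)
    (h : Tendsto (fun k => (h1 k).toLp (a k)) atTop (𝓝 (h2.toLp b))) : L2Lim μ a b :=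
  ⟨h1, h2, (tendsto_lintegral_sq_iff fun k => a k - b).2
    ((Lp.tendsto_Lp_iff_tendsto_eLpNorm'' a h1 b h2).1 h)⟩

lemma integral_mul (h : L2Lim μ a b) (h' : L2Lim μ a' b') :
    Tendsto (fun k => ∫ x, a k x * a' k x ∂μ) atTop (𝓝 (∫ x, b x * b' x ∂μ)) := by
  rw [← inner_toLp h.memLp h'.memLp]
  refine (h.tendsto_toLp.inner h'.tendsto_toLp).congr fun k => ?_
  rw [inner_toLp]

lemma const (hb : MemLp b 2 μ) : L2Lim μ (fun _ => b) b :=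
  ⟨fun _ => hb, hb, by simp⟩

lemma bounded_mul (h : L2Lim μ a b) {g : X → ℝ} {C : ℝ} (hm : AEStronglyMeasurable g μ)
    (hC : ∀ᵐ x ∂μ, |g x| ≤ C) : L2Lim μ (fun k x => g x * a k x) (fun x => g x * b x) := by
  refine ⟨fun k => (h.memLp_seq k).bounded_mul hm hC, h.memLp.bounded_mul hm hC, ?_⟩
  have h1 := ENNReal.Tendsto.const_mul (a := ENNReal.ofReal (C ^ 2)) h.tendsto
    (Or.inr ENNReal.ofReal_ne_top)
  rw [mul_zero] at h1
  refine tendsto_of_tendsto_of_tendsto_of_le_of_le tendsto_const_nhds h1 (fun _ => zero_le)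
    fun k => ?_
  simp only
  rw [← lintegral_const_mul' _ _ ENNReal.ofReal_ne_top]
  refine lintegral_mono_ae ?_
  filter_upwards [hC] with x hx
  rw [← ENNReal.ofReal_mul (sq_nonneg _), ← mul_sub, mul_pow]
  exact ENNReal.ofReal_le_ofReal (mul_le_mul_of_nonneg_right
    (by rw [← sq_abs]; exact pow_le_pow_left₀ (abs_nonneg _) hx 2) (sq_nonneg _))

end L2Lim

lemma exists_l2Lim_of_cauchy {a : ℕ → X → ℝ} (ha : ∀ k, MemLp (a k) 2 μ)
    (hc : Tendsto (fun kl : ℕ × ℕ => ∫⁻ x, ENNReal.ofReal ((a kl.1 x - a kl.2 x) ^ 2) ∂μ)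
      (atTop ×ˢ atTop) (𝓝 0)) : ∃ b, L2Lim μ a b := by
  have h1 : CauchySeq fun k => (ha k).toLp (a k) := by
    rw [Lp.cauchySeq_Lp_iff_cauchySeq_eLpNorm, ← prod_atTop_atTop_eq]
    refine ((tendsto_lintegral_sq_iff fun kl : ℕ × ℕ => a kl.1 - a kl.2).1 hc).congr fun kl => ?_
    refine eLpNorm_congr_ae ?_
    exact ((ha kl.1).coeFn_toLp.sub (ha kl.2).coeFn_toLp).symm
  obtain ⟨v, hv⟩ := cauchySeq_tendsto_of_complete h1
  exact ⟨v, L2Lim.of_tendsto_toLp ha (Lp.memLp v) (by rwa [Lp.toLp_coeFn])⟩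

end SquareIntegrable

/-! ### The form domain -/

section FormDomain

variable {n : ℕ} {M : Type*} [TopologicalSpace M] [ChartedSpace (ModelE n) M]
  [IsManifold (𝓡 (2 * n + 1)) ∞ M]

omit [IsManifold (𝓡 (2 * n + 1)) ∞ M] in
lemma isTest_mul {Ω : Set M} {h φ : M → ℝ} (hh : ContMDiff (𝓡 (2 * n + 1)) 𝓘(ℝ, ℝ) 2 h)
    (hφ : StrictlyPseudoconvexCR.IsTest n Ω φ) : StrictlyPseudoconvexCR.IsTest n Ω (h * φ) :=
  ⟨hh.mul hφ.1, hφ.2.1.mul_left, tsupport_mul_subset_right.trans hφ.2.2⟩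

/-- Splitting of the potential as `V = sign(V) √|V| √|V|`, so that both factors of `V a b` are
square integrable on the form domain. The junk value `0 / 0 = 0` is the right sign of `0`. -/
lemma mul_mul_eq_sqrt_abs_mul (V a b : ℝ) :
    V * (a * b) = (V / |V| * (√|V| * a)) * (√|V| * b) := by
  have h1 : √|V| * √|V| = |V| := Real.mul_self_sqrt (abs_nonneg V)
  have h2 : V / |V| * |V| = V := by
    by_cases h : V = 0
    · simp [h]
    · exact div_mul_cancel₀ _ (abs_ne_zero.2 h)
  calc V * (a * b) = V / |V| * |V| * (a * b) := by rw [h2]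
    _ = V / |V| * (√|V| * √|V|) * (a * b) := by rw [h1]
    _ = _ := by ring

lemma abs_div_abs_le (V : ℝ) : abs (V / |V|) ≤ 1 := by
  rw [abs_div, abs_abs]; exact div_self_le_one _

set_option linter.unusedSectionVars false
namespace StrictlyPseudoconvexCR
variable (S : StrictlyPseudoconvexCR n M)
variable [T2Space M] [SecondCountableTopology M] [MeasurableSpace M] [BorelSpace M]
variable {Ω : Set M} {V : M → ℝ} {m : ℕ} {f : M → Heis m}

omit [T2Space M] [SecondCountableTopology M] in
lemma exists_bound_restrict (hΩo : IsOpen Ω) (hΩb : IsCompact (closure Ω)) {g : M → ℝ}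
    (hg : Continuous g) : ∃ C, ∀ᵐ x ∂S.vol.restrict Ω, |g x| ≤ C := by
  obtain ⟨C, hC⟩ := hΩb.exists_bound_of_continuousOn hg.continuousOn
  refine ⟨C, ?_⟩
  filter_upwards [ae_restrict_mem hΩo.measurableSet] with x hx
  exact hC x (subset_closure hx)

lemma isFiniteMeasure_restrict (hΩb : IsCompact (closure Ω)) :
    IsFiniteMeasure (S.vol.restrict Ω) := by
  have := S.isLocallyFiniteMeasure_vol
  exact MeasureTheory.isFiniteMeasure_restrict.2
    ((measure_mono subset_closure).trans_lt hΩb.measure_lt_top).ne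

lemma memLp_restrict (hΩo : IsOpen Ω) (hΩb : IsCompact (closure Ω)) {g : M → ℝ}
    (hg : Continuous g) : MemLp g 2 (S.vol.restrict Ω) := by
  have := S.isFiniteMeasure_restrict hΩb
  obtain ⟨C, hC⟩ := S.exists_bound_restrict hΩo hΩb hg
  exact MemLp.of_bound hg.aestronglyMeasurable C hC

lemma setIntegral_mul_subLaplacian {φ ψ : M → ℝ}
    (hφ : ContMDiff (𝓡 (2 * n + 1)) 𝓘(ℝ, ℝ) 2 φ) (hψ : IsTest n Ω ψ) :
    ∫ x in Ω, ψ x * S.subLaplacian φ x ∂S.vol = -∫ x in Ω, S.carre φ ψ x ∂S.vol := by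
  have h : ∀ x, x ∉ Ω → x ∉ tsupport ψ := fun x hx h => hx (hψ.2.2 h)
  rw [setIntegral_eq_integral_of_forall_compl_eq_zero fun x hx => by
      rw [image_eq_zero_of_notMem_tsupport (h x hx), zero_mul],
    setIntegral_eq_integral_of_forall_compl_eq_zero fun x hx =>
      S.carre_eq_zero_of_notMem_tsupport φ (h x hx),
    S.integral_mul_subLaplacian hφ hψ.1 hψ.2.1]

/-- Approximation of `u` by test functions `φ k` in the form norm. The horizontal gradient of `u`
exists only as a limit; it is encoded by the `L²`-limits `p α` of its components `Γ(F_α, φ k)` along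
the coordinate functions `F_α = coordFn f α`. -/
structure FormApprox (Ω : Set M) (V : M → ℝ) (f : M → Heis m) (u : M → ℝ) (φ : ℕ → M → ℝ)
    (p : Fin m ⊕ Fin m → M → ℝ) : Prop where
  test : ∀ k, IsTest n Ω (φ k)
  lim : L2Lim (S.vol.restrict Ω) φ u
  lim_weight : L2Lim (S.vol.restrict Ω) (fun k x => √|V x| * φ k x) (fun x => √|V x| * u x)
  lim_grad : ∀ α, L2Lim (S.vol.restrict Ω) (fun k => S.carre (coordFn f α) (φ k)) (p α)

omit [T2Space M] [SecondCountableTopology M] [IsManifold (𝓡 (2 * n + 1)) ∞ M]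
  [ChartedSpace (ModelE n) M] [TopologicalSpace M] [BorelSpace M] in
lemma memLp_two_of_lintegral {X : Type*} [MeasurableSpace X] {μ : Measure X} {g : X → ℝ}
    (hm : AEStronglyMeasurable g μ) (h : ∫⁻ x, ENNReal.ofReal (g x ^ 2) ∂μ < ⊤) :
    MemLp g 2 μ := by
  refine ⟨hm, ?_⟩
  rw [lintegral_ofReal_sq] at h
  exact (ENNReal.rpow_lt_top_iff_of_pos (by norm_num)).1 h

lemma memLp_sqrt_mul_test (hV : LocallyIntegrableOn V Ω S.vol) {φ : M → ℝ} (hφ : IsTest n Ω φ) :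
    MemLp (fun x => √|V x| * φ x) 2 (S.vol.restrict Ω) := by
  have hVm : AEStronglyMeasurable V (S.vol.restrict Ω) := hV.aestronglyMeasurable
  have hsm : AEStronglyMeasurable (fun x => √|V x|) (S.vol.restrict Ω) :=
    Real.continuous_sqrt.comp_aestronglyMeasurable hVm.norm
  refine (memLp_two_iff_integrable_sq (hsm.mul hφ.1.continuous.aestronglyMeasurable)).2 ?_
  have h1 : IntegrableOn V (tsupport φ) S.vol :=
    hV.integrableOn_compact_subset hφ.2.2 hφ.2.1.isCompact
  obtain ⟨C, hC⟩ := hφ.2.1.isCompact.exists_bound_of_continuousOn hφ.1.continuous.continuousOn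
  have h2 : IntegrableOn (fun x => φ x ^ 2 * |V x|) (tsupport φ) S.vol := by
    refine Integrable.bdd_mul (c := C ^ 2) h1.norm (hφ.1.continuous.pow 2).aestronglyMeasurable ?_
    filter_upwards [ae_restrict_mem (isClosed_tsupport φ).measurableSet] with x hx
    rw [norm_pow]
    exact pow_le_pow_left₀ (norm_nonneg _) (hC x hx) 2
  have h3 : Integrable (fun x => φ x ^ 2 * |V x|) S.vol := by
    refine (integrableOn_iff_integrable_of_support_subset fun x hx => ?_).1 h2
    refine subset_tsupport φ fun h => hx ?_
    simp [h]
  refine h3.restrict.congr (ae_of_all _ fun x => ?_)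
  change φ x ^ 2 * |V x| = (√|V x| * φ x) ^ 2
  rw [mul_pow, Real.sq_sqrt (abs_nonneg _), mul_comm]

lemma exists_formApprox (hf : ContMDiff (𝓡 (2 * n + 1)) 𝓘(ℝ, Heis m) 2 f)
    (hiso : S.SemiIsometric f) (hhor : S.PreservesHorizontal f)
    (hΩo : IsOpen Ω) (hΩb : IsCompact (closure Ω)) (hV : LocallyIntegrableOn V Ω S.vol)
    {u : M → ℝ} (hu : S.InFormDomain Ω V u) : ∃ φ p, S.FormApprox Ω V f u φ p := by
  obtain ⟨hu2, φ, ht, hl, hg⟩ := hu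
  have hVm : AEStronglyMeasurable V (S.vol.restrict Ω) := hV.aestronglyMeasurable
  have hsm : AEStronglyMeasurable (fun x => √|V x|) (S.vol.restrict Ω) :=
    Real.continuous_sqrt.comp_aestronglyMeasurable hVm.norm
  have hgrad : ∀ α, ∃ p, L2Lim (S.vol.restrict Ω) (fun k => S.carre (coordFn f α) (φ k)) p := by
    intro α
    refine exists_l2Lim_of_cauchy (fun k => S.memLp_restrict hΩo hΩb
      (S.continuous_carre (contMDiff_coordFn hf α) (ht k).1)) ?_
    refine tendsto_of_tendsto_of_tendsto_of_le_of_le tendsto_const_nhds hg (fun _ => zero_le)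
      fun kl => ?_
    refine lintegral_mono fun x => ENNReal.ofReal_le_ofReal ?_
    rw [S.levi_hgrad, ← S.sum_carre_mul_carre hf hiso hhor (φ kl.1 - φ kl.2),
      ← S.carre_sub ((ht _).1.mdifferentiable (by simp) x) ((ht _).1.mdifferentiable (by simp) x),
      sq]
    exact Finset.single_le_sum (f := fun α => S.carre (coordFn f α) (φ kl.1 - φ kl.2) x *
      S.carre (coordFn f α) (φ kl.1 - φ kl.2) x) (fun _ _ => mul_self_nonneg _) (Finset.mem_univ α)
  choose p hp using hgrad
  have hw : Tendsto (fun k => ∫⁻ x in Ω, ENNReal.ofReal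
      ((√|V x| * φ k x - √|V x| * u x) ^ 2) ∂S.vol) atTop (𝓝 0) := by
    refine tendsto_of_tendsto_of_tendsto_of_le_of_le tendsto_const_nhds hl (fun _ => zero_le)
      fun k => lintegral_mono fun x => ENNReal.ofReal_le_ofReal ?_
    rw [← mul_sub, mul_pow, Real.sq_sqrt (abs_nonneg _)]
    exact mul_le_mul_of_nonneg_right (by linarith) (sq_nonneg _)
  have hwu : MemLp (fun x => √|V x| * u x) 2 (S.vol.restrict Ω) := by
    obtain ⟨k, hk⟩ := (hw.eventually (gt_mem_nhds ENNReal.zero_lt_top)).exists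
    have h1 := memLp_two_of_lintegral ((hsm.mul
      (ht k).1.continuous.aestronglyMeasurable).sub (hsm.mul hu2.1)) hk
    have h2 := (S.memLp_sqrt_mul_test hV (ht k)).sub h1
    convert h2 using 1
    funext x
    simp
  refine ⟨φ, p, ht, ⟨fun k => S.memLp_restrict hΩo hΩb (ht k).1.continuous, hu2, ?_⟩,
    ⟨fun k => S.memLp_sqrt_mul_test hV (ht k), hwu, hw⟩, hp⟩
  refine tendsto_of_tendsto_of_tendsto_of_le_of_le tendsto_const_nhds hl (fun _ => zero_le)
    fun k => lintegral_mono fun x => ENNReal.ofReal_le_ofReal ?_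
  exact le_mul_of_one_le_left (sq_nonneg _) (by linarith [abs_nonneg (V x)])

namespace FormApprox

variable {S} {u v : M → ℝ} {φ ψ : ℕ → M → ℝ} {p q : Fin m ⊕ Fin m → M → ℝ}

lemma lim_sign (hV : LocallyIntegrableOn V Ω S.vol) (A : S.FormApprox Ω V f u φ p) :
    L2Lim (S.vol.restrict Ω) (fun k x => V x / |V x| * (√|V x| * φ k x))
      (fun x => V x / |V x| * (√|V x| * u x)) :=
  have hVm : AEStronglyMeasurable V (S.vol.restrict Ω) := hV.aestronglyMeasurable
  A.lim_weight.bounded_mul (hVm.aemeasurable.div hVm.norm.aemeasurable).aestronglyMeasurable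
    (ae_of_all _ fun x => abs_div_abs_le (V x))

/-- The equation `(-Δ_b + V) u = l u` in form sense, tested against test functions. -/
lemma weak_eq (hf : ContMDiff (𝓡 (2 * n + 1)) 𝓘(ℝ, Heis m) 2 f)
    (hiso : S.SemiIsometric f) (hhor : S.PreservesHorizontal f)
    (hΩo : IsOpen Ω) (hΩb : IsCompact (closure Ω)) (hV : LocallyIntegrableOn V Ω S.vol)
    {l : ℝ} (hu : S.IsDirichletSolution Ω V l u) (A : S.FormApprox Ω V f u φ p)
    {χ : M → ℝ} (hχ : IsTest n Ω χ) :
    ∑ α, ∫ x in Ω, p α x * S.carre (coordFn f α) χ x ∂S.vol +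
      ∫ x in Ω, (V x / |V x| * (√|V x| * u x)) * (√|V x| * χ x) ∂S.vol =
      l * ∫ x in Ω, u x * χ x ∂S.vol := by
  have hΔ : MemLp (S.subLaplacian χ) 2 (S.vol.restrict Ω) :=
    S.memLp_restrict hΩo hΩb (S.continuous_subLaplacian hχ.1)
  have hΓ : ∀ α, MemLp (S.carre (coordFn f α) χ) 2 (S.vol.restrict Ω) := fun α =>
    S.memLp_restrict hΩo hΩb (S.continuous_carre (contMDiff_coordFn hf α) hχ.1)
  have h1 : Tendsto (fun k => ∫ x in Ω, φ k x * S.subLaplacian χ x ∂S.vol) atTop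
      (𝓝 (∫ x in Ω, u x * S.subLaplacian χ x ∂S.vol)) := A.lim.integral_mul (.const hΔ)
  have h2 : Tendsto (fun k => ∑ α, ∫ x in Ω, S.carre (coordFn f α) (φ k) x *
      S.carre (coordFn f α) χ x ∂S.vol) atTop
      (𝓝 (∑ α, ∫ x in Ω, p α x * S.carre (coordFn f α) χ x ∂S.vol)) :=
    tendsto_finsetSum _ fun α _ => (A.lim_grad α).integral_mul (.const (hΓ α))
  have h3 : ∀ k, ∫ x in Ω, φ k x * S.subLaplacian χ x ∂S.vol = -∑ α, ∫ x in Ω,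
      S.carre (coordFn f α) (φ k) x * S.carre (coordFn f α) χ x ∂S.vol := by
    intro k
    rw [S.setIntegral_mul_subLaplacian hχ.1 (A.test k), ← integral_finsetSum _ fun α _ =>
      ((A.lim_grad α).memLp_seq k).integrable_mul_two (hΓ α)]
    simp only [S.sum_carre_mul_carre hf hiso hhor]
    simp only [S.carre_comm χ]
  have h4 : ∫ x in Ω, u x * S.subLaplacian χ x ∂S.vol =
      -∑ α, ∫ x in Ω, p α x * S.carre (coordFn f α) χ x ∂S.vol := by
    refine tendsto_nhds_unique h1 ?_
    simp only [h3]
    exact h2.neg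
  have h5 := hu.2 χ hχ
  have h6 : ∀ x, u x * (-S.subLaplacian χ x + V x * χ x) = -(u x * S.subLaplacian χ x) +
      (V x / |V x| * (√|V x| * u x)) * (√|V x| * χ x) := fun x => by
    rw [← mul_mul_eq_sqrt_abs_mul]; ring
  simp only [h6] at h5
  rw [integral_add, integral_neg, h4, neg_neg] at h5
  · exact h5
  · exact (A.lim.memLp.integrable_mul_two hΔ).neg
  · exact (A.lim_sign hV).memLp.integrable_mul_two (S.memLp_sqrt_mul_test hV hχ)

/-- The form equation of `u` tested against `h v`, for `v` in the form domain and `h` of class `C²`.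
The product rule for `Γ` splits the gradient of `h v`. -/
lemma weak_eq_mul (hf : ContMDiff (𝓡 (2 * n + 1)) 𝓘(ℝ, Heis m) 2 f)
    (hiso : S.SemiIsometric f) (hhor : S.PreservesHorizontal f)
    (hΩo : IsOpen Ω) (hΩb : IsCompact (closure Ω)) (hV : LocallyIntegrableOn V Ω S.vol)
    {l : ℝ} (hu : S.IsDirichletSolution Ω V l u) (A : S.FormApprox Ω V f u φ p)
    (B : S.FormApprox Ω V f v ψ q) {h : M → ℝ} (hh : ContMDiff (𝓡 (2 * n + 1)) 𝓘(ℝ, ℝ) 2 h) :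
    ∑ α, (∫ x in Ω, p α x * (h x * q α x) ∂S.vol +
        ∫ x in Ω, p α x * (S.carre (coordFn f α) h x * v x) ∂S.vol) +
      ∫ x in Ω, (V x / |V x| * (√|V x| * u x)) * (h x * (√|V x| * v x)) ∂S.vol =
      l * ∫ x in Ω, u x * (h x * v x) ∂S.vol := by
  obtain ⟨C, hC⟩ := S.exists_bound_restrict hΩo hΩb hh.continuous
  have hm : AEStronglyMeasurable h (S.vol.restrict Ω) := hh.continuous.aestronglyMeasurable
  have hcΓ : ∀ α, Continuous (S.carre (coordFn f α) h) := fun α =>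
    S.continuous_carre (contMDiff_coordFn hf α) hh
  have hw := fun k => A.weak_eq hf hiso hhor hΩo hΩb hV hu (isTest_mul hh (B.test k))
  have e1 : ∀ α, L2Lim (S.vol.restrict Ω)
      (fun k x => S.carre (coordFn f α) h x * ψ k x) (fun x => S.carre (coordFn f α) h x * v x) :=
    fun α => by
      obtain ⟨C, hC⟩ := S.exists_bound_restrict hΩo hΩb (hcΓ α)
      exact B.lim.bounded_mul (hcΓ α).aestronglyMeasurable hC
  have e2 := fun α => (B.lim_grad α).bounded_mul hm hC
  have hΓ : ∀ k α x, S.carre (coordFn f α) (h * ψ k) x =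
      h x * S.carre (coordFn f α) (ψ k) x + S.carre (coordFn f α) h x * ψ k x := fun k α x => by
    rw [S.carre_mul (hh.mdifferentiable (by simp) x) ((B.test k).1.mdifferentiable (by simp) x)]
    ring
  have hs : ∀ k α, ∫ x in Ω, p α x * S.carre (coordFn f α) (h * ψ k) x ∂S.vol =
      ∫ x in Ω, p α x * (h x * S.carre (coordFn f α) (ψ k) x) ∂S.vol +
      ∫ x in Ω, p α x * (S.carre (coordFn f α) h x * ψ k x) ∂S.vol := fun k α => by
    rw [← integral_add ((A.lim_grad α).memLp.integrable_mul_two ((e2 α).memLp_seq k))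
      ((A.lim_grad α).memLp.integrable_mul_two ((e1 α).memLp_seq k))]
    simp only [hΓ, mul_add]
  simp only [hs, Pi.mul_apply] at hw
  simp only [mul_left_comm (√|_|) (h _)] at hw
  have l1 := tendsto_finsetSum Finset.univ fun α _ =>
    ((L2Lim.const (A.lim_grad α).memLp).integral_mul (e2 α)).add
      ((L2Lim.const (A.lim_grad α).memLp).integral_mul (e1 α))
  have l2 := (L2Lim.const (A.lim_sign hV).memLp).integral_mul (B.lim_weight.bounded_mul hm hC)
  have l3 := ((L2Lim.const A.lim.memLp).integral_mul (B.lim.bounded_mul hm hC)).const_mul l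
  exact tendsto_nhds_unique (l1.add l2) (l3.congr fun k => (hw k).symm)

/-- The components `p α` of the gradient reproduce themselves under the Parseval frame. -/
lemma sum_integral_carre (hf : ContMDiff (𝓡 (2 * n + 1)) 𝓘(ℝ, Heis m) 2 f)
    (hiso : S.SemiIsometric f) (hhor : S.PreservesHorizontal f)
    (hΩo : IsOpen Ω) (hΩb : IsCompact (closure Ω)) (A : S.FormApprox Ω V f u φ p)
    (hv : MemLp v 2 (S.vol.restrict Ω)) (β : Fin m ⊕ Fin m) :
    ∑ α, ∫ x in Ω, p α x * (S.carre (coordFn f α) (coordFn f β) x * v x) ∂S.vol =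
      ∫ x in Ω, p β x * v x ∂S.vol := by
  have e1 : ∀ α, MemLp (fun x => S.carre (coordFn f α) (coordFn f β) x * v x) 2
      (S.vol.restrict Ω) := fun α => by
    have hc := S.continuous_carre (contMDiff_coordFn hf α) (contMDiff_coordFn hf β)
    obtain ⟨C, hC⟩ := S.exists_bound_restrict hΩo hΩb hc
    exact hv.bounded_mul hc.aestronglyMeasurable hC
  have l1 := tendsto_finsetSum Finset.univ fun α _ =>
    (A.lim_grad α).integral_mul (L2Lim.const (e1 α))
  have l2 := (A.lim_grad β).integral_mul (L2Lim.const hv)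
  refine tendsto_nhds_unique l1 (l2.congr fun k => ?_)
  rw [← integral_finsetSum _ fun α _ =>
    ((A.lim_grad α).memLp_seq k).integrable_mul_two (e1 α)]
  congr 1
  funext x
  rw [← S.sum_carre_mul_carre hf hiso hhor, Finset.sum_mul]
  exact Finset.sum_congr rfl fun α _ => by ring

/-- Integration by parts for the first-order part of the commutator. -/
lemma integral_grad_add (hf : ContMDiff (𝓡 (2 * n + 1)) 𝓘(ℝ, Heis m) 2 f)
    (hΩo : IsOpen Ω) (hΩb : IsCompact (closure Ω)) (A : S.FormApprox Ω V f u φ p)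
    (B : S.FormApprox Ω V f v ψ q) (β : Fin m ⊕ Fin m) :
    ∫ x in Ω, p β x * v x ∂S.vol + ∫ x in Ω, q β x * u x ∂S.vol =
      -∫ x in Ω, u x * (S.subLaplacian (coordFn f β) x * v x) ∂S.vol := by
  have hβ := contMDiff_coordFn hf β
  have hc := S.continuous_subLaplacian hβ
  obtain ⟨C, hC⟩ := S.exists_bound_restrict hΩo hΩb hc
  have e := B.lim.bounded_mul hc.aestronglyMeasurable hC
  have l1 := ((A.lim_grad β).integral_mul B.lim).add ((B.lim_grad β).integral_mul A.lim)
  have l2 := (A.lim.integral_mul e).neg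
  refine tendsto_nhds_unique l1 (l2.congr fun k => ?_)
  have h1 := S.setIntegral_mul_subLaplacian hβ (isTest_mul (A.test k).1 (B.test k))
  rw [← integral_add (((A.lim_grad β).memLp_seq k).integrable_mul_two (B.lim.memLp_seq k))
    (((B.lim_grad β).memLp_seq k).integrable_mul_two (A.lim.memLp_seq k)), neg_eq_iff_eq_neg]
  refine Eq.trans ?_ (h1.trans ?_)
  · congr 1; funext x; rw [Pi.mul_apply]; ring
  · congr 2; funext x
    rw [S.carre_mul ((A.test k).1.mdifferentiable (by simp) x)
      ((B.test k).1.mdifferentiable (by simp) x)]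
    ring

/-- Integration by parts against `F_α u²`; summed over `α`, it evaluates the pairing of the
commutator with `F_α u`. -/
lemma integral_coord_grad (hf : ContMDiff (𝓡 (2 * n + 1)) 𝓘(ℝ, Heis m) 2 f)
    (hΩo : IsOpen Ω) (hΩb : IsCompact (closure Ω)) (A : S.FormApprox Ω V f u φ p)
    (α : Fin m ⊕ Fin m) :
    2 * ∫ x in Ω, p α x * (coordFn f α x * u x) ∂S.vol +
      ∫ x in Ω, u x * (S.carre (coordFn f α) (coordFn f α) x * u x) ∂S.vol =
      -∫ x in Ω, (S.subLaplacian (coordFn f α) x * u x) * (coordFn f α x * u x) ∂S.vol := by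
  have hα := contMDiff_coordFn hf α
  have hc := S.continuous_subLaplacian hα
  have hΓ := S.continuous_carre hα hα
  obtain ⟨C, hC⟩ := S.exists_bound_restrict hΩo hΩb hc
  obtain ⟨C', hC'⟩ := S.exists_bound_restrict hΩo hΩb hα.continuous
  obtain ⟨C'', hC''⟩ := S.exists_bound_restrict hΩo hΩb hΓ
  have e1 := A.lim.bounded_mul hc.aestronglyMeasurable hC
  have e2 := A.lim.bounded_mul hα.continuous.aestronglyMeasurable hC'
  have e3 := A.lim.bounded_mul hΓ.aestronglyMeasurable hC''
  have l1 := (((A.lim_grad α).integral_mul e2).const_mul 2).add (A.lim.integral_mul e3)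
  have l2 := (e1.integral_mul e2).neg
  refine tendsto_nhds_unique l1 (l2.congr fun k => ?_)
  have h1 := S.setIntegral_mul_subLaplacian hα
    (isTest_mul hα (isTest_mul (A.test k).1 (A.test k)))
  rw [← integral_const_mul, ← integral_add
    ((((A.lim_grad α).memLp_seq k).integrable_mul_two (e2.memLp_seq k)).const_mul 2)
    ((A.lim.memLp_seq k).integrable_mul_two (e3.memLp_seq k)), neg_eq_iff_eq_neg]
  refine Eq.trans ?_ (h1.trans ?_)
  · congr 1; funext x; simp only [Pi.mul_apply]; ring
  · congr 2; funext x
    have d := (A.test k).1.mdifferentiable (by simp) x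
    rw [S.carre_mul (hα.mdifferentiable (by simp) x)
      (((A.test k).1.mul (A.test k).1).mdifferentiable (by simp) x), S.carre_mul d d]
    simp only [Pi.mul_apply]
    ring

lemma sum_integral_subLaplacian_grad (hf : ContMDiff (𝓡 (2 * n + 1)) 𝓘(ℝ, Heis m) 2 f)
    (hiso : S.SemiIsometric f) (hhor : S.PreservesHorizontal f)
    (hΩo : IsOpen Ω) (hΩb : IsCompact (closure Ω)) (A : S.FormApprox Ω V f u φ p) :
    ∑ α, ∫ x in Ω, (S.subLaplacian (coordFn f α) x * u x) * p α x ∂S.vol = 0 := by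
  have e1 : ∀ α, L2Lim (S.vol.restrict Ω) (fun k x => S.subLaplacian (coordFn f α) x * φ k x)
      (fun x => S.subLaplacian (coordFn f α) x * u x) := fun α => by
    have hc := S.continuous_subLaplacian (contMDiff_coordFn hf α)
    obtain ⟨C, hC⟩ := S.exists_bound_restrict hΩo hΩb hc
    exact A.lim.bounded_mul hc.aestronglyMeasurable hC
  have l1 := tendsto_finsetSum Finset.univ fun α _ => (e1 α).integral_mul (A.lim_grad α)
  refine tendsto_nhds_unique l1 (tendsto_const_nhds.congr fun k => ?_)
  rw [← integral_finsetSum _ fun α _ =>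
    ((e1 α).memLp_seq k).integrable_mul_two ((A.lim_grad α).memLp_seq k)]
  refine (integral_eq_zero_of_ae (ae_of_all _ fun x => ?_)).symm
  rw [Pi.zero_apply, ← mul_zero (φ k x), ← S.sum_subLaplacian_mul_carre hf hiso hhor (φ k) x,
    Finset.mul_sum]
  exact Finset.sum_congr rfl fun α _ => by ring

end FormApprox

end StrictlyPseudoconvexCR

end FormDomain

/-! ### Commutators and sum rules -/

section CommutatorIdentities

variable {n : ℕ} {M : Type*} [TopologicalSpace M] [ChartedSpace (ModelE n) M]
  [IsManifold (𝓡 (2 * n + 1)) ∞ M]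

namespace StrictlyPseudoconvexCR
variable (S : StrictlyPseudoconvexCR n M)
variable [T2Space M] [SecondCountableTopology M] [MeasurableSpace M] [BorelSpace M]
variable {Ω : Set M} {V : M → ℝ} {m : ℕ} {f : M → Heis m}

omit [T2Space M] [SecondCountableTopology M] [MeasurableSpace M] [BorelSpace M] in
lemma carre_const (φ : M → ℝ) (r : ℝ) (x : M) : S.carre φ (fun _ => r) x = 0 := by
  refine Finset.sum_eq_zero fun i _ => ?_
  have : dirDeriv (fun _ : M => r) x (S.onb x i) = 0 := by
    rw [dirDeriv, mvfderiv_const]; rfl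
  rw [this, mul_zero]

/-- The matrix entry `⟨F_α u_i, u_j⟩` of multiplication by the coordinate function
`F_α = coordFn f α`. -/
def coeff (f : M → Heis m) (Ω : Set M) (u : ℕ → M → ℝ) (α : Fin m ⊕ Fin m) (i j : ℕ) : ℝ :=
  ∫ x in Ω, (coordFn f α x * u i x) * u j x ∂S.vol

/-- The sum over `α` of the squared matrix entries `⟨F_α u_i, u_j⟩²`. -/
def weight (f : M → Heis m) (Ω : Set M) (u : ℕ → M → ℝ) (i j : ℕ) : ℝ :=
  ∑ α, S.coeff f Ω u α i j ^ 2

omit [T2Space M] [SecondCountableTopology M] [BorelSpace M] in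
lemma coeff_symm (u : ℕ → M → ℝ) (α : Fin m ⊕ Fin m) (i j : ℕ) :
    S.coeff f Ω u α i j = S.coeff f Ω u α j i := by
  rw [coeff, coeff]; congr 1; funext x; ring

/-- The functions `v α = [Δ_b, F_α] u_i = (Δ_b F_α) u_i + 2 Γ(F_α, u_i)`, with their Fourier
coefficients, their pairing with `F_α u_i`, and their norms. Since `F_α u_i` need not lie in the
domain of the operator, the commutator is formed in the sense of quadratic forms. -/
theorem exists_commutator (hf : ContMDiff (𝓡 (2 * n + 1)) 𝓘(ℝ, Heis m) 2 f)
    (hiso : S.SemiIsometric f) (hhor : S.PreservesHorizontal f)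
    (hΩo : IsOpen Ω) (hΩb : IsCompact (closure Ω)) (hV : LocallyIntegrableOn V Ω S.vol)
    {lam : ℕ → ℝ} {u : ℕ → M → ℝ} (hspec : S.IsDirichletSpectrum Ω V lam u) (i : ℕ) :
    Integrable (fun x => (S.leviTensionSq f x - 4 * V x) * u i x ^ 2) (S.vol.restrict Ω) ∧
    ∃ v : Fin m ⊕ Fin m → M → ℝ, (∀ α, MemLp (v α) 2 (S.vol.restrict Ω)) ∧
      (∀ α j, ∫ x in Ω, v α x * u j x ∂S.vol = (lam i - lam j) * S.coeff f Ω u α i j) ∧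
      ∑ α, ∫ x in Ω, v α x * (coordFn f α x * u i x) ∂S.vol = -(2 * n) ∧
      ∑ α, ∫ x in Ω, v α x * v α x ∂S.vol =
        4 * lam i + ∫ x in Ω, (S.leviTensionSq f x - 4 * V x) * u i x ^ 2 ∂S.vol := by
  have hA := fun i => S.exists_formApprox hf hiso hhor hΩo hΩb hV (hspec.eigen i).1
  choose φ p A using hA
  have hu : ∀ i, MemLp (u i) 2 (S.vol.restrict Ω) := fun i => (A i).lim.memLp
  have hp : ∀ i α, MemLp (p i α) 2 (S.vol.restrict Ω) := fun i α => ((A i).lim_grad α).memLp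
  have hΔ : ∀ i α, MemLp (fun x => S.subLaplacian (coordFn f α) x * u i x) 2
      (S.vol.restrict Ω) := fun i α => by
    have hc := S.continuous_subLaplacian (contMDiff_coordFn hf α)
    obtain ⟨C, hC⟩ := S.exists_bound_restrict hΩo hΩb hc
    exact (hu i).bounded_mul hc.aestronglyMeasurable hC
  have hF : ∀ i α, MemLp (fun x => coordFn f α x * u i x) 2 (S.vol.restrict Ω) := fun i α => by
    have hc := (contMDiff_coordFn hf α).continuous
    obtain ⟨C, hC⟩ := S.exists_bound_restrict hΩo hΩb hc
    exact (hu i).bounded_mul hc.aestronglyMeasurable hC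
  -- the commutator `⟨p i, u j⟩ - ⟨p j, u i⟩`
  have hcomm : ∀ α j, ∫ x in Ω, p i α x * u j x ∂S.vol - ∫ x in Ω, p j α x * u i x ∂S.vol =
      (lam i - lam j) * S.coeff f Ω u α i j := by
    intro α j
    have h := fun i j => (A i).weak_eq_mul hf hiso hhor hΩo hΩb hV (hspec.eigen i) (A j)
      (contMDiff_coordFn hf α)
    simp only [Finset.sum_add_distrib] at h
    have h1 := h i j
    have h2 := h j i
    rw [(A i).sum_integral_carre hf hiso hhor hΩo hΩb (hu j) α] at h1
    rw [(A j).sum_integral_carre hf hiso hhor hΩo hΩb (hu i) α] at h2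
    have s1 : ∑ β, ∫ x in Ω, p j β x * (coordFn f α x * p i β x) ∂S.vol =
        ∑ β, ∫ x in Ω, p i β x * (coordFn f α x * p j β x) ∂S.vol :=
      Finset.sum_congr rfl fun β _ => by congr 1; funext x; ring
    have s2 : ∫ x in Ω, (V x / |V x| * (√|V x| * u j x)) * (coordFn f α x * (√|V x| * u i x)) ∂S.vol
        = ∫ x in Ω, (V x / |V x| * (√|V x| * u i x)) * (coordFn f α x * (√|V x| * u j x))
          ∂S.vol := by
      congr 1; funext x; ring
    have s3 : ∫ x in Ω, u i x * (coordFn f α x * u j x) ∂S.vol = S.coeff f Ω u α i j := by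
      rw [coeff]; congr 1; funext x; ring
    have s4 : ∫ x in Ω, u j x * (coordFn f α x * u i x) ∂S.vol = S.coeff f Ω u α i j := by
      rw [coeff]; congr 1; funext x; ring
    rw [s3] at h1
    rw [s1, s2, s4] at h2
    linarith
  -- the energy identity `∑ ‖p i α‖² + ∫ V u² = λ`
  have henergy : ∑ α, ∫ x in Ω, p i α x * p i α x ∂S.vol +
      ∫ x in Ω, (V x / |V x| * (√|V x| * u i x)) * (√|V x| * u i x) ∂S.vol = lam i := by
    have h := (A i).weak_eq_mul hf hiso hhor hΩo hΩb hV (hspec.eigen i) (A i)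
      (h := fun _ => 1) contMDiff_const
    simp only [S.carre_const, one_mul, zero_mul, mul_zero, integral_zero, add_zero,
      hspec.orthonormal, if_true, mul_one] at h
    exact h
  have hVu : Integrable (fun x => (V x / |V x| * (√|V x| * u i x)) * (√|V x| * u i x))
      (S.vol.restrict Ω) := ((A i).lim_sign hV).memLp.integrable_mul_two (A i).lim_weight.memLp
  have hsq : ∀ x, (S.leviTensionSq f x - 4 * V x) * u i x ^ 2 =
      ∑ α, (S.subLaplacian (coordFn f α) x * u i x) * (S.subLaplacian (coordFn f α) x * u i x) -
      4 * ((V x / |V x| * (√|V x| * u i x)) * (√|V x| * u i x)) := by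
    intro x
    rw [← mul_mul_eq_sqrt_abs_mul, S.leviTensionSq_eq hf hhor, sub_mul, Finset.sum_mul]
    congr 1
    · exact Finset.sum_congr rfl fun α _ => by ring
    · ring
  have hI1 : Integrable (fun x => ∑ α, (S.subLaplacian (coordFn f α) x * u i x) *
      (S.subLaplacian (coordFn f α) x * u i x)) (S.vol.restrict Ω) :=
    integrable_finsetSum _ fun α _ => (hΔ i α).integrable_mul_two (hΔ i α)
  refine ⟨?_, fun α x => S.subLaplacian (coordFn f α) x * u i x + 2 * p i α x,
    fun α => (hΔ i α).add ((hp i α).const_mul 2), fun α j => ?_, ?_, ?_⟩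
  · simp only [hsq]
    exact hI1.sub (hVu.const_mul 4)
  · have h1 := (A i).integral_grad_add hf hΩo hΩb (A j) α
    have h2 := hcomm α j
    have h3 : ∫ x in Ω, u i x * (S.subLaplacian (coordFn f α) x * u j x) ∂S.vol =
        ∫ x in Ω, S.subLaplacian (coordFn f α) x * u i x * u j x ∂S.vol := by
      congr 1; funext x; ring
    simp only [add_mul, mul_assoc (2 : ℝ)]
    rw [integral_add ((hΔ i α).integrable_mul_two (hu j))
      (((hp i α).integrable_mul_two (hu j)).const_mul 2), integral_const_mul, ← h3]
    linarith
  · have h1 := fun α => (A i).integral_coord_grad hf hΩo hΩb α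
    have hΓ : ∀ α, MemLp (fun x => S.carre (coordFn f α) (coordFn f α) x * u i x) 2
        (S.vol.restrict Ω) := fun α => by
      have hc := S.continuous_carre (contMDiff_coordFn hf α) (contMDiff_coordFn hf α)
      obtain ⟨C, hC⟩ := S.exists_bound_restrict hΩo hΩb hc
      exact (hu i).bounded_mul hc.aestronglyMeasurable hC
    have h2 : ∑ α, ∫ x in Ω, u i x * (S.carre (coordFn f α) (coordFn f α) x * u i x) ∂S.vol =
        2 * n := by
      rw [← integral_finsetSum _ fun α _ => (hu i).integrable_mul_two (hΓ α)]
      have : ∀ x, ∑ α, u i x * (S.carre (coordFn f α) (coordFn f α) x * u i x) =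
          2 * n * (u i x * u i x) := fun x => by
        rw [← S.sum_carre_self hf hiso hhor x, Finset.sum_mul]
        exact Finset.sum_congr rfl fun α _ => by ring
      simp only [this]
      rw [integral_const_mul, hspec.orthonormal, if_pos rfl, mul_one]
    rw [← h2, ← Finset.sum_neg_distrib]
    refine Finset.sum_congr rfl fun α _ => ?_
    have h3 := h1 α
    simp only [add_mul, mul_assoc (2 : ℝ)]
    rw [integral_add ((hΔ i α).integrable_mul_two (hF i α))
      (((hp i α).integrable_mul_two (hF i α)).const_mul 2), integral_const_mul]
    linarith
  · have h1 := (A i).sum_integral_subLaplacian_grad hf hiso hhor hΩo hΩb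
    have e : ∀ α, ∫ x in Ω, (S.subLaplacian (coordFn f α) x * u i x + 2 * p i α x) *
        (S.subLaplacian (coordFn f α) x * u i x + 2 * p i α x) ∂S.vol =
        ∫ x in Ω, (S.subLaplacian (coordFn f α) x * u i x) *
          (S.subLaplacian (coordFn f α) x * u i x) ∂S.vol +
        (4 * ∫ x in Ω, (S.subLaplacian (coordFn f α) x * u i x) * p i α x ∂S.vol +
        4 * ∫ x in Ω, p i α x * p i α x ∂S.vol) := fun α => by
      rw [← integral_const_mul, ← integral_const_mul, ← integral_add, ← integral_add]
      · congr 1; funext x; ring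
      · exact (hΔ i α).integrable_mul_two (hΔ i α)
      · exact (((hΔ i α).integrable_mul_two (hp i α)).const_mul 4).add
          (((hp i α).integrable_mul_two (hp i α)).const_mul 4)
      · exact ((hΔ i α).integrable_mul_two (hp i α)).const_mul 4
      · exact ((hp i α).integrable_mul_two (hp i α)).const_mul 4
    simp only [e, hsq]
    rw [integral_sub hI1 (hVu.const_mul 4), integral_const_mul,
      integral_finsetSum _ fun α _ => (hΔ i α).integrable_mul_two (hΔ i α)]
    simp only [Finset.sum_add_distrib, ← Finset.mul_sum]
    rw [h1]
    linarith

/-- The sum rules of first and second order, by Parseval's identity. -/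
theorem hasSum_weight (hf : ContMDiff (𝓡 (2 * n + 1)) 𝓘(ℝ, Heis m) 2 f)
    (hiso : S.SemiIsometric f) (hhor : S.PreservesHorizontal f)
    (hΩo : IsOpen Ω) (hΩb : IsCompact (closure Ω)) (hV : LocallyIntegrableOn V Ω S.vol)
    {lam : ℕ → ℝ} {u : ℕ → M → ℝ} (hspec : S.IsDirichletSpectrum Ω V lam u) (i : ℕ) :
    HasSum (fun j => (lam j - lam i) * S.weight f Ω u i j) (2 * n) ∧
    HasSum (fun j => (lam j - lam i) ^ 2 * S.weight f Ω u i j)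
      (4 * lam i + ∫ x in Ω, (S.leviTensionSq f x - 4 * V x) * u i x ^ 2 ∂S.vol) := by
  obtain ⟨-, v, hv, hvu, hvF, hvv⟩ := S.exists_commutator hf hiso hhor hΩo hΩb hV hspec i
  have hu : ∀ i, MemLp (u i) 2 (S.vol.restrict Ω) := fun i => (hspec.eigen i).1.1
  have hF : ∀ α, MemLp (fun x => coordFn f α x * u i x) 2 (S.vol.restrict Ω) := fun α => by
    have hc := (contMDiff_coordFn hf α).continuous
    obtain ⟨C, hC⟩ := S.exists_bound_restrict hΩo hΩb hc
    exact (hu i).bounded_mul hc.aestronglyMeasurable hC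
  constructor
  · have h := hasSum_sum (s := Finset.univ) fun α _ =>
      hasSum_integral_mul hu hspec.orthonormal hspec.complete (hv α) (hF α)
    rw [hvF] at h
    have h' := h.neg
    rw [neg_neg] at h'
    refine (funext fun j => ?_ : (fun j => (lam j - lam i) * S.weight f Ω u i j) = _) ▸ h'
    rw [weight, Finset.mul_sum, ← Finset.sum_neg_distrib]
    refine Finset.sum_congr rfl fun α _ => ?_
    rw [hvu, show ∫ x in Ω, coordFn f α x * u i x * u j x ∂S.vol = S.coeff f Ω u α i j from rfl]
    ring
  · have h := hasSum_sum (s := Finset.univ) fun α _ =>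
      hasSum_integral_mul hu hspec.orthonormal hspec.complete (hv α) (hv α)
    rw [hvv] at h
    refine (funext fun j => ?_ : (fun j => (lam j - lam i) ^ 2 * S.weight f Ω u i j) = _) ▸ h
    rw [weight, Finset.mul_sum]
    refine Finset.sum_congr rfl fun α _ => ?_
    rw [hvu]
    ring

end StrictlyPseudoconvexCR

end CommutatorIdentities

/-! ### Eigenvalue bounds -/

section EigenvalueBounds

variable {n k : ℕ} {lam D : ℕ → ℝ} {w : ℕ → ℕ → ℝ}

/-- The universal inequality with the constants of the sub-Laplacian. -/
theorem yang_inequality (hn : 1 ≤ n) (hmono : Monotone lam)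
    (hw : ∀ i j, 0 ≤ w i j) (hsymm : ∀ i j, w i j = w j i)
    (h1 : ∀ i, HasSum (fun j => (lam j - lam i) * w i j) (2 * n))
    (h2 : ∀ i, HasSum (fun j => (lam j - lam i) ^ 2 * w i j) (4 * lam i + D i)) (p : ℝ) :
    ∑ i ∈ (Finset.range k).filter (fun i => 1 ≤ p ∨ lam i < lam k), (lam k - lam i) ^ p ≤
      max 2 p / n * ∑ i ∈ (Finset.range k).filter (fun i => 1 ≤ p ∨ lam i < lam k),
        (lam k - lam i) ^ (p - 1) * (lam i + 1 / 4 * D i) := by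
  have hn0 : (0 : ℝ) < n := by exact_mod_cast hn
  set F := (Finset.range k).filter fun i => 1 ≤ p ∨ lam i < lam k
  have h := sum_rpow_le_of_commutator hw hsymm h1 h2 (z := lam k) (p := p) (F := F)
    (fun i hi => hmono (Finset.mem_range.1 (Finset.mem_filter.1 hi).1).le)
    (fun i hi => by
      rcases le_or_gt k i with hk | hk
      · exact hmono hk
      · by_contra hlt
        exact hi (Finset.mem_filter.2 ⟨Finset.mem_range.2 hk, Or.inr (not_le.1 hlt)⟩))
    (fun i hi => (Finset.mem_filter.1 hi).2)
  rw [← Finset.sum_mul] at h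
  have e1 : ∑ i ∈ F, (lam k - lam i) ^ (p - 1) * (4 * lam i + D i) =
      4 * ∑ i ∈ F, (lam k - lam i) ^ (p - 1) * (lam i + 1 / 4 * D i) := by
    rw [Finset.mul_sum]; exact Finset.sum_congr rfl fun _ _ => by ring
  have e2 : max 2 p = 2 * max 1 (p / 2) := by
    rw [mul_max_of_nonneg _ _ (by norm_num : (0 : ℝ) ≤ 2)]; congr 1 <;> ring
  rw [e1] at h
  rw [e2, div_mul_eq_mul_div, le_div_iff₀ hn0]
  linarith

/-- The case `p = 1`, with `D i` replaced by an upper bound. -/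
theorem le_mean_of_commutator (hn : 1 ≤ n) (hk : 1 ≤ k) (hmono : Monotone lam)
    (hw : ∀ i j, 0 ≤ w i j) (hsymm : ∀ i j, w i j = w j i)
    (h1 : ∀ i, HasSum (fun j => (lam j - lam i) * w i j) (2 * n))
    (h2 : ∀ i, HasSum (fun j => (lam j - lam i) ^ 2 * w i j) (4 * lam i + D i)) {Ds : ℝ}
    (hD : ∀ i, D i ≤ Ds) :
    lam k ≤ (1 + 2 / n) * (1 / k * ∑ i ∈ Finset.range k, lam i) + 1 / (2 * n) * Ds := by
  have hn0 : (0 : ℝ) < n := by exact_mod_cast hn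
  have hk0 : (0 : ℝ) < k := by exact_mod_cast hk
  have h := yang_inequality (k := k) hn hmono hw hsymm h1 h2 1
  simp only [le_refl, true_or, Finset.filter_true, Real.rpow_one, sub_self, Real.rpow_zero,
    one_mul, Finset.sum_sub_distrib, Finset.sum_const, Finset.card_range, nsmul_eq_mul] at h
  rw [max_eq_left (by norm_num)] at h
  have h3 : ∑ i ∈ Finset.range k, (lam i + 1 / 4 * D i) ≤
      ∑ i ∈ Finset.range k, lam i + k * (1 / 4 * Ds) := by
    rw [Finset.sum_add_distrib]
    have := Finset.sum_le_card_nsmul (Finset.range k) (fun i => 1 / 4 * D i) (1 / 4 * Ds)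
      fun i _ => by linarith [hD i]
    rw [Finset.card_range, nsmul_eq_mul] at this
    linarith
  have h4 := h.trans (mul_le_mul_of_nonneg_left h3 (by positivity : (0 : ℝ) ≤ 2 / n))
  have h5 : k * lam k ≤ k * ((1 + 2 / n) * (1 / k * ∑ i ∈ Finset.range k, lam i)
      + 1 / (2 * n) * Ds) := by
    have e : k * ((1 + 2 / n) * (1 / k * ∑ i ∈ Finset.range k, lam i) + 1 / (2 * n) * Ds) =
        ∑ i ∈ Finset.range k, lam i + 2 / n * (∑ i ∈ Finset.range k, lam i + k * (1 / 4 * Ds)) := by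
      field_simp; ring
    rw [e]; linarith
  exact le_of_mul_le_mul_left h5 hk0

/-- The case `p = 2` at all thresholds `z ≤ λ_k + D/4` is a differential inequality for Riesz means
of the shifted eigenvalues `λ_i + D/4`, to which `le_mul_rpow_of_riesz` applies. The lowest shifted
eigenvalue is positive because the sum rules exclude `4 λ_0 + D_0 = 0`. -/
theorem le_rpow_of_commutator (hn : 1 ≤ n) (hk : 1 ≤ k) (hmono : Monotone lam)
    (hw : ∀ i j, 0 ≤ w i j) (hsymm : ∀ i j, w i j = w j i)
    (h1 : ∀ i, HasSum (fun j => (lam j - lam i) * w i j) (2 * n))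
    (h2 : ∀ i, HasSum (fun j => (lam j - lam i) ^ 2 * w i j) (4 * lam i + D i)) {Ds : ℝ}
    (hD : ∀ i, D i ≤ Ds) :
    lam k ≤ (1 + 2 / n) * (k : ℝ) ^ (1 / (n : ℝ)) * lam 0
      + 1 / 4 * ((1 + 2 / n) * (k : ℝ) ^ (1 / (n : ℝ)) - 1) * Ds := by
  have hn0 : (0 : ℝ) < n := by exact_mod_cast hn
  set a : ℕ → ℝ := fun i => lam i + Ds / 4 with ha
  -- if the second-order sum vanishes, then so does every term of the first-order sum `2n`
  have hc0 : 0 < 4 * lam 0 + D 0 := by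
    have hnn : ∀ j, 0 ≤ (lam j - lam 0) ^ 2 * w 0 j := fun j => mul_nonneg (sq_nonneg _) (hw 0 j)
    refine ((h2 0).nonneg hnn).lt_of_ne' fun h0 => ?_
    have h3 := (hasSum_zero_iff_of_nonneg hnn).1 (h0 ▸ h2 0)
    have h4 : (fun j => (lam j - lam 0) * w 0 j) = 0 := by
      funext j
      have h5 := congrFun h3 j
      simp only [Pi.zero_apply, mul_eq_zero, pow_eq_zero_iff two_ne_zero] at h5
      exact mul_eq_zero.2 h5
    have h6 := h1 0
    rw [h4] at h6
    have h7 := h6.unique hasSum_zero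
    linarith
  have ha0 : 0 < a 0 := by simp only [ha]; linarith [hD 0]
  have h := le_mul_rpow_of_riesz (a := a) hn hk ha0 fun z hz => ?_
  · simp only [ha] at h
    linarith
  set F := (Finset.range k).filter fun i => a i < z
  have h3 := sum_rpow_le_of_commutator hw hsymm h1 h2 (z := z - Ds / 4) (p := 2) (F := F)
    (fun i hi => by
      have := (Finset.mem_filter.1 hi).2
      simp only [ha] at this
      linarith)
    (fun i hi => by
      have hzi : z ≤ a i := by
        rcases le_or_gt k i with hk | hk
        · exact hz.trans (add_le_add_left (hmono hk) _)
        · by_contra hlt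
          exact hi (Finset.mem_filter.2 ⟨Finset.mem_range.2 hk, not_le.1 hlt⟩)
      simp only [ha] at hzi
      linarith)
    (fun i _ => Or.inl one_le_two)
  have e : ∀ i, z - Ds / 4 - lam i = z - a i := fun i => by simp only [ha]; ring
  norm_num [e] at h3
  have hmax : ∀ r : ℕ, 1 ≤ r → ∑ i ∈ Finset.range k, max (z - a i) 0 ^ r =
      ∑ i ∈ F, (z - a i) ^ r := by
    intro r hr
    rw [Finset.sum_filter]
    refine Finset.sum_congr rfl fun i _ => ?_
    split_ifs with hi
    · rw [max_eq_left (by linarith)]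
    · rw [max_eq_right (by linarith [not_lt.1 hi]), zero_pow (by omega)]
  have h4 := hmax 1 le_rfl
  simp only [pow_one] at h4
  rw [hmax 2 (by norm_num), h4]
  have h5 : ∑ i ∈ F, (z - a i) * (4 * lam i + D i) ≤
      4 * (z * ∑ i ∈ F, (z - a i)) - 4 * ∑ i ∈ F, (z - a i) ^ 2 := by
    rw [Finset.mul_sum, Finset.mul_sum, Finset.mul_sum, ← Finset.sum_sub_distrib]
    refine Finset.sum_le_sum fun i hi => ?_
    have hi' := (Finset.mem_filter.1 hi).2
    have : (z - a i) * (4 * lam i + D i) ≤ (z - a i) * (4 * a i) :=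
      mul_le_mul_of_nonneg_left (by simp only [ha]; linarith [hD i]) (by linarith)
    linarith
  rw [← Finset.sum_mul] at h3
  have h6 := h3.trans h5
  have h7 : (2 * (n : ℝ)) * ((1 + 2 / n) * ∑ i ∈ F, (z - a i) ^ 2) ≤
      (2 * (n : ℝ)) * (2 / n * (z * ∑ i ∈ F, (z - a i))) := by
    have e1 : (2 * (n : ℝ)) * ((1 + 2 / n) * ∑ i ∈ F, (z - a i) ^ 2) =
      2 * n * ∑ i ∈ F, (z - a i) ^ 2 + 4 * ∑ i ∈ F, (z - a i) ^ 2 := by field_simp; ring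
    have e2 : (2 * (n : ℝ)) * (2 / n * (z * ∑ i ∈ F, (z - a i))) =
      4 * (z * ∑ i ∈ F, (z - a i)) := by field_simp; ring
    rw [e1, e2]; linarith
  exact le_of_mul_le_mul_left h7 (by positivity)

end EigenvalueBounds

end

theorem theorem5p1 (n m : ℕ) (hn : 1 ≤ n) (M : Type*) [TopologicalSpace M] [T2Space M]
    [SecondCountableTopology M] [MeasurableSpace M] [BorelSpace M]
    [ChartedSpace (ModelE n) M] [IsManifold (𝓡 (2 * n + 1)) ∞ M]
    (S : StrictlyPseudoconvexCR n M)
    (f : M → Heis m) (hf : ContMDiff (𝓡 (2 * n + 1)) 𝓘(ℝ, Heis m) 2 f)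
    (hiso : S.SemiIsometric f) (hhor : S.PreservesHorizontal f)
    (Ω : Set M) (hΩo : IsOpen Ω) (hΩc : IsConnected Ω) (hΩb : IsCompact (closure Ω))
    (V : M → ℝ) (hV : LocallyIntegrableOn V Ω S.vol)
    (lam : ℕ → ℝ) (u : ℕ → M → ℝ) (hspec : S.IsDirichletSpectrum Ω V lam u) :
    -- `lam j` is `λ_{j+1}` and `u j` is `u_{j+1}`
    (∀ k : ℕ, 1 ≤ k → ∀ p : ℝ,
      (∀ i < k, Integrable (fun x => (S.leviTensionSq f x - 4 * V x) * u i x ^ 2)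
        (S.vol.restrict Ω)) ∧
      -- for `p < 1` the terms with `λ_i = λ_{k+1}`, which are undefined, are left out
      ∑ i ∈ (Finset.range k).filter (fun i => 1 ≤ p ∨ lam i < lam k), (lam k - lam i) ^ p ≤
        max 2 p / n * ∑ i ∈ (Finset.range k).filter (fun i => 1 ≤ p ∨ lam i < lam k),
          (lam k - lam i) ^ (p - 1) * (lam i + 1 / 4 *
            ∫ x in Ω, (S.leviTensionSq f x - 4 * V x) * u i x ^ 2 ∂S.vol)) ∧
    (BddBelow (V '' Ω) →
      BddAbove ((fun x => S.leviTensionSq f x - 4 * V x) '' Ω) ∧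
      ∀ k : ℕ, 1 ≤ k →
        lam k ≤ (1 + 2 / n) * (1 / k * ∑ i ∈ Finset.range k, lam i)
          + 1 / (2 * n) * sSup ((fun x => S.leviTensionSq f x - 4 * V x) '' Ω) ∧
        lam k ≤ (1 + 2 / n) * (k : ℝ) ^ (1 / (n : ℝ)) * lam 0
          + 1 / 4 * ((1 + 2 / n) * (k : ℝ) ^ (1 / (n : ℝ)) - 1)
            * sSup ((fun x => S.leviTensionSq f x - 4 * V x) '' Ω)) := by
  set D : ℕ → ℝ := fun i => ∫ x in Ω, (S.leviTensionSq f x - 4 * V x) * u i x ^ 2 ∂S.vol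
  have hint : ∀ i, Integrable (fun x => (S.leviTensionSq f x - 4 * V x) * u i x ^ 2)
      (S.vol.restrict Ω) := fun i =>
    (S.exists_commutator hf hiso hhor hΩo hΩb hV hspec i).1
  have hw : ∀ i j, 0 ≤ S.weight f Ω u i j := fun i j => Finset.sum_nonneg fun _ _ => sq_nonneg _
  have hsymm : ∀ i j, S.weight f Ω u i j = S.weight f Ω u j i := fun i j =>
    Finset.sum_congr rfl fun α _ => by rw [S.coeff_symm]
  have h1 := fun i => (S.hasSum_weight hf hiso hhor hΩo hΩb hV hspec i).1
  have h2 := fun i => (S.hasSum_weight hf hiso hhor hΩo hΩb hV hspec i).2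
  refine ⟨fun k _ p => ⟨fun i _ => hint i,
    yang_inequality (D := D) hn hspec.mono hw hsymm h1 h2 p⟩, fun hVb => ?_⟩
  -- `|H_b(f)|²` is continuous on `M`, hence bounded on the compact closure of `Ω`
  have hbdd : BddAbove ((fun x => S.leviTensionSq f x - 4 * V x) '' Ω) := by
    obtain ⟨b, hb⟩ := hVb
    have hc : Continuous fun x => S.leviTensionSq f x := by
      simp only [S.leviTensionSq_eq hf hhor]
      exact continuous_finsetSum _ fun α _ =>
        (S.continuous_subLaplacian
          (StrictlyPseudoconvexCR.contMDiff_coordFn hf α)).pow 2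
    obtain ⟨C, hC⟩ := hΩb.exists_bound_of_continuousOn hc.continuousOn
    refine ⟨C - 4 * b, ?_⟩
    rintro _ ⟨x, hx, rfl⟩
    have h3 := (le_abs_self _).trans (hC x (subset_closure hx))
    have h4 := hb (mem_image_of_mem V hx)
    simp only
    linarith
  set Ds := sSup ((fun x => S.leviTensionSq f x - 4 * V x) '' Ω)
  have hD : ∀ i, D i ≤ Ds := by
    intro i
    have h3 : Ds = ∫ x in Ω, Ds * (u i x * u i x) ∂S.vol := by
      rw [integral_const_mul, hspec.orthonormal, if_pos rfl, mul_one]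
    rw [h3]
    refine setIntegral_mono_on (hint i) (((hspec.eigen i).1.1.integrable_mul_two
      (hspec.eigen i).1.1).const_mul Ds) hΩo.measurableSet fun x hx => ?_
    rw [← sq]
    exact mul_le_mul_of_nonneg_right (le_csSup hbdd (mem_image_of_mem _ hx)) (sq_nonneg _)
  exact ⟨hbdd, fun k hk => ⟨le_mean_of_commutator hn hk hspec.mono hw hsymm h1 h2 hD,
    le_rpow_of_commutator hn hk hspec.mono hw hsymm h1 h2 hD⟩⟩
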